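/- A financial network $\mathcal F=(N,e,c)$ has banks $N=\{1,\dots,n\}$, external assets $e_i\in\mathbb Q_{\ge 0}$, debt contracts with notionals $c_{i,j}\in\mathbb Q_{\ge 0}$ (debtor $i$, creditor $j$; $c_{i,i}=0$) and credit default swaps (CDSes) with notionals $c_{i,j}^k\in\mathbb Q_{\ge 0}$ (debtor $i$, creditor $j$, reference bank $k$; $c_{i,j}^k=0$ unless $i,j,k$ are distinct). For $r\in[0,1]^n$ put $l_{i,j}(r)=c_{i,j}+\sum_k(1-r_k)c_{i,j}^k$, $l_i(r)=\sum_j l_{i,j}(r)$ and $a_i(r)=e_i+\sum_j r_j\,l_{j,i}(r)$. The vector $r$ is clearing if for every bank $i$: $r_i=\min\{1,a_i(r)/l_i(r)\}$ if $l_i(r)>0$, and $r_i=1$ if $l_i(r)=0$. The network is non-degenerate if every reference bank of a CDS of nonzero notional is the debtor of a debt contract of nonzero notional, and every debtor of a CDS of nonzero notional has positive external assets or is the debtor of a debt contract of nonzero notional. It has the central CDS debtor property if there is a bank $d$ such that $c_{i,j}^k\ne 0$ implies $i=d$, $c_{d,i}=0$ for all $i$, and $e_d\ge\sum_{j,k}c_{d,j}^k$.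 Theorem. There are a deterministic algorithm and a polynomial $p$ such that for every non-degenerate financial network $\mathcal F$ with the central CDS debtor property, the algorithm on input $\mathcal F$ halts and outputs an exact rational clearing vector of $\mathcal F$ in time at most $p(|\mathcal F|)\cdot 2^{n}$, where $n$ is the number of banks and $|\mathcal F|$ is the bit length of the input. (Time is the logarithmic cost, in bit operations up to polynomial factors, on a random access machine with integer registers; the input is the list of $n$ and of the numerators and denominators of all $e_i$, $c_{i,j}$, $c_{i,j}^k$.) -/

import Mathlib

/-! ### Financial networks -/

/-- A financial network on the banks `Fin n`: external assets, notionals of debt contracts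
(`debt i j` is what `i` owes to `j`) and notionals of credit default swaps
(`cds i j k` is the CDS with debtor `i`, creditor `j` and reference bank `k`).
An absent contract is a contract with notional `0`. -/
structure FinancialNetwork (n : ℕ) where
  assets : Fin n → ℚ≥0
  debt : Fin n → Fin n → ℚ≥0
  cds : Fin n → Fin n → Fin n → ℚ≥0
  debt_self : ∀ i, debt i i = 0
  cds_distinct : ∀ i j k, cds i j k ≠ 0 → i ≠ j ∧ i ≠ k ∧ j ≠ k

namespace FinancialNetwork

variable {n : ℕ}

/-- Liability of bank `i` to bank `j` under the recovery rates `r`. -/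
noncomputable def liability (F : FinancialNetwork n) (r : Fin n → ℝ) (i j : Fin n) : ℝ :=
  (F.debt i j : ℝ) + ∑ k, (1 - r k) * (F.cds i j k : ℝ)

/-- Total liability of bank `i`. -/
noncomputable def totalLiability (F : FinancialNetwork n) (r : Fin n → ℝ) (i : Fin n) : ℝ :=
  ∑ j, F.liability r i j

/-- Proportional payment of bank `i` to bank `j`. -/
noncomputable def payment (F : FinancialNetwork n) (r : Fin n → ℝ) (i j : Fin n) : ℝ :=
  r i * F.liability r i j

/-- Assets of bank `i`: external assets and incoming payments. -/
noncomputable def totalAssets (F : FinancialNetwork n) (r : Fin n → ℝ) (i : Fin n) : ℝ :=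
  (F.assets i : ℝ) + ∑ j, F.payment r j i

/-- Clearing recovery rate vectors. -/
def IsClearing (F : FinancialNetwork n) (r : Fin n → ℝ) : Prop :=
  (∀ i, r i ∈ Set.Icc (0 : ℝ) 1) ∧
  ∀ i, (0 < F.totalLiability r i → r i = min 1 (F.totalAssets r i / F.totalLiability r i)) ∧
    (F.totalLiability r i = 0 → r i = 1)

/-- Every reference bank is the debtor of a debt contract, and every CDS debtor has positive
external assets or is the debtor of a debt contract. -/
def NonDegenerate (F : FinancialNetwork n) : Prop :=
  (∀ k, (∃ i j, F.cds i j k ≠ 0) → ∃ j, F.debt k j ≠ 0) ∧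
  ∀ i, (∃ j k, F.cds i j k ≠ 0) → 0 < F.assets i ∨ ∃ j, F.debt i j ≠ 0

/-- Some bank `d` is the debtor of all CDSes, is the debtor of no debt contract, and has external
assets at least the sum of the notionals of all its CDSes. -/
def CentralCDSDebtor (F : FinancialNetwork n) : Prop :=
  ∃ d, (∀ i j k, F.cds i j k ≠ 0 → i = d) ∧ (∀ i, F.debt d i = 0) ∧
    ∑ j, ∑ k, F.cds d j k ≤ F.assets d

/-- A nonnegative rational as numerator and denominator in lowest terms. -/
def encodeRat (q : ℚ≥0) : List ℤ := [(q.num : ℤ), (q.den : ℤ)]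

/-- The network as a list of integers: the number of banks, then all external assets, all debt
notionals and all CDS notionals, in lexicographic order of the indices. -/
def encode (F : FinancialNetwork n) : List ℤ :=
  [(n : ℤ)] ++
  ((List.finRange n).flatMap fun i => encodeRat (F.assets i)) ++
  ((List.finRange n).flatMap fun i => (List.finRange n).flatMap fun j =>
    encodeRat (F.debt i j)) ++
  ((List.finRange n).flatMap fun i => (List.finRange n).flatMap fun j =>
    (List.finRange n).flatMap fun k => encodeRat (F.cds i j k))

end FinancialNetwork

/-! ### Random access machines with integer registers and logarithmic cost -/

namespace RAM

/-- Number of binary digits of `|z|`, plus one for the sign. -/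
def bitLength (z : ℤ) : ℕ := Nat.size z.natAbs + 1

/-- Bit length of a list of integers. -/
def listBitLength (l : List ℤ) : ℕ := (l.map bitLength).sum

/-- A memory: the content of the register at each index of each array. The arrays are numbered,
and a program names only finitely many of them. -/
abbrev Memory := ℕ → ℤ → ℤ

/-- Integer expressions. `get a e` is the register of array `a` at the index given by `e`
(indirect addressing). -/
inductive Expr where
  | const (z : ℤ)
  | get (a : ℕ) (e : Expr)
  | add (e f : Expr)
  | sub (e f : Expr)
  | mul (e f : Expr)
  | div (e f : Expr)

/-- Value of an expression. Division is Euclidean division of integers, and `x / 0 = 0`. -/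
def Expr.eval (m : Memory) : Expr → ℤ
  | .const z => z
  | .get a e => m a (e.eval m)
  | .add e f => e.eval m + f.eval m
  | .sub e f => e.eval m - f.eval m
  | .mul e f => e.eval m * f.eval m
  | .div e f => e.eval m / f.eval m

/-- Logarithmic cost of evaluating an expression: the sum of the bit lengths of the values of all
its subexpressions, including the addresses used. -/
def Expr.cost (m : Memory) : Expr → ℕ
  | .const z => bitLength z
  | .get a e => e.cost m + bitLength (m a (e.eval m))
  | .add e f => e.cost m + f.cost m + bitLength (e.eval m + f.eval m)
  | .sub e f => e.cost m + f.cost m + bitLength (e.eval m - f.eval m)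
  | .mul e f => e.cost m + f.cost m + bitLength (e.eval m * f.eval m)
  | .div e f => e.cost m + f.cost m + bitLength (e.eval m / f.eval m)

/-- Programs. `put a e f` writes the value of `f` into array `a` at index `e`; `branch` and `loop`
test whether the value of the expression is positive. -/
inductive Program where
  | skip
  | put (a : ℕ) (e f : Expr)
  | seq (P Q : Program)
  | branch (e : Expr) (P Q : Program)
  | loop (e : Expr) (P : Program)

/-- The memory `m` after writing `v` into array `a` at index `i`. -/
def Memory.write (m : Memory) (a : ℕ) (i v : ℤ) : Memory :=
  fun b j => if b = a ∧ j = i then v else m b j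

/-- `Runs P m m' t`: started in memory `m`, the program `P` halts in memory `m'`, and the run has
logarithmic cost `t`. -/
inductive Runs : Program → Memory → Memory → ℕ → Prop where
  | skip (m : Memory) : Runs .skip m m 1
  | put (m : Memory) (a : ℕ) (e f : Expr) :
      Runs (.put a e f) m (m.write a (e.eval m) (f.eval m)) (e.cost m + f.cost m + 1)
  | seq {P Q : Program} {m m' m'' : Memory} {t u : ℕ} :
      Runs P m m' t → Runs Q m' m'' u → Runs (.seq P Q) m m'' (t + u)
  | branch_pos {e : Expr} {P Q : Program} {m m' : Memory} {t : ℕ} :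
      0 < e.eval m → Runs P m m' t → Runs (.branch e P Q) m m' (e.cost m + t + 1)
  | branch_nonpos {e : Expr} {P Q : Program} {m m' : Memory} {t : ℕ} :
      e.eval m ≤ 0 → Runs Q m m' t → Runs (.branch e P Q) m m' (e.cost m + t + 1)
  | loop_pos {e : Expr} {P : Program} {m m' m'' : Memory} {t u : ℕ} :
      0 < e.eval m → Runs P m m' t → Runs (.loop e P) m' m'' u →
      Runs (.loop e P) m m'' (e.cost m + t + u + 1)
  | loop_nonpos {e : Expr} {P : Program} {m : Memory} :
      e.eval m ≤ 0 → Runs (.loop e P) m m (e.cost m + 1)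

/-- The initial memory: the input list stands in array `0` from index `0` on, and all other
registers are `0`. -/
def initial (l : List ℤ) : Memory :=
  fun a i => if a = 0 ∧ 0 ≤ i then l.getD i.toNat 0 else 0

/-- The final memory `m` presents the rational vector `r` as output: array `1` holds, from index
`0` on, the entries of `r` as pairs of a numerator and a positive denominator. -/
def Outputs (m : Memory) {n : ℕ} (r : Fin n → ℚ) : Prop :=
  ∀ i : Fin n, 0 < m 1 (2 * (i : ℕ) + 1) ∧
    r i = (m 1 (2 * (i : ℕ)) : ℚ) / (m 1 (2 * (i : ℕ) + 1) : ℚ)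

end RAM

/-! The central debtor `d` owes no debt and its external assets cover all its CDS notionals, so `r d
= 1` and `d` pays in full. Every other bank then has a constant liability `l i`, the sum of its
debts, and all assets are affine in `r`, say `(E + C r) i`. With `l d` set to `0`, clearing follows
from `r i = min 1 ((E + C r) i / l i)`, with `r i = 1` where `l i = 0`
(`CentralCDSDebtor.isClearing`). Entries of `C` may be negative, so the equations need not be
monotone; but assets are nonnegative on the cube, and Brouwer's theorem gives a solution.

A solution determines the region `S` of the banks with `l i > 0` and `l i * r i = (E + C r) i`; off
`S` its value is `1`. Once `S` is guessed, `r` solves a linear system, and a solution of that system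
is accepted when the remaining inequalities hold. The algorithm tries the `2 ^ n` regions in turn.
The obstacle is that the system of a region may be singular. `exists_nonsingular_region` shows that
some regular region always works: replace `E i` by `E i + ε ^ (i + 1)`. A singular region is
compatible with only finitely many `ε`, since a left kernel vector turns compatibility into a
nontrivial polynomial equation in `ε`. So for small `ε > 0` all solutions lie in regular regions,
one region recurs as `ε` tends to `0`, and its solution, continuous in `ε`, converges to an
admissible solution of the original system.

Brouwer's theorem is derived from Scarf's lemma (`Scarf.exists_colorful`), a parity argument on
doors and rooms, applied to finer and finer grids of the simplex.

For the running time, the input is scaled to integers and each system is solved by the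
Faddeev-LeVerrier recursion, whose divisions are exact (`Matrix.faddeev_eq`). All intermediate
numbers are at most `(2 ^ L) ^ O(n)` for inputs of bit length `L` (`bd_faddeev`), so each region
costs polynomially many bit operations. The runs of the program are analysed by loop rules that
carry an invariant, a bound on the registers and a cost. -/

namespace RAM

/-! ### Bit lengths -/

lemma bitLength_pos (z : ℤ) : 1 ≤ bitLength z := Nat.le_add_left _ _

lemma bitLength_le_of_lt {z : ℤ} {b : ℕ} (h : z.natAbs < 2 ^ b) : bitLength z ≤ b + 1 :=
  Nat.add_le_add_right (Nat.size_le.2 h) 1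

lemma natAbs_lt_two_pow_bitLength_sub_one (z : ℤ) : z.natAbs < 2 ^ (bitLength z - 1) := by
  simpa [bitLength] using Nat.lt_size_self z.natAbs

/-- Each sign bit on the right is one spare binary digit: one of them pays for the sign of `z`, the
other for the factor `2`. That factor makes the criterion serve sums as well as products. -/
lemma bitLength_le_of_natAbs_lt_mul {x y z : ℤ}
    (h : z.natAbs < 2 ^ (bitLength x - 1) * 2 ^ (bitLength y - 1) * 2) :
    bitLength z ≤ bitLength x + bitLength y := by
  have hx := bitLength_pos x
  have hy := bitLength_pos y
  have : bitLength z ≤ (bitLength x - 1 + (bitLength y - 1) + 1) + 1 := by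
    apply bitLength_le_of_lt
    rw [pow_succ, pow_add]
    exact h
  omega

lemma bitLength_le_of_natAbs_le_add {x y z : ℤ} (h : z.natAbs ≤ x.natAbs + y.natAbs) :
    bitLength z ≤ bitLength x + bitLength y := by
  apply bitLength_le_of_natAbs_lt_mul
  have hx := natAbs_lt_two_pow_bitLength_sub_one x
  have hy := natAbs_lt_two_pow_bitLength_sub_one y
  generalize 2 ^ (bitLength x - 1) = a at *
  generalize 2 ^ (bitLength y - 1) = b at *
  obtain ⟨a, rfl⟩ : ∃ a', a = a' + 1 := ⟨a - 1, by omega⟩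
  obtain ⟨b, rfl⟩ : ∃ b', b = b' + 1 := ⟨b - 1, by omega⟩
  nlinarith [Nat.zero_le (a * b)]

lemma bitLength_add (x y : ℤ) : bitLength (x + y) ≤ bitLength x + bitLength y :=
  bitLength_le_of_natAbs_le_add (Int.natAbs_add_le x y)

lemma bitLength_sub (x y : ℤ) : bitLength (x - y) ≤ bitLength x + bitLength y :=
  bitLength_le_of_natAbs_le_add (Int.natAbs_sub_le x y)

lemma bitLength_mul (x y : ℤ) : bitLength (x * y) ≤ bitLength x + bitLength y := by
  apply bitLength_le_of_natAbs_lt_mul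
  have hx := natAbs_lt_two_pow_bitLength_sub_one x
  have hy := natAbs_lt_two_pow_bitLength_sub_one y
  rw [Int.natAbs_mul]
  have := Nat.mul_lt_mul'' hx hy
  omega

lemma bitLength_div (x y : ℤ) : bitLength (x / y) ≤ bitLength x + bitLength y :=
  bitLength_le_of_natAbs_le_add
    ((Int.natAbs_ediv_le_natAbs x y).trans (Nat.le_add_right _ _))

/-! ### Cost of expressions in bounded memories -/

/-- Every register holds at most `B` bits. -/
def Memory.Bounded (B : ℕ) (m : Memory) : Prop := ∀ a i, bitLength (m a i) ≤ B

/-- Bit length of the value of an expression, per bit of the registers. -/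
def Expr.weight : Expr → ℕ
  | .const z => bitLength z
  | .get _ _ => 1
  | .add e f | .sub e f | .mul e f | .div e f => e.weight + f.weight

/-- Cost of an expression, per bit of the registers. -/
def Expr.costWeight : Expr → ℕ
  | .const z => bitLength z
  | .get _ e => e.costWeight + 1
  | .add e f | .sub e f | .mul e f | .div e f =>
    e.costWeight + f.costWeight + (e.weight + f.weight)

lemma Memory.Bounded.one_le {B : ℕ} {m : Memory} (h : m.Bounded B) : 1 ≤ B :=
  (bitLength_pos _).trans (h 0 0)

lemma Memory.Bounded.write {B : ℕ} {m : Memory} (h : m.Bounded B) (a : ℕ) (i : ℤ) {v : ℤ}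
    (hv : bitLength v ≤ B) : (m.write a i v).Bounded B := by
  intro b j
  unfold Memory.write
  split
  · exact hv
  · exact h b j

/-- Bit lengths add under all four operations and a register read restores the bound `B`, so an
expression of fixed shape is linear in `B`. -/
lemma Expr.bitLength_eval_le {B : ℕ} {m : Memory} (h : m.Bounded B) (e : Expr) :
    bitLength (e.eval m) ≤ e.weight * B := by
  induction e with
  | const z => exact Nat.le_mul_of_pos_right _ h.one_le
  | get a e ih => simpa [Expr.eval, Expr.weight] using h a _
  | add e f he hf =>
    simp only [Expr.eval, Expr.weight, Nat.add_mul]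
    exact (bitLength_add _ _).trans (add_le_add he hf)
  | sub e f he hf =>
    simp only [Expr.eval, Expr.weight, Nat.add_mul]
    exact (bitLength_sub _ _).trans (add_le_add he hf)
  | mul e f he hf =>
    simp only [Expr.eval, Expr.weight, Nat.add_mul]
    exact (bitLength_mul _ _).trans (add_le_add he hf)
  | div e f he hf =>
    simp only [Expr.eval, Expr.weight, Nat.add_mul]
    exact (bitLength_div _ _).trans (add_le_add he hf)

lemma Expr.cost_le {B : ℕ} {m : Memory} (h : m.Bounded B) (e : Expr) :
    e.cost m ≤ e.costWeight * B := by
  induction e with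
  | const z => exact Nat.le_mul_of_pos_right _ h.one_le
  | get a e ih =>
    simp only [Expr.cost, Expr.costWeight, Nat.add_mul, one_mul]
    exact add_le_add ih (h a _)
  | add e f he hf =>
    simp only [Expr.cost, Expr.costWeight, Nat.add_mul _ (_ + _) B]
    exact add_le_add ((add_le_add he hf).trans_eq (Nat.add_mul _ _ _).symm)
      (Expr.bitLength_eval_le h (.add e f))
  | sub e f he hf =>
    simp only [Expr.cost, Expr.costWeight, Nat.add_mul _ (_ + _) B]
    exact add_le_add ((add_le_add he hf).trans_eq (Nat.add_mul _ _ _).symm)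
      (Expr.bitLength_eval_le h (.sub e f))
  | mul e f he hf =>
    simp only [Expr.cost, Expr.costWeight, Nat.add_mul _ (_ + _) B]
    exact add_le_add ((add_le_add he hf).trans_eq (Nat.add_mul _ _ _).symm)
      (Expr.bitLength_eval_le h (.mul e f))
  | div e f he hf =>
    simp only [Expr.cost, Expr.costWeight, Nat.add_mul _ (_ + _) B]
    exact add_le_add ((add_le_add he hf).trans_eq (Nat.add_mul _ _ _).symm)
      (Expr.bitLength_eval_le h (.div e f))

/-! ### Total correctness with a cost bound -/

/-- Started in `m`, the program `P` halts at cost at most `c` in a memory with property `Q`. -/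
def Halts (P : Program) (m : Memory) (c : ℕ) (Q : Memory → Prop) : Prop :=
  ∃ m' t, Runs P m m' t ∧ t ≤ c ∧ Q m'

lemma Halts.mono {P : Program} {m : Memory} {c c' : ℕ} {Q Q' : Memory → Prop}
    (h : Halts P m c Q) (hc : c ≤ c') (hQ : ∀ m', Q m' → Q' m') : Halts P m c' Q' := by
  obtain ⟨m', t, hr, ht, hq⟩ := h
  exact ⟨m', t, hr, ht.trans hc, hQ m' hq⟩

lemma Halts.seq {P Q : Program} {m : Memory} {c c' : ℕ} {R S : Memory → Prop}
    (h : Halts P m c R) (h' : ∀ m', R m' → Halts Q m' c' S) : Halts (.seq P Q) m (c + c') S := by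
  obtain ⟨m', t, hr, ht, hq⟩ := h
  obtain ⟨m'', t', hr', ht', hq'⟩ := h' m' hq
  exact ⟨m'', t + t', .seq hr hr', add_le_add ht ht', hq'⟩

lemma Halts.put {B : ℕ} {m : Memory} (hm : m.Bounded B) (a : ℕ) (e f : Expr) {Q : Memory → Prop}
    (hQ : Q (m.write a (e.eval m) (f.eval m))) :
    Halts (.put a e f) m ((e.costWeight + f.costWeight + 1) * B) Q := by
  refine ⟨_, _, .put m a e f, ?_, hQ⟩
  have h1 := e.cost_le hm
  have h2 := f.cost_le hm
  have h3 := hm.one_le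
  simp only [Nat.add_mul, one_mul]
  omega

/-- Rule for loops, with invariant `I k` after `k` rounds. -/
lemma Halts.loop {e : Expr} {P : Program} {B c n : ℕ} (I : ℕ → Memory → Prop)
    (hB : ∀ k m, I k m → m.Bounded B)
    (hstep : ∀ k < n, ∀ m, I k m → 0 < e.eval m ∧ Halts P m c (I (k + 1)))
    (hend : ∀ m, I n m → e.eval m ≤ 0) {m : Memory} (h0 : I 0 m) :
    Halts (.loop e P) m ((n + 1) * (e.costWeight * B + c + 1)) (I n) := by
  -- Induction on the number `d` of rounds still to come, since a run of a loop unfolds from its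
  -- first round.
  suffices ∀ d k m, k + d = n → I k m →
      Halts (.loop e P) m ((d + 1) * (e.costWeight * B + c + 1)) (I n) from
    this n 0 m (zero_add n) h0
  intro d
  induction d with
  | zero =>
    rintro k m rfl hk
    refine ⟨m, _, .loop_nonpos (hend m hk), ?_, hk⟩
    have := e.cost_le (hB _ _ hk)
    omega
  | succ d ih =>
    intro k m hkn hk
    obtain ⟨hpos, m', t, hr, ht, hI⟩ := hstep k (by omega) m hk
    obtain ⟨m'', u, hr', hu, hI'⟩ := ih (k + 1) m' (by omega) hI
    refine ⟨m'', _, .loop_pos hpos hr hr', ?_, hI'⟩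
    have := e.cost_le (hB _ _ hk)
    rw [Nat.add_mul (d + 1), one_mul]
    omega

/-- `for v < N do P`, with the counter in register `0` of array `v`. -/
def forLoop (v : ℕ) (N : Expr) (P : Program) : Program :=
  .seq (.put v (.const 0) (.const 0))
    (.loop (.sub N (.get v (.const 0)))
      (.seq P (.put v (.const 0) (.add (.get v (.const 0)) (.const 1)))))

/-- Rule for counted loops. The invariant must not depend on the counter. -/
lemma Halts.forLoop {v : ℕ} {N : Expr} {P : Program} {B c n : ℕ} (I : ℕ → Memory → Prop)
    (hB : ∀ k m, I k m → m.Bounded B) (hn : bitLength n ≤ B)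
    (hI : ∀ k m (z : ℤ), bitLength z ≤ B → I k m → I k (m.write v 0 z))
    (hN : ∀ k m, I k m → N.eval m = n)
    (hstep : ∀ k < n, ∀ m, I k m → m v 0 = k →
      Halts P m c (fun m' => I (k + 1) m' ∧ m' v 0 = k))
    {m : Memory} (h0 : I 0 m) :
    Halts (forLoop v N P) m ((n + 1) * ((N.costWeight + N.weight + 16) * B + c)) (I n) := by
  have hmono : ∀ k : ℕ, k ≤ n → bitLength (k : ℤ) ≤ B := fun k hk =>
    le_trans (by simpa [bitLength] using Nat.size_le_size hk) hn
  have h1B := (hB _ _ h0).one_le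
  have hz : bitLength (0 : ℤ) ≤ B := by simpa using hmono 0 (Nat.zero_le n)
  -- `3 * B` pays for resetting the counter, `9 * B` for incrementing it, and the first summand in
  -- the brackets for the loop test.
  refine Halts.mono (c := 3 * B +
    (n + 1) * ((N.costWeight + 2 + (N.weight + 1)) * B + (c + 9 * B) + 1)) ?_ ?_
    (fun m' h => h)
  · refine Halts.seq (R := fun m' => I 0 m' ∧ m' v 0 = (0 : ℕ))
      (Halts.put (hB _ _ h0) _ _ _ ⟨hI _ _ _ hz h0, by simp [Memory.write, Expr.eval]⟩) ?_
    rintro m' hm'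
    refine Halts.mono (Halts.loop (B := B) (c := c + 9 * B)
      (fun k m => I k m ∧ m v 0 = k) (fun k m h => hB k m h.1) (n := n) ?_ ?_ hm') le_rfl
      (fun _ h => h.1)
    · rintro k hk m ⟨hIk, hv⟩
      refine ⟨by simp [Expr.eval, hN k m hIk, hv, hk], ?_⟩
      refine Halts.seq (hstep k hk m hIk hv) ?_
      rintro m' ⟨hI', hv'⟩
      refine Halts.put (hB _ _ hI') _ _ _ ?_
      simp only [Expr.eval, hv']
      exact ⟨hI _ _ _ (mod_cast hmono (k + 1) hk) hI', by simp [Memory.write]⟩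
    · rintro m ⟨hIn, hv⟩
      simp [Expr.eval, hN n m hIn, hv]
  · have : n * B ≤ n * (B * 13) := Nat.mul_le_mul_left _ (by omega)
    nlinarith

/-- The program `for p < N do {acc := init; for k < K do acc := step; a[p] := fin}`.
The variables `p`, `k` and `acc` are the registers `0` of the arrays `2`, `3` and `4`. -/
def tabulate (a : ℕ) (N K init step fin : Expr) : Program :=
  forLoop 2 N (.seq (.put 4 (.const 0) init)
    (.seq (forLoop 3 K (.put 4 (.const 0) step)) (.put a (.get 2 (.const 0)) fin)))

/-- `m'` is `m` with arbitrary changes in array `a` and in the arrays of the local variables. -/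
def Memory.EqOff (a : ℕ) (m m' : Memory) : Prop :=
  ∀ b, b ≠ a → b ≠ 2 → b ≠ 3 → b ≠ 4 → m' b = m b

lemma Memory.EqOff.refl (a : ℕ) (m : Memory) : m.EqOff a m := fun _ _ _ _ _ => rfl

lemma Memory.EqOff.write {a : ℕ} {m m' : Memory} (h : m.EqOff a m') {b : ℕ}
    (hb : b = a ∨ b = 2 ∨ b = 3 ∨ b = 4) (i z : ℤ) : m.EqOff a (m'.write b i z) := by
  intro d h1 h2 h3 h4
  rw [← h d h1 h2 h3 h4]
  funext j
  have : d ≠ b := by rintro rfl; simp_all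
  simp [Memory.write, this]

/-- Cost of `tabulate`, per bit and per round. -/
def tabulateWeight (N K init step fin : Expr) : ℕ :=
  N.costWeight + N.weight + K.costWeight + K.weight + init.costWeight + step.costWeight +
    fin.costWeight + 100

/-- `acc p k` is the accumulator for entry `p` after `k` inner rounds. The hypotheses on expressions
concern every memory that agrees with `m` off array `a` and the local arrays, so they can be checked
from the state before the tabulation, without knowing which entries are already written. -/
lemma Halts.tabulate {a : ℕ} {N K init step fin : Expr} {B n κ : ℕ} {m : Memory}
    (acc : ℕ → ℕ → ℤ) (len : ℕ → ℕ) (val : ℕ → ℤ)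
    (ha : a ≠ 2 ∧ a ≠ 3 ∧ a ≠ 4) (hm : m.Bounded B)
    (hn : bitLength n ≤ B) (hκ : bitLength κ ≤ B) (hlen : ∀ p < n, len p ≤ κ)
    (hacc : ∀ p < n, ∀ k ≤ len p, bitLength (acc p k) ≤ B)
    (hval : ∀ p < n, bitLength (val p) ≤ B)
    (hN : ∀ m', m.EqOff a m' → N.eval m' = n)
    (hK : ∀ p < n, ∀ m', m.EqOff a m' → m' 2 0 = p → K.eval m' = len p)
    (hinit : ∀ p < n, ∀ m', m.EqOff a m' → m' 2 0 = p → init.eval m' = acc p 0)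
    (hstep : ∀ p < n, ∀ k < len p, ∀ m', m.EqOff a m' → m' 2 0 = p → m' 3 0 = k →
      m' 4 0 = acc p k → step.eval m' = acc p (k + 1))
    (hfin : ∀ p < n, ∀ m', m.EqOff a m' → m' 2 0 = p → m' 4 0 = acc p (len p) →
      fin.eval m' = val p) :
    Halts (tabulate a N K init step fin) m
      (tabulateWeight N K init step fin * B * ((n + 1) * (κ + 1)))
      (fun m' => m'.Bounded B ∧ m.EqOff a m' ∧ ∀ p < n, m' a p = val p) := by
  have hmono : ∀ {k l : ℕ}, k ≤ l → bitLength (l : ℤ) ≤ B → bitLength (k : ℤ) ≤ B :=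
    fun hk hl => le_trans (by simpa [bitLength] using Nat.size_le_size hk) hl
  have h1B := hm.one_le
  refine Halts.mono (Halts.forLoop (B := B) (n := n) (c := (init.costWeight + 2) * B +
    ((κ + 1) * ((K.costWeight + K.weight + 16) * B + (step.costWeight + 2) * B) +
      (fin.costWeight + 4) * B))
    (fun k m' => m'.Bounded B ∧ m.EqOff a m' ∧ ∀ p < k, m' a p = val p)
    (fun _ _ h => h.1) hn ?_ (fun k m' h => hN m' h.2.1) ?_
    ⟨hm, .refl a m, fun p hp => absurd hp (Nat.not_lt_zero p)⟩) ?_ (fun _ h => h)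
  · rintro k m' z hz ⟨h1, h2, h3⟩
    refine ⟨h1.write _ _ hz, h2.write (by simp) _ _, fun p hp => ?_⟩
    simp [Memory.write, ha.1, h3 p hp]
  · rintro p hp m' ⟨h1, h2, h3⟩ hmp
    refine Halts.seq (R := fun m' => m'.Bounded B ∧ m.EqOff a m' ∧ (∀ q < p, m' a q = val q) ∧
      m' 2 0 = p ∧ m' 4 0 = acc p 0) ?_ ?_
    · refine Halts.mono (Halts.put h1 _ _ _ ?_) (Nat.mul_le_mul_right B ?_) (fun _ h => h)
      · rw [hinit p hp m' h2 hmp]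
        refine ⟨h1.write _ _ (hacc p hp 0 (Nat.zero_le _)), h2.write (by simp) _ _, ?_, ?_, ?_⟩
        · intro q hq
          simp [Memory.write, ha.2.2, h3 q hq]
        · simp [Memory.write, hmp]
        · simp [Memory.write, Expr.eval]
      · simp only [Expr.costWeight, show bitLength 0 = 1 from rfl]
        omega
    rintro m' ⟨h1, h2, h3, hmp, hma⟩
    refine Halts.seq (R := fun m' => m'.Bounded B ∧ m.EqOff a m' ∧ (∀ q < p, m' a q = val q) ∧
      m' 2 0 = p ∧ m' 4 0 = acc p (len p)) ?_ ?_
    · refine Halts.mono (Halts.forLoop (B := B) (n := len p) (c := (step.costWeight + 2) * B)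
        (fun k m' => m'.Bounded B ∧ m.EqOff a m' ∧ (∀ q < p, m' a q = val q) ∧
        m' 2 0 = p ∧ m' 4 0 = acc p k) (fun _ _ h => h.1) (hmono (hlen p hp) hκ) ?_
        (fun k m' h => hK p hp m' h.2.1 h.2.2.2.1) ?_ ⟨h1, h2, h3, hmp, hma⟩)
        (Nat.mul_le_mul_right _ (Nat.add_le_add_right (hlen p hp) 1)) (fun _ h => h)
      · rintro k m' z hz ⟨h1, h2, h3, hmp, hma⟩
        refine ⟨h1.write _ _ hz, h2.write (by simp) _ _, fun q hq => ?_, ?_, ?_⟩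
        · simp [Memory.write, ha.2.1, h3 q hq]
        · simp [Memory.write, hmp]
        · simp [Memory.write, hma]
      · rintro k hk m' ⟨h1, h2, h3, hmp, hma⟩ hmk
        refine Halts.mono (Halts.put h1 _ _ _ ?_) (Nat.mul_le_mul_right B ?_) (fun _ h => h)
        · rw [hstep p hp k hk m' h2 hmp hmk hma]
          refine ⟨⟨h1.write _ _ (hacc p hp (k + 1) hk), h2.write (by simp) _ _, ?_, ?_, ?_⟩, ?_⟩
          · intro q hq
            simp [Memory.write, ha.2.2, h3 q hq]
          · simp [Memory.write, hmp]
          · simp [Memory.write, Expr.eval]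
          · simp [Memory.write, hmk]
        · simp only [Expr.costWeight, show bitLength 0 = 1 from rfl]
          omega
    · rintro m' ⟨h1, h2, h3, hmp, hma⟩
      refine Halts.mono (Halts.put h1 _ _ _ ?_) (Nat.mul_le_mul_right B ?_) (fun _ h => h)
      · rw [hfin p hp m' h2 hmp hma]
        have hp' : (Expr.get 2 (.const 0)).eval m' = p := by simp [Expr.eval, hmp]
        rw [hp']
        refine ⟨⟨h1.write _ _ (hval p hp), h2.write (by simp) _ _, ?_⟩, ?_⟩
        · intro q hq
          rcases eq_or_ne q p with rfl | hqp
          · simp [Memory.write]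
          · simp [Memory.write, hqp, h3 q (by omega)]
        · simp [Memory.write, ha.1.symm, hmp]
      · simp only [Expr.costWeight, show bitLength 0 = 1 from rfl]
        omega
  · rw [mul_left_comm]
    apply Nat.mul_le_mul_left
    unfold tabulateWeight
    have : 0 ≤ κ * B := Nat.zero_le _
    nlinarith [Nat.zero_le (κ * B), Nat.zero_le (κ * B * N.costWeight),
      Nat.zero_le (κ * B * N.weight), Nat.zero_le (κ * B * init.costWeight),
      Nat.zero_le (κ * B * fin.costWeight)]
end RAM

/-! ### The Faddeev-LeVerrier algorithm -/

namespace Matrix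

open Polynomial

variable {ι : Type*} [Fintype ι] [DecidableEq ι]

/-- The product rule, applied to each term of the expansion over permutations. -/
lemma derivative_det_updateCol {R : Type*} [CommRing R] (N : Matrix ι ι R[X]) :
    derivative N.det = ∑ i, (N.updateCol i fun j => derivative (N j i)).det := by
  simp only [det_apply, derivative_sum]
  rw [Finset.sum_comm]
  refine Finset.sum_congr rfl fun σ _ => ?_
  rw [← Finset.smul_sum, Units.smul_def, Units.smul_def, derivative_smul]
  congr 1
  rw [derivative_prod_finset]
  refine Finset.sum_congr rfl fun i _ => ?_
  rw [← Finset.prod_erase_mul _ _ (Finset.mem_univ i), updateCol_self]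
  congr 1
  refine Finset.prod_congr rfl fun j hj => ?_
  rw [updateCol_ne (Finset.ne_of_mem_erase hj)]

/-- The derivative of column `i` of `X - A` is the unit vector at `i`, and the determinant with this
column is the diagonal cofactor. -/
lemma derivative_charpoly {R : Type*} [CommRing R] (A : Matrix ι ι R) :
    derivative A.charpoly = trace (adjugate (charmatrix A)) := by
  rw [charpoly, derivative_det_updateCol]
  refine Finset.sum_congr rfl fun i _ => ?_
  have : (fun j => derivative (charmatrix A j i)) = Pi.single i 1 := by
    funext j
    rcases eq_or_ne j i with rfl | h
    · simp [charmatrix_apply_eq]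
    · simp [h]
  rw [this, diag_apply, ← transpose_apply (adjugate _), adjugate_transpose, adjugate_apply,
    updateRow_transpose, det_transpose]

/-- The coefficients of the adjugate of `X - A`. -/
noncomputable def adjCoeff (A : Matrix ι ι ℤ) (j : ℕ) : Matrix ι ι ℤ :=
  of fun a b => (adjugate (charmatrix A) a b).coeff j

/-- Comparison of the constant coefficients in `(X - A) * adj (X - A) = charpoly • 1`; the higher
coefficients give `mul_adjCoeff_succ`. -/
lemma mul_adjCoeff_zero (A : Matrix ι ι ℤ) :
    A * adjCoeff A 0 = -(A.charpoly.coeff 0 • (1 : Matrix ι ι ℤ)) := by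
  have key (N : Matrix ι ι ℤ[X]) (a b : ι) :
      ((charmatrix A * N) a b).coeff 0 = -∑ x, A a x * (N x b).coeff 0 := by
    simp [charmatrix, sub_mul, mul_apply, diagonal_apply]
  ext a b
  have h := key (adjugate (charmatrix A)) a b
  rw [mul_adjugate, smul_apply, one_apply, smul_eq_mul, mul_ite, mul_one, mul_zero,
    apply_ite (fun p : ℤ[X] => p.coeff 0), coeff_zero] at h
  simp only [mul_apply, adjCoeff, of_apply, neg_apply, smul_apply, one_apply, smul_eq_mul,
    mul_ite, mul_one, mul_zero, charpoly]
  linarith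

lemma mul_adjCoeff_succ (A : Matrix ι ι ℤ) (j : ℕ) :
    adjCoeff A j = A * adjCoeff A (j + 1) + A.charpoly.coeff (j + 1) • (1 : Matrix ι ι ℤ) := by
  have key (N : Matrix ι ι ℤ[X]) (a b : ι) : ((charmatrix A * N) a b).coeff (j + 1) =
      (N a b).coeff j - ∑ x, A a x * (N x b).coeff (j + 1) := by
    simp [charmatrix, sub_mul, mul_apply, diagonal_apply]
  ext a b
  have h := key (adjugate (charmatrix A)) a b
  rw [mul_adjugate, smul_apply, one_apply, smul_eq_mul, mul_ite, mul_one, mul_zero,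
    apply_ite (fun p : ℤ[X] => p.coeff (j + 1)), coeff_zero] at h
  simp only [mul_apply, adjCoeff, of_apply, add_apply, smul_apply, one_apply, smul_eq_mul,
    mul_ite, mul_one, mul_zero, charpoly]
  linarith

lemma trace_adjCoeff (A : Matrix ι ι ℤ) (j : ℕ) :
    trace (adjCoeff A j) = A.charpoly.coeff (j + 1) * (j + 1) := by
  rw [← coeff_derivative, derivative_charpoly, trace, trace, finsetSum_coeff]
  rfl

/-- No degree bound for the adjugate is needed: its coefficients vanish eventually, and the
recursion carries this down as long as the coefficients of the characteristic polynomial vanish too.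
-/
lemma adjCoeff_of_le (A : Matrix ι ι ℤ) {j : ℕ} (hj : Fintype.card ι ≤ j) : adjCoeff A j = 0 := by
  obtain ⟨J, hJ⟩ : ∃ J, ∀ j ≥ J, adjCoeff A j = 0 := by
    refine ⟨(Finset.univ.sup fun a => Finset.univ.sup fun b =>
      (adjugate (charmatrix A) a b).natDegree) + 1, fun j hj => ?_⟩
    ext a b
    refine coeff_eq_zero_of_natDegree_lt (lt_of_lt_of_le (Nat.lt_succ_of_le ?_) hj)
    exact (Finset.le_sup (f := fun b => (adjugate (charmatrix A) a b).natDegree)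
      (Finset.mem_univ b)).trans (Finset.le_sup (f := fun a => Finset.univ.sup fun b =>
      (adjugate (charmatrix A) a b).natDegree) (Finset.mem_univ a))
  suffices ∀ d j, Fintype.card ι ≤ j → J ≤ j + d → adjCoeff A j = 0 from
    this J j hj (Nat.le_add_left _ _)
  intro d
  induction d with
  | zero => exact fun j _ h => hJ j h
  | succ d ih =>
    intro j h1 h2
    rw [mul_adjCoeff_succ, ih (j + 1) (by omega) (by omega), coeff_eq_zero_of_natDegree_lt]
    · simp
    · rw [charpoly_natDegree_eq_dim]
      omega

/-- State of the Faddeev-LeVerrier iteration: the current coefficient of the adjugate of `X - A`,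
its product with `A`, and the current coefficient of the characteristic polynomial. -/
def faddeev (A : Matrix ι ι ℤ) : ℕ → Matrix ι ι ℤ × Matrix ι ι ℤ × ℤ
  | 0 => (0, 0, 1)
  | k + 1 =>
    let M := (faddeev A k).2.1 + (faddeev A k).2.2 • 1
    (M, A * M, (0 - trace (A * M)) / ((k : ℤ) + 1))

/-- The trace of the recursion, with `trace_adjCoeff`, gives `tr (A * M) = -(k + 1) * c`, where `M`
is the new adjugate coefficient and `c` the next coefficient of the characteristic polynomial. Hence
the integer division is exact. -/
lemma faddeev_eq (A : Matrix ι ι ℤ) {k : ℕ} (hk : k ≤ Fintype.card ι) :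
    faddeev A k = (adjCoeff A (Fintype.card ι - k), A * adjCoeff A (Fintype.card ι - k),
      A.charpoly.coeff (Fintype.card ι - k)) := by
  induction k with
  | zero =>
    have := A.charpoly_monic.coeff_natDegree
    rw [charpoly_natDegree_eq_dim] at this
    simp [faddeev, adjCoeff_of_le, this]
  | succ k ih =>
    obtain ⟨j, hj⟩ : ∃ j, Fintype.card ι - k = j + 1 := ⟨Fintype.card ι - k - 1, by omega⟩
    have hj' : Fintype.card ι - (k + 1) = j := by omega
    have hM : (faddeev A k).2.1 + (faddeev A k).2.2 • 1 = adjCoeff A j := by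
      rw [ih (by omega), hj, mul_adjCoeff_succ A j]
    simp only [faddeev, hM, hj', Prod.mk.injEq, true_and]
    have hcard : (Fintype.card ι : ℤ) = k + 1 + j := by omega
    have hk0 : (k : ℤ) + 1 ≠ 0 := by omega
    apply Int.ediv_eq_of_eq_mul_left hk0
    cases j with
    | zero =>
      rw [mul_adjCoeff_zero, trace_neg, trace_smul, trace_one, hcard]
      simp
    | succ j =>
      have h := congrArg trace (mul_adjCoeff_succ A j)
      rw [trace_add, trace_smul, trace_one, trace_adjCoeff, hcard] at h
      simp only [smul_eq_mul] at h
      push_cast at h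
      linarith

/-- The iteration computes the adjugate and the determinant of `-A`. -/
lemma neg_mul_faddeev (A : Matrix ι ι ℤ) :
    -A * (faddeev A (Fintype.card ι)).1 = (faddeev A (Fintype.card ι)).2.2 • 1 := by
  rw [faddeev_eq A le_rfl, Nat.sub_self]
  simp [mul_adjCoeff_zero]

lemma faddeev_det (A : Matrix ι ι ℤ) : (faddeev A (Fintype.card ι)).2.2 = (-A).det := by
  rw [faddeev_eq A le_rfl, Nat.sub_self]
  simp only
  rw [coeff_zero_eq_eval_zero, eval_charpoly]
  simp

end Matrix

/-! ### Scarf's lemma -/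

namespace Scarf

open Finset

variable {T I : Type*} [Fintype T] [DecidableEq T] [Fintype I] [DecidableEq I]

/-- No point of `T` lies above all of `σ` in all of the orders with index in `C`. The orders are
given by the utilities `u i : T → ℕ`. -/
def Dominant (u : I → T → ℕ) (σ : Finset T) (C : Finset I) : Prop :=
  ∀ y, ∃ i ∈ C, ∀ x ∈ σ, u i y ≤ u i x

/-- A dominant pair of sets of equal size. -/
def Room (u : I → T → ℕ) (R : Finset T × Finset I) : Prop :=
  Dominant u R.1 R.2 ∧ #R.2 = #R.1

/-- The pair `d` arises from the pair `R` by adding an index or by removing a point. -/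
def Face (d R : Finset T × Finset I) : Prop :=
  (R.1 = d.1 ∧ ∃ i ∈ d.2, R.2 = d.2.erase i) ∨ (R.2 = d.2 ∧ ∃ x, x ∉ d.1 ∧ R.1 = insert x d.1)

omit [Fintype T] [DecidableEq T] [Fintype I] [DecidableEq I] in
lemma Dominant.mono {u : I → T → ℕ} {σ τ : Finset T} {C D : Finset I} (h : Dominant u σ C)
    (hσ : τ ⊆ σ) (hC : C ⊆ D) : Dominant u τ D := fun y =>
  let ⟨i, hi, hy⟩ := h y
  ⟨i, hC hi, fun x hx => hy x (hσ hx)⟩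

omit [Fintype T] [Fintype I] in
lemma Face.dominant {u : I → T → ℕ} {d R : Finset T × Finset I} (h : Face d R) (hR : Room u R) :
    Dominant u d.1 d.2 ∧ #d.2 = #d.1 + 1 := by
  obtain ⟨τ, D⟩ := d
  obtain ⟨σ, C⟩ := R
  obtain ⟨hR, hc⟩ := hR
  rcases h with ⟨h1, i, hi, h2⟩ | ⟨h1, x, hx, h2⟩ <;>
    simp only at h1 h2 hc hR <;> subst h1 <;> subst h2
  · refine ⟨hR.mono subset_rfl (erase_subset _ _), ?_⟩
    rw [← hc, card_erase_add_one hi]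
  · refine ⟨hR.mono (subset_insert _ _) subset_rfl, ?_⟩
    rw [hc, card_insert_of_notMem hx]

/-- The rooms at a door that are obtained by giving up the index `a`. -/
def Side (u : I → T → ℕ) (mn : I → T) (τ : Finset T) (D : Finset I) (a : I)
    (R : Finset T × Finset I) : Prop :=
  R = (τ, D.erase a) ∨ ∃ x, x ∉ τ ∧ R = (insert x τ, D) ∧ ∀ i ∈ D.erase a, u i (mn i) < u i x

/-- As `a` and `b` have the same minimal point, `a` is dispensable for exhibiting the points of `τ`
as minima. If no point exceeds all minima in the orders other than `a`, the index `a` can be erased.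
Otherwise the only point that can be added is the one among them that is greatest in the order `a`.
-/
lemma exists_unique_side {u : I → T → ℕ} (hu : ∀ i, Function.Injective (u i)) {mn : I → T}
    {τ : Finset T} {D : Finset I} (hmem : ∀ i, mn i ∈ τ)
    (hmin : ∀ i, ∀ x ∈ τ, u i (mn i) ≤ u i x) (hdom : Dominant u τ D) (hcard : #D = #τ + 1)
    {a b : I} (ha : a ∈ D) (hb : b ∈ D) (hab : a ≠ b) (hmn : mn a = mn b) :
    ∃ R, Room u R ∧ Side u mn τ D a R ∧ ∀ R', Room u R' → Side u mn τ D a R' → R' = R := by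
  -- Dominance, tested at a point of `τ` itself, says that this point is a minimum in some order;
  -- `b` stands in for `a`.
  have hsurj : ∀ y ∈ τ, ∃ i ∈ D.erase a, mn i = y := by
    intro y hy
    obtain ⟨i, hi, h⟩ := hdom y
    have : mn i = y := hu i (le_antisymm (hmin i y hy) (h _ (hmem i)))
    rcases eq_or_ne i a with rfl | hia
    · exact ⟨b, mem_erase.2 ⟨hab.symm, hb⟩, hmn ▸ this⟩
    · exact ⟨i, mem_erase.2 ⟨hia, hi⟩, this⟩
  by_cases hY : ∃ x, ∀ i ∈ D.erase a, u i (mn i) < u i x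
  · obtain ⟨x, hxY, hxmax⟩ : ∃ x, (∀ i ∈ D.erase a, u i (mn i) < u i x) ∧
        ∀ y, (∀ i ∈ D.erase a, u i (mn i) < u i y) → u a y ≤ u a x := by
      obtain ⟨x0, hx0⟩ := hY
      obtain ⟨x, hx, hmax⟩ := exists_max_image
        (univ.filter fun x => ∀ i ∈ D.erase a, u i (mn i) < u i x) (u a) ⟨x0, by simpa using hx0⟩
      simp only [mem_filter, mem_univ, true_and] at hx hmax
      exact ⟨x, hx, hmax⟩
    have hxτ : x ∉ τ := by
      intro h
      obtain ⟨i, hi, rfl⟩ := hsurj x h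
      exact lt_irrefl _ (hxY i hi)
    -- Since `x` exceeds the minima in all other orders, dominance of `τ` at `x` can only come from
    -- `a`.
    have hxa : ∀ z ∈ τ, u a x ≤ u a z := by
      obtain ⟨i, hi, h⟩ := hdom x
      rcases eq_or_ne i a with rfl | hia
      · exact h
      · exact absurd (hxY i (mem_erase.2 ⟨hia, hi⟩)) (not_lt.2 (h _ (hmem i)))
    refine ⟨(insert x τ, D), ⟨?_, ?_⟩, Or.inr ⟨x, hxτ, rfl, hxY⟩, ?_⟩
    · intro y
      by_cases hy : ∀ i ∈ D.erase a, u i (mn i) < u i y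
      · refine ⟨a, ha, fun z hz => ?_⟩
        rcases mem_insert.1 hz with rfl | hz
        · exact hxmax y hy
        · exact (hxmax y hy).trans (hxa z hz)
      · push Not at hy
        obtain ⟨i, hi, hle⟩ := hy
        refine ⟨i, mem_of_mem_erase hi, fun z hz => hle.trans ?_⟩
        rcases mem_insert.1 hz with rfl | hz
        · exact (hxY i hi).le
        · exact hmin i z hz
    · simp only [hcard, card_insert_of_notMem hxτ]
    · rintro R' ⟨hR', -⟩ (rfl | ⟨x', hx', rfl, hY'⟩)
      · obtain ⟨i, hi, h⟩ := hR' x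
        exact absurd (hxY i hi) (not_lt.2 (h _ (hmem i)))
      · obtain ⟨i, hi, h⟩ := hR' x
        rcases eq_or_ne i a with rfl | hia
        · have := hu i (le_antisymm (h x' (mem_insert_self _ _)) (hxmax x' hY'))
          rw [this]
        · exact absurd (hxY i (mem_erase.2 ⟨hia, hi⟩))
            (not_lt.2 (h _ (mem_insert_of_mem (hmem i))))
  · refine ⟨(τ, D.erase a), ⟨?_, ?_⟩, Or.inl rfl, ?_⟩
    · intro y
      push Not at hY
      obtain ⟨i, hi, h⟩ := hY y
      exact ⟨i, hi, fun x hx => h.trans (hmin i x hx)⟩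
    · simp only [card_erase_of_mem ha, hcard, Nat.add_sub_cancel]
    · rintro R' - (rfl | ⟨x', hx', rfl, hY'⟩)
      · rfl
      · exact absurd ⟨x', hY'⟩ hY

-- The minima map `D` onto `τ`, and `D` has one element more, so exactly one pair `a`, `b` collides.
-- A room at the door arises by giving up `a` or by giving up `b`, each in a unique way.
open Classical in
lemma card_rooms_of_nonempty {u : I → T → ℕ} (hu : ∀ i, Function.Injective (u i))
    {τ : Finset T} {D : Finset I} (hτ : τ.Nonempty) (hdom : Dominant u τ D)
    (hcard : #D = #τ + 1) : #(univ.filter fun R => Room u R ∧ Face (τ, D) R) = 2 := by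
  choose mn hmem hmin using fun i => exists_min_image τ (u i) hτ
  have hlt : #τ < #D := by omega
  obtain ⟨a, ha, b, hb, hab, hmn⟩ :=
    exists_ne_map_eq_of_card_lt_of_maps_to hlt (f := mn) (fun i _ => hmem i)
  -- A subset of `D` on which the minima still cover `τ` lacks at most one index, and that index
  -- belongs to the colliding pair.
  have key : ∀ D' ⊆ D, (∀ y ∈ τ, ∃ i ∈ D', mn i = y) → D.erase a ⊆ D' ∨ D.erase b ⊆ D' := by
    intro D' hD' hs
    by_contra hcon
    rw [not_or, not_subset, not_subset] at hcon
    obtain ⟨⟨i, hi, hi'⟩, j, hj, hj'⟩ := hcon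
    have hsub : τ ⊆ D'.image mn := fun y hy => mem_image.2 (hs y hy)
    have h1 : #τ ≤ #(D'.image mn) := card_le_card hsub
    have h2 : #(D'.image mn) ≤ #D' := card_image_le
    have hDi : D' ⊆ D.erase i := subset_erase.2 ⟨hD', hi'⟩
    have h3 := card_erase_of_mem (mem_of_mem_erase hi)
    have hD'i : D' = D.erase i := eq_of_subset_of_card_le hDi (by omega)
    have hij : i = j := by
      by_contra hij
      exact hj' (hD'i ▸ mem_erase.2 ⟨fun h => hij h.symm, mem_of_mem_erase hj⟩)
    subst hij
    have hinj : Set.InjOn mn D' := card_image_iff.1 (by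
      have := card_le_card hDi
      omega)
    refine hab (hinj ?_ ?_ hmn)
    · rw [hD'i]
      exact mem_coe.2 (mem_erase.2 ⟨(ne_of_mem_erase hi).symm, ha⟩)
    · rw [hD'i]
      exact mem_coe.2 (mem_erase.2 ⟨(ne_of_mem_erase hj).symm, hb⟩)
  obtain ⟨Ra, hRa, hSa, hUa⟩ := exists_unique_side hu hmem hmin hdom hcard ha hb hab hmn
  obtain ⟨Rb, hRb, hSb, hUb⟩ := exists_unique_side hu hmem hmin hdom hcard hb ha hab.symm hmn.symm
  -- A point that could be added on both sides would exceed the minima in all orders of `D`, against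
  -- dominance of `τ`.
  have hne : Ra ≠ Rb := by
    rintro rfl
    rcases hSa with rfl | ⟨x, hx, rfl, hY⟩ <;> rcases hSb with h | ⟨x', hx', h, hY'⟩
    · have := (Prod.mk.inj h).2
      have h' : b ∈ D.erase a := mem_erase.2 ⟨hab.symm, hb⟩
      rw [this] at h'
      exact ne_of_mem_erase h' rfl
    · exact hx' ((Prod.mk.inj h).1 ▸ mem_insert_self _ _)
    · exact hx ((Prod.mk.inj h).1 ▸ mem_insert_self _ _)
    · have hxx : x = x' := by
        have : x ∈ insert x' τ := (Prod.mk.inj h).1 ▸ mem_insert_self _ _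
        exact (mem_insert.1 this).resolve_right hx
      subst hxx
      obtain ⟨i, hi, hle⟩ := hdom x
      have hle := hle _ (hmem i)
      rcases eq_or_ne i a with rfl | hia
      · exact absurd (hY' i (mem_erase.2 ⟨hab, hi⟩)) (not_lt.2 hle)
      · exact absurd (hY i (mem_erase.2 ⟨hia, hi⟩)) (not_lt.2 hle)
  have hface : ∀ {e} {R}, e ∈ D → Side u mn τ D e R → Face (τ, D) R := by
    rintro e R he (rfl | ⟨x, hx, rfl, -⟩)
    · exact Or.inl ⟨rfl, e, he, rfl⟩
    · exact Or.inr ⟨rfl, x, hx, rfl⟩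
  rw [← card_pair hne]
  congr 1
  ext R
  simp only [mem_filter, mem_univ, true_and, mem_insert, mem_singleton]
  constructor
  · rintro ⟨hR, hF⟩
    suffices Side u mn τ D a R ∨ Side u mn τ D b R from this.imp (hUa R hR) (hUb R hR)
    obtain ⟨σ, C⟩ := R
    rcases hF with ⟨h1, i, hi, h2⟩ | ⟨h1, x, hx, h2⟩ <;>
      simp only at h1 h2 <;> subst h1 <;> subst h2
    · have h := key (D.erase i) (erase_subset _ _) fun y hy => by
        obtain ⟨j, hj, h⟩ := hR.1 y
        exact ⟨j, hj, hu j (le_antisymm (hmin j y hy) (h _ (hmem j)))⟩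
      refine h.imp (fun h => ?_) (fun h => ?_) <;>
      · have : i ∉ D.erase _ := fun h' => ne_of_mem_erase (h h') rfl
        have := not_not.1 fun hne => this (mem_erase.2 ⟨hne, hi⟩)
        subst this
        exact Or.inl rfl
    · have h := key (C.filter fun i => u i (mn i) < u i x) (filter_subset _ _) fun y hy => by
        obtain ⟨j, hj, h⟩ := hR.1 y
        have hy' : mn j = y :=
          hu j (le_antisymm (hmin j y hy) (h _ (mem_insert_of_mem (hmem j))))
        refine ⟨j, mem_filter.2 ⟨hj, ?_⟩, hy'⟩
        rw [hy']
        refine lt_of_le_of_ne (h x (mem_insert_self _ _)) fun he => hx ?_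
        rw [← hu j he]
        exact hy
      refine h.imp (fun h => ?_) (fun h => ?_) <;>
      · refine Or.inr ⟨x, hx, rfl, fun i hi => ?_⟩
        have := h hi
        exact (mem_filter.1 this).2
  · rintro (rfl | rfl)
    · exact ⟨hRa, hface ha hSa⟩
    · exact ⟨hRb, hface hb hSb⟩

-- Erasing `i` leaves no index to dominate with, so a point must be added, and it must be the
-- maximum in the order `i`.
open Classical in
lemma card_rooms_empty [Nonempty T] {u : I → T → ℕ} (hu : ∀ i, Function.Injective (u i)) (i : I) :
    #(univ.filter fun R => Room u R ∧ Face (∅, {i}) R) = 1 := by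
  obtain ⟨x, -, hx⟩ := exists_max_image (univ : Finset T) (u i) univ_nonempty
  rw [card_eq_one]
  refine ⟨({x}, {i}), ?_⟩
  ext ⟨σ, C⟩
  simp only [mem_filter, mem_univ, true_and, mem_singleton, Prod.mk.injEq]
  constructor
  · rintro ⟨⟨hR, hc⟩, ⟨h1, j, hj, h2⟩ | ⟨h1, y, hy, h2⟩⟩ <;>
      simp only at h1 h2 hR hc <;> subst h1 <;> subst h2
    · rw [mem_singleton.1 hj, erase_singleton] at hR
      obtain ⟨k, hk, -⟩ := hR (Classical.arbitrary T)
      exact absurd hk (notMem_empty k)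
    · refine ⟨?_, rfl⟩
      obtain ⟨k, hk, h⟩ := hR x
      rw [mem_singleton.1 hk] at h
      rw [hu i (le_antisymm (h y (mem_insert_self _ _)) (hx y (mem_univ _)))]
      rfl
  · rintro ⟨rfl, rfl⟩
    refine ⟨⟨fun y => ⟨i, mem_singleton_self i, fun z hz => ?_⟩, rfl⟩,
      Or.inr ⟨rfl, x, notMem_empty x, rfl⟩⟩
    rw [mem_singleton.1 hz]
    exact hx y (mem_univ y)

-- A room that is not colourful has two doors or none. If its colours are `C` with `i₀` exchanged
-- for a foreign colour, one adds this colour to `C` or removes the point that bears it. If its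
-- colours are `C.erase i₀`, one removes either of the two points of equal colour. In all other
-- cases there is no door.
open Classical in
lemma even_card_doors {c : T → I} {i₀ : I} {σ : Finset T} {C : Finset I} (hcard : #C = #σ)
    (hcol : σ.image c ≠ C) :
    Even #(univ.filter fun d : Finset T × Finset I =>
      (i₀ ∈ d.2 ∧ d.1.image c = d.2.erase i₀ ∧ #d.2 = #d.1 + 1) ∧ Face d (σ, C)) := by
  by_cases hA : i₀ ∈ C ∧ ∃ j, j ∉ C ∧ σ.image c = insert j (C.erase i₀)
  · obtain ⟨hi₀, j, hj, him⟩ := hA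
    have hj' : j ∉ C.erase i₀ := fun h => hj (mem_of_mem_erase h)
    have hinj : Set.InjOn c σ := card_image_iff.1 (by
      rw [him, card_insert_of_notMem hj', card_erase_add_one hi₀, hcard])
    obtain ⟨x, hx, rfl⟩ : ∃ x ∈ σ, c x = j := mem_image.1 (him ▸ mem_insert_self _ _)
    have hne : (σ, insert (c x) C) ≠ (σ.erase x, C) := fun h =>
      hj ((Prod.mk.inj h).2 ▸ mem_insert_self _ _)
    have hix : i₀ ≠ c x := by
      rintro rfl
      exact hj hi₀
    refine ⟨1, ?_⟩
    rw [← two_mul, mul_one, ← card_pair hne]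
    congr 1
    ext ⟨τ, D⟩
    simp only [mem_filter, mem_univ, true_and, mem_insert, mem_singleton, Prod.mk.injEq]
    constructor
    · rintro ⟨⟨h0, h3, h4⟩, ⟨h1, i, hi, h2⟩ | ⟨h1, y, hy, h2⟩⟩ <;>
        simp only at h1 h2 <;> subst h1 <;> subst h2
      · left
        have : c x ∈ D.erase i₀ := by
          rw [← h3, him]
          exact mem_insert_self _ _
        have hxi : c x = i := by
          by_contra hne
          exact hj (mem_erase.2 ⟨hne, mem_of_mem_erase this⟩)
        rw [hxi, insert_erase hi]
        exact ⟨rfl, rfl⟩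
      · right
        have hxy : x = y := by
          rcases mem_insert.1 hx with h | h
          · exact h
          · exact absurd (h3 ▸ mem_image_of_mem c h) hj'
        subst hxy
        rw [erase_insert hy]
        exact ⟨rfl, rfl⟩
    · rintro (⟨rfl, rfl⟩ | ⟨rfl, rfl⟩)
      · refine ⟨⟨mem_insert_of_mem hi₀, ?_, ?_⟩, Or.inl ⟨rfl, c x, mem_insert_self _ _, ?_⟩⟩
        · rw [him, erase_insert_of_ne hix.symm]
        · rw [card_insert_of_notMem hj, hcard]
        · simp only [erase_insert hj]
      · refine ⟨⟨hi₀, ?_, ?_⟩, Or.inr ⟨rfl, x, notMem_erase _ _, (insert_erase hx).symm⟩⟩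
        · rw [← erase_insert hj', ← him]
          ext k
          simp only [mem_image, mem_erase]
          constructor
          · rintro ⟨y, ⟨hyx, hy⟩, rfl⟩
            exact ⟨fun h => hyx (hinj hy hx h), y, hy, rfl⟩
          · rintro ⟨hk, y, hy, rfl⟩
            exact ⟨y, ⟨fun h => hk (h ▸ rfl), hy⟩, rfl⟩
        · rw [hcard, card_erase_add_one hx]
  by_cases hB : i₀ ∈ C ∧ σ.image c = C.erase i₀
  · obtain ⟨hi₀, him⟩ := hB
    have hlt : #(σ.image c) < #σ := by
      rw [him, ← hcard]
      exact card_erase_lt_of_mem hi₀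
    obtain ⟨x, hx, y, hy, hxy, hc⟩ :=
      exists_ne_map_eq_of_card_lt_of_maps_to hlt (f := c) (fun z hz => mem_image_of_mem c hz)
    have hne : (σ.erase x, C) ≠ (σ.erase y, C) := fun h => by
      have h' : y ∈ σ.erase x := mem_erase.2 ⟨hxy.symm, hy⟩
      rw [(Prod.mk.inj h).1] at h'
      exact notMem_erase _ _ h'
    have himage : ∀ {x y}, y ∈ σ → x ≠ y → c x = c y → (σ.erase x).image c = C.erase i₀ := by
      intro x y hy hxy hc
      rw [← him]
      refine subset_antisymm (image_subset_image (erase_subset _ _)) fun k hk => ?_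
      obtain ⟨z, hz, rfl⟩ := mem_image.1 hk
      rcases eq_or_ne z x with rfl | hzx
      · exact mem_image.2 ⟨y, mem_erase.2 ⟨hxy.symm, hy⟩, hc.symm⟩
      · exact mem_image_of_mem c (mem_erase.2 ⟨hzx, hz⟩)
    refine ⟨1, ?_⟩
    rw [← two_mul, mul_one, ← card_pair hne]
    congr 1
    ext ⟨τ, D⟩
    simp only [mem_filter, mem_univ, true_and, mem_insert, mem_singleton, Prod.mk.injEq]
    constructor
    · rintro ⟨⟨h0, h3, h4⟩, ⟨h1, i, hi, h2⟩ | ⟨h1, z, hz, h2⟩⟩ <;>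
        simp only at h1 h2 <;> subst h1 <;> subst h2
      · rw [h3] at him
        rcases eq_or_ne i i₀ with rfl | hii
        · exact absurd hi₀ (notMem_erase _ _)
        · have : i ∈ (D.erase i).erase i₀ := him ▸ mem_erase.2 ⟨hii, hi⟩
          exact absurd (mem_of_mem_erase this) (notMem_erase _ _)
      · have hinj : Set.InjOn c τ := card_image_iff.1 (by
          rw [h3, card_erase_of_mem hi₀, h4, Nat.add_sub_cancel])
        rcases eq_or_ne x z with rfl | hxz
        · exact Or.inl ⟨(erase_insert hz).symm, rfl⟩
        rcases eq_or_ne y z with rfl | hyz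
        · exact Or.inr ⟨(erase_insert hz).symm, rfl⟩
        exact absurd (hinj ((mem_insert.1 hx).resolve_left hxz)
          ((mem_insert.1 hy).resolve_left hyz) hc) hxy
    · rintro (⟨rfl, rfl⟩ | ⟨rfl, rfl⟩)
      · refine ⟨⟨hi₀, himage hy hxy hc, ?_⟩,
          Or.inr ⟨rfl, x, notMem_erase _ _, (insert_erase hx).symm⟩⟩
        rw [hcard, card_erase_add_one hx]
      · refine ⟨⟨hi₀, himage hx hxy.symm hc.symm, ?_⟩,
          Or.inr ⟨rfl, y, notMem_erase _ _, (insert_erase hy).symm⟩⟩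
        rw [hcard, card_erase_add_one hy]
  · rw [filter_eq_empty_iff.2]
    · exact Even.zero
    rintro ⟨τ, D⟩ - ⟨⟨h0, h3, h4⟩, ⟨h1, i, hi, h2⟩ | ⟨h1, x, hx, h2⟩⟩ <;>
      simp only at h1 h2 h0 h3 h4 <;> subst h1 <;> subst h2
    · have hii : i₀ ≠ i := by
        rintro rfl
        exact hcol h3
      refine hA ⟨mem_erase.2 ⟨hii, h0⟩, i, notMem_erase _ _, ?_⟩
      rw [h3, erase_right_comm, insert_erase (mem_erase.2 ⟨hii.symm, hi⟩)]
    · rw [image_insert, h3] at hcol hA hB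
      by_cases hcx : c x ∈ C
      · rcases eq_or_ne (c x) i₀ with hc | hc
        · rw [hc, insert_erase h0] at hcol
          exact hcol rfl
        · exact hB ⟨h0, insert_eq_of_mem (mem_erase.2 ⟨hc, hcx⟩)⟩
      · exact hA ⟨h0, c x, hcx, rfl⟩

/-- Scarf's lemma: every colouring has a room that is coloured exactly by its indices. -/
theorem exists_colorful [Nonempty T] [Nonempty I] {u : I → T → ℕ}
    (hu : ∀ i, Function.Injective (u i)) (c : T → I) :
    ∃ σ C, Dominant u σ C ∧ σ.image c = C := by
  classical
  by_contra hcon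
  push Not at hcon
  let i₀ : I := Classical.arbitrary I
  let doors := univ.filter fun d : Finset T × Finset I =>
    Dominant u d.1 d.2 ∧ i₀ ∈ d.2 ∧ d.1.image c = d.2.erase i₀ ∧ #d.2 = #d.1 + 1
  let rooms := univ.filter fun R : Finset T × Finset I => Room u R
  -- Incidences are counted twice. Without a colourful room every room has evenly many doors, while
  -- every door has two rooms except `(∅, {i₀})`, which has one.
  have h := sum_card_bipartiteAbove_eq_sum_card_bipartiteBelow (s := doors) (t := rooms) Face
  have heven : Even (∑ R ∈ rooms, #(bipartiteBelow Face doors R)) := by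
    refine even_sum _ fun R hR => ?_
    have hR : Room u R := (mem_filter.1 hR).2
    have hd : bipartiteBelow Face doors R = univ.filter fun d : Finset T × Finset I =>
        (i₀ ∈ d.2 ∧ d.1.image c = d.2.erase i₀ ∧ #d.2 = #d.1 + 1) ∧ Face d R := by
      ext d
      simp only [bipartiteBelow, doors, mem_filter, mem_univ, true_and]
      exact ⟨fun h => ⟨h.1.2, h.2⟩, fun h => ⟨⟨(h.2.dominant hR).1, h.1⟩, h.2⟩⟩
    rw [hd]
    exact even_card_doors hR.2 (hcon _ _ hR.1)
  have hmem : (∅, {i₀}) ∈ doors := by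
    simp only [doors, mem_filter, mem_univ, true_and]
    exact ⟨fun y => ⟨i₀, mem_singleton_self _, fun x hx => absurd hx (notMem_empty x)⟩, by simp⟩
  have hodd : Odd (∑ d ∈ doors, #(bipartiteAbove Face rooms d)) := by
    rw [← add_sum_erase _ _ hmem]
    have h1 : #(bipartiteAbove Face rooms (∅, {i₀})) = 1 := by
      rw [← card_rooms_empty hu i₀]
      simp only [bipartiteAbove, rooms, filter_filter]
    rw [h1]
    refine Even.one_add (even_sum _ fun d hd => ?_)
    obtain ⟨hne, hd⟩ := mem_erase.1 hd
    obtain ⟨hdom, hi, him, hc⟩ := (mem_filter.1 hd).2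
    have h2 : #(bipartiteAbove Face rooms d) = 2 := by
      rw [← card_rooms_of_nonempty hu (τ := d.1) (D := d.2) ?_ hdom hc]
      · simp only [bipartiteAbove, rooms, filter_filter]
      · rw [nonempty_iff_ne_empty]
        intro he
        refine hne (Prod.ext he ?_)
        rw [he, card_empty, zero_add, card_eq_one] at hc
        obtain ⟨j, hj⟩ := hc
        rw [hj, mem_singleton] at hi
        rw [hj, hi]
    rw [h2]
    exact even_two
  rw [h] at hodd
  exact (Nat.not_even_iff_odd.2 hodd) heven

end Scarf

/-! ### Brouwer's fixed point theorem for simplices and cubes -/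

namespace Scarf

open Finset

/-- The points of the simplex with denominator `N`, scaled by `N`. -/
abbrev Grid (ι : Type*) [Fintype ι] (N : ℕ) : Type _ :=
  {x : ι → Fin (N + 1) // ∑ i, (x i : ℕ) = N}

/-- Coordinate order on the grid, with ties broken by an enumeration. -/
noncomputable def gridOrder {ι : Type*} [Fintype ι] [DecidableEq ι] (N : ℕ) (i : ι)
    (x : Grid ι N) : ℕ :=
  (x.1 i : ℕ) * Fintype.card (Grid ι N) + Fintype.equivFin (Grid ι N) x

section

variable {ι : Type*} [Fintype ι] [DecidableEq ι] {N : ℕ}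

lemma gridOrder_lt {i : ι} {x y : Grid ι N} (h : (x.1 i : ℕ) < y.1 i) :
    gridOrder N i x < gridOrder N i y := by
  unfold gridOrder
  have h1 := (Fintype.equivFin (Grid ι N) x).2
  have h2 := Nat.mul_le_mul_right (Fintype.card (Grid ι N)) (Nat.succ_le_of_lt h)
  rw [Nat.succ_mul] at h2
  omega

lemma gridOrder_injective (i : ι) : Function.Injective (gridOrder (ι := ι) N i) := by
  intro x y h
  have hxy : (x.1 i : ℕ) = y.1 i := by
    by_contra hne
    rcases Nat.lt_or_gt_of_ne hne with h' | h'
    · exact (gridOrder_lt h').ne h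
    · exact (gridOrder_lt h').ne' h
  unfold gridOrder at h
  rw [hxy] at h
  exact (Fintype.equivFin _).injective (Fin.ext (Nat.add_left_cancel h))

/-- The points of a dominant set of grid points are close to each other and to a face. -/
lemma Dominant.grid_le [Nonempty (Grid ι N)] {σ : Finset (Grid ι N)} {C : Finset ι}
    (h : Dominant (gridOrder N) σ C) (hσ : σ.Nonempty) :
    ∃ m : ι → ℕ, (∀ x ∈ σ, ∀ i, m i ≤ x.1 i ∧ (x.1 i : ℕ) ≤ m i + Fintype.card ι) ∧
      ∀ i ∉ C, m i = 0 := by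
  choose w hw hmin using fun i => exists_min_image σ (fun x => (x.1 i : ℕ)) hσ
  refine ⟨fun i => if i ∈ C then (w i).1 i else 0, ?_, fun i hi => if_neg hi⟩
  -- Otherwise a grid point would exceed all minima in the coordinates of `C`, against dominance;
  -- the mass left over goes to some coordinate in `C`.
  have hsum : N < ∑ i ∈ C, (((w i).1 i : ℕ) + 1) := by
    by_contra hle
    push Not at hle
    obtain ⟨j, hj, -⟩ := h (Classical.arbitrary _)
    set s := ∑ i ∈ C, (((w i).1 i : ℕ) + 1) with hs
    let y : ι → ℕ := fun i => (if i ∈ C then ((w i).1 i : ℕ) + 1 else 0) + if i = j then N - s else 0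
    have hy : ∑ i, y i = N := by
      simp only [y, sum_add_distrib, sum_ite_mem, univ_inter, sum_ite_eq', mem_univ, if_true]
      rw [← sum_add_distrib, ← hs]
      omega
    have hyN : ∀ i, y i < N + 1 := fun i =>
      Nat.lt_succ_of_le (hy ▸ single_le_sum (fun _ _ => Nat.zero_le _) (mem_univ i))
    obtain ⟨i, hi, hlt⟩ := h ⟨fun i => ⟨y i, hyN i⟩, hy⟩
    refine absurd (hlt _ (hw i)) (not_le.2 (gridOrder_lt ?_))
    simp only [y, hi, if_true]
    omega
  intro x hx i
  have hlow : ∀ i, (if i ∈ C then ((w i).1 i : ℕ) else 0) ≤ x.1 i := by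
    intro i
    split
    · exact hmin i x hx
    · exact Nat.zero_le _
  refine ⟨hlow i, ?_⟩
  -- The coordinates of `x` sum to `N`, which the lower bounds miss by less than the number of
  -- elements of `C`.
  have h1 : ∑ i, ((x.1 i : ℕ) - if i ∈ C then ((w i).1 i : ℕ) else 0) ≤ Fintype.card ι := by
    have h2 : ∑ i, ((x.1 i : ℕ) - if i ∈ C then ((w i).1 i : ℕ) else 0) +
        ∑ i, (if i ∈ C then ((w i).1 i : ℕ) else 0) = N := by
      rw [← sum_add_distrib]
      exact (sum_congr rfl fun i _ => Nat.sub_add_cancel (hlow i)).trans x.2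
    rw [sum_ite_mem, univ_inter] at h2
    rw [sum_add_distrib, sum_const, smul_eq_mul, mul_one] at hsum
    have := card_le_univ C
    omega
  have h3 := (single_le_sum (f := fun i => ((x.1 i : ℕ) - if i ∈ C then ((w i).1 i : ℕ) else 0))
    (fun _ _ => Nat.zero_le _) (mem_univ i)).trans h1
  exact tsub_le_iff_left.1 h3

end

end Scarf

-- A grid point `x` gets as colour a coordinate with `x i ≤ f x i`, which exists because both sides
-- sum to `1`. In a colourful room all points are close together; a coordinate in `C` is the colour
-- of one of them, and the coordinates off `C` are so small that the inequality holds up to the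
-- error.
open Finset Filter Topology in
lemma stdSimplex.exists_approx_fixedPoint {ι : Type*} [Fintype ι] [Nonempty ι]
    {f : (ι → ℝ) → ι → ℝ} (hf : ∀ x ∈ stdSimplex ℝ ι, f x ∈ stdSimplex ℝ ι) (N : ℕ) :
    ∃ x ∈ stdSimplex ℝ ι, ∀ i, ∃ y ∈ stdSimplex ℝ ι,
      dist y x ≤ Fintype.card ι * (1 / ((N : ℝ) + 1)) ∧
      y i ≤ f y i + Fintype.card ι * (1 / ((N : ℝ) + 1)) := by
  classical
  let e : Scarf.Grid ι (N + 1) → ι → ℝ := fun x i => (x.1 i : ℕ) * (1 / ((N : ℝ) + 1))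
  have hN : (0 : ℝ) < (N : ℝ) + 1 := by positivity
  have he : ∀ x, e x ∈ stdSimplex ℝ ι := by
    intro x
    refine ⟨fun i => by positivity, ?_⟩
    simp only [e]
    rw [← sum_mul, ← Nat.cast_sum, x.2]
    push_cast
    field_simp
  have hcol : ∀ x, ∃ i, e x i ≤ f (e x) i := by
    intro x
    by_contra hcon
    push Not at hcon
    have := sum_lt_sum_of_nonempty (univ_nonempty (α := ι)) fun i _ => hcon i
    rw [(he x).2, (hf _ (he x)).2] at this
    exact lt_irrefl _ this
  choose c hc using hcol
  have hne : Nonempty (Scarf.Grid ι (N + 1)) := by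
    refine ⟨⟨fun i => if i = Classical.arbitrary ι then Fin.last _ else 0, ?_⟩⟩
    simp [apply_ite Fin.val]
  obtain ⟨σ, C, hdom, hσC⟩ := Scarf.exists_colorful Scarf.gridOrder_injective c
  obtain ⟨j, hj, -⟩ := hdom hne.some
  obtain ⟨x, hx, -⟩ := mem_image.1 (hσC ▸ hj)
  obtain ⟨m, hm, hm0⟩ := hdom.grid_le ⟨x, hx⟩
  refine ⟨e x, he x, fun i => ?_⟩
  by_cases hi : i ∈ C
  · obtain ⟨y, hy, rfl⟩ := mem_image.1 (hσC ▸ hi)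
    refine ⟨e y, he y, ?_, (hc y).trans (le_add_of_nonneg_right (by positivity))⟩
    rw [dist_pi_le_iff (by positivity)]
    intro k
    have h1 := hm x hx k
    have h2 := hm y hy k
    simp only [e]
    rw [Real.dist_eq, ← sub_mul, abs_mul, abs_of_pos (a := 1 / ((N : ℝ) + 1)) (by positivity)]
    refine mul_le_mul_of_nonneg_right ?_ (by positivity)
    rw [abs_le]
    have h3 : (x.1 k : ℕ) ≤ (y.1 k : ℕ) + Fintype.card ι := by omega
    have h4 : (y.1 k : ℕ) ≤ (x.1 k : ℕ) + Fintype.card ι := by omega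
    have h3' : ((x.1 k : ℕ) : ℝ) ≤ (y.1 k : ℕ) + Fintype.card ι := mod_cast h3
    have h4' : ((y.1 k : ℕ) : ℝ) ≤ (x.1 k : ℕ) + Fintype.card ι := mod_cast h4
    constructor <;> linarith
  · refine ⟨e x, he x, ?_, ?_⟩
    · rw [dist_self]
      positivity
    · have h1 := (hm x hx i).2
      rw [hm0 i hi, zero_add] at h1
      have h1' : ((x.1 i : ℕ) : ℝ) ≤ Fintype.card ι := mod_cast h1
      have h2 := (hf _ (he x)).1 i
      have h3 : e x i ≤ Fintype.card ι * (1 / ((N : ℝ) + 1)) :=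
        mul_le_mul_of_nonneg_right h1' (by positivity)
      linarith

open Filter Topology in
/-- Brouwer's fixed point theorem for the standard simplex. -/
theorem stdSimplex.exists_fixedPoint {ι : Type*} [Fintype ι] [Nonempty ι]
    {f : (ι → ℝ) → ι → ℝ} (hf : ∀ x ∈ stdSimplex ℝ ι, f x ∈ stdSimplex ℝ ι)
    (hc : ContinuousOn f (stdSimplex ℝ ι)) : ∃ x ∈ stdSimplex ℝ ι, f x = x := by
  choose x hx y hy hyx hfy using stdSimplex.exists_approx_fixedPoint hf
  obtain ⟨a, ha, φ, hφ, hlim⟩ := (isCompact_stdSimplex ℝ ι).tendsto_subseq hx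
  have h0 : Tendsto (fun N : ℕ => Fintype.card ι * (1 / ((φ N : ℝ) + 1))) atTop (𝓝 0) := by
    simpa using (tendsto_one_div_add_atTop_nhds_zero_nat.comp hφ.tendsto_atTop).const_mul
      (Fintype.card ι : ℝ)
  have hle : ∀ i, a i ≤ f a i := by
    intro i
    have hyl : Tendsto (fun N => y (φ N) i) atTop (𝓝 a) := by
      rw [tendsto_iff_dist_tendsto_zero] at hlim ⊢
      refine squeeze_zero (fun _ => dist_nonneg) (fun N => dist_triangle _ (x (φ N)) _) ?_
      simpa using (squeeze_zero (fun _ => dist_nonneg) (fun N => hyx (φ N) i) h0).add hlim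
    have hfl : Tendsto (fun N => f (y (φ N) i)) atTop (𝓝 (f a)) :=
      (hc a ha).tendsto.comp (tendsto_nhdsWithin_iff.2 ⟨hyl, Eventually.of_forall fun N => hy _ _⟩)
    have h1 := (tendsto_pi_nhds.1 hyl) i
    have h2 := ((tendsto_pi_nhds.1 hfl) i).add h0
    rw [add_zero] at h2
    exact le_of_tendsto_of_tendsto' h1 h2 fun N => hfy (φ N) i
  refine ⟨a, ha, ?_⟩
  -- Coordinatewise inequality with equal sums forces equality.
  have hsum : ∑ i, a i = ∑ i, f a i := by rw [ha.2, (hf a ha).2]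
  funext i
  exact ((Finset.sum_eq_sum_iff_of_le fun i _ => hle i).1 hsum i (Finset.mem_univ i)).symm

/-- Brouwer's fixed point theorem for the unit cube. -/
theorem exists_fixedPoint_cube {ι : Type*} [Fintype ι] {f : (ι → ℝ) → ι → ℝ}
    (hf : ∀ x ∈ Set.Icc (0 : ι → ℝ) 1, f x ∈ Set.Icc (0 : ι → ℝ) 1)
    (hc : ContinuousOn f (Set.Icc 0 1)) : ∃ x ∈ Set.Icc (0 : ι → ℝ) 1, f x = x := by
  -- The cube, shrunk by `m`, fits into the simplex on `Option ι`: the coordinate `none` takes up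
  -- the remaining mass, and `clip` retracts the simplex onto the cube.
  set m : ℝ := Fintype.card ι + 1 with hm
  have hm0 : 0 < m := by positivity
  let clip : (Option ι → ℝ) → ι → ℝ := fun y i => min 1 (m * y (some i))
  let g : (Option ι → ℝ) → Option ι → ℝ := fun y o =>
    o.elim (1 - ∑ i, f (clip y) i / m) fun i => f (clip y) i / m
  have hclip : ∀ y ∈ stdSimplex ℝ (Option ι), clip y ∈ Set.Icc (0 : ι → ℝ) 1 := by
    intro y hy
    exact ⟨fun i => le_min zero_le_one (mul_nonneg hm0.le (hy.1 _)), fun i => min_le_left _ _⟩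
  have hg : ∀ y ∈ stdSimplex ℝ (Option ι), g y ∈ stdSimplex ℝ (Option ι) := by
    intro y hy
    have h := hf _ (hclip y hy)
    refine ⟨?_, by simp [g, Fintype.sum_option]⟩
    rintro (_ | i)
    · simp only [g, Option.elim, sub_nonneg, ← Finset.sum_div]
      rw [div_le_one hm0]
      refine (Finset.sum_le_card_nsmul _ _ 1 fun i _ => h.2 i).trans ?_
      simp [hm]
    · exact div_nonneg (h.1 i) hm0.le
  have hcl : Continuous clip := by fun_prop
  have hfc : ContinuousOn (fun y => f (clip y)) (stdSimplex ℝ (Option ι)) :=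
    hc.comp hcl.continuousOn hclip
  have hgc : ContinuousOn g (stdSimplex ℝ (Option ι)) := by
    rw [continuousOn_pi] at hfc ⊢
    rintro (_ | i)
    · exact continuousOn_const.sub (continuousOn_finsetSum _ fun i _ => (hfc i).div_const m)
    · exact (hfc i).div_const m
  obtain ⟨y, hy, hfix⟩ := stdSimplex.exists_fixedPoint hg hgc
  refine ⟨clip y, hclip y hy, ?_⟩
  funext i
  have h1 : f (clip y) i / m = y (some i) := congrFun hfix (some i)
  have h2 : m * y (some i) = f (clip y) i := by
    rw [← h1]
    field_simp
  have h3 : f (clip y) i ≤ 1 := (hf _ (hclip y hy)).2 i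
  change f (clip y) i = min 1 (m * y (some i))
  rw [h2, min_eq_right h3]

/-! ### Nonsingular regions of piecewise linear equations -/

open Filter Topology

/-- The linear system that describes the solutions of `r i = min 1 ((E + C r) i / l i)` with value
`1` off `S` and without truncation on `S`: its matrix. -/
def regionMatrix {ι R : Type*} [DecidableEq ι] [CommRing R] (l : ι → R) (C : Matrix ι ι R)
    (S : ι → R) : Matrix ι ι R :=
  fun i j => S i * (l i * (if i = j then 1 else 0) - C i j) + (1 - S i) * (if i = j then 1 else 0)

/-- The right hand side of the linear system of `regionMatrix`. -/
def regionVector {ι R : Type*} [CommRing R] (E S : ι → R) : ι → R :=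
  fun i => S i * E i + (1 - S i)

lemma regionMatrix_mulVec {ι R : Type*} [Fintype ι] [DecidableEq ι] [CommRing R] (l : ι → R)
    (C : Matrix ι ι R) (S r : ι → R) (i : ι) :
    (regionMatrix l C S).mulVec r i = S i * (l i * r i - ∑ j, C i j * r j) + (1 - S i) * r i := by
  simp only [regionMatrix, Matrix.mulVec, dotProduct, add_mul, Finset.sum_add_distrib, mul_assoc,
    sub_mul, ← Finset.mul_sum, Finset.sum_sub_distrib]
  simp

section

variable {n : ℕ} {l E : Fin n → ℝ} {C : Matrix (Fin n) (Fin n) ℝ}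

/-- The indicator of a finite set. -/
def ind (S : Finset (Fin n)) (i : Fin n) : ℝ := if i ∈ S then 1 else 0

/-- The region `S` contains a solution of the equations with constant terms `E`. -/
def RegionSolution (l E : Fin n → ℝ) (C : Matrix (Fin n) (Fin n) ℝ) (S : Finset (Fin n))
    (r : Fin n → ℝ) : Prop :=
  (∀ i, 0 ≤ r i ∧ r i ≤ 1 ∧ l i * r i ≤ E i + ∑ j, C i j * r j) ∧
    (regionMatrix l C (ind S)).mulVec r = regionVector E (ind S)

/-- Brouwer's theorem for the map `r i ↦ min 1 ((E + C r) i / l i)`; the region consists of the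
indices at which the untruncated equation holds. -/
lemma exists_regionSolution (hl : ∀ i, 0 ≤ l i)
    (hpos : ∀ r ∈ Set.Icc (0 : Fin n → ℝ) 1, ∀ i, 0 ≤ E i + ∑ j, C i j * r j) :
    ∃ S : Finset (Fin n), (∀ i ∈ S, 0 < l i) ∧ ∃ r, RegionSolution l E C S r := by
  let f : (Fin n → ℝ) → Fin n → ℝ := fun r i =>
    if 0 < l i then min 1 ((E i + ∑ j, C i j * r j) / l i) else 1
  obtain ⟨r, hr, hfix⟩ := exists_fixedPoint_cube (f := f) (by
    intro r hr
    constructor <;> intro i <;> simp only [f] <;> split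
    · next h => exact le_min zero_le_one (div_nonneg (hpos r hr i) h.le)
    · exact zero_le_one
    · exact min_le_left _ _
    · exact le_rfl) (by
    refine Continuous.continuousOn (continuous_pi fun i => ?_)
    by_cases h : 0 < l i
    · simp only [f, h, if_true]
      fun_prop
    · simp only [f, h, if_false]
      fun_prop)
  have hfix' : ∀ i, 0 < l i → r i = min 1 ((E i + ∑ j, C i j * r j) / l i) := by
    intro i hi
    have := congrFun hfix i
    simp only [f, hi, if_true] at this
    exact this.symm
  have hfix0 : ∀ i, ¬ 0 < l i → r i = 1 := by
    intro i hi
    have := congrFun hfix i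
    simp only [f, hi, if_false] at this
    exact this.symm
  refine ⟨Finset.univ.filter fun i => 0 < l i ∧ l i * r i = E i + ∑ j, C i j * r j,
    fun i hi => (Finset.mem_filter.1 hi).2.1, r, fun i => ⟨hr.1 i, hr.2 i, ?_⟩, ?_⟩
  · by_cases h : 0 < l i
    · have h1 : r i ≤ (E i + ∑ j, C i j * r j) / l i := (hfix' i h).trans_le (min_le_right _ _)
      rwa [le_div_iff₀ h, mul_comm] at h1
    · rw [le_antisymm (not_lt.1 h) (hl i), zero_mul]
      exact hpos r hr i
  · funext i
    rw [regionMatrix_mulVec]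
    simp only [regionVector, ind, Finset.mem_filter, Finset.mem_univ, true_and]
    split
    · next h => linarith [h.2]
    · next h =>
      suffices r i = 1 by linarith
      by_cases hi : 0 < l i
      · rcases min_choice 1 ((E i + ∑ j, C i j * r j) / l i) with h' | h'
        · exact (hfix' i hi).trans h'
        · refine absurd ⟨hi, ?_⟩ h
          have := (hfix' i hi).trans h'
          rw [eq_div_iff hi.ne', mul_comm] at this
          exact this
      · exact hfix0 i hi

/-- For all but finitely many perturbations, a solution lies in no region with a singular system. -/
lemma finite_singular_perturbations (l E : Fin n → ℝ) (C : Matrix (Fin n) (Fin n) ℝ)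
    (S : Finset (Fin n)) (hS : (regionMatrix l C (ind S)).det = 0) :
    {ε : ℝ | ∃ r, (regionMatrix l C (ind S)).mulVec r =
      regionVector (fun i => E i + ε ^ ((i : ℕ) + 1)) (ind S)}.Finite := by
  -- Pairing the system with the left kernel vector `v` leaves a polynomial condition on `ε`. The
  -- perturbations use distinct powers, so their contributions cannot cancel.
  obtain ⟨v, hv, hvB⟩ := Matrix.exists_vecMul_eq_zero_iff.2 hS
  let p : Polynomial ℝ := ∑ i, Polynomial.C (v i * ind S i) * Polynomial.X ^ ((i : ℕ) + 1) +
    Polynomial.C (∑ i, v i * regionVector E (ind S) i)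
  have hcoeff : ∀ i : Fin n, p.coeff (i + 1) = v i * ind S i := by
    intro i
    simp only [p, Polynomial.coeff_add, Polynomial.finsetSum_coeff, Polynomial.coeff_C_mul_X_pow,
      Polynomial.coeff_C_succ, add_zero, Nat.add_right_cancel_iff, Fin.val_inj]
    simp
  -- If all these coefficients vanish, `v` is supported off `S`, where the rows of the matrix are
  -- rows of the identity; then `v = 0`.
  have hp : p ≠ 0 := by
    intro hp
    have h0 : ∀ i, v i * ind S i = 0 := fun i => by rw [← hcoeff i, hp, Polynomial.coeff_zero]
    apply hv
    funext j
    by_cases hj : j ∈ S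
    · simpa [ind, hj] using h0 j
    · have h1 := congrFun hvB j
      simp only [Matrix.vecMul, dotProduct, regionMatrix, Pi.zero_apply, mul_add] at h1
      rw [Finset.sum_add_distrib, Finset.sum_eq_zero, zero_add, Finset.sum_eq_single j] at h1
      · simpa [ind, hj] using h1
      · intro i _ hij
        simp [hij]
      · simp
      · intro i _
        rw [← mul_assoc, h0 i, zero_mul]
  refine (p.rootSet_finite ℝ).subset ?_
  rintro ε ⟨r, hr⟩
  rw [Polynomial.mem_rootSet]
  refine ⟨hp, ?_⟩
  have h1 : dotProduct v ((regionMatrix l C (ind S)).mulVec r) = 0 := by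
    rw [Matrix.dotProduct_mulVec, hvB, zero_dotProduct]
  rw [hr] at h1
  rw [← h1]
  simp only [p, Polynomial.coe_aeval_eq_eval, Polynomial.eval_add, Polynomial.eval_finsetSum,
    Polynomial.eval_mul, Polynomial.eval_C, Polynomial.eval_pow, Polynomial.eval_X, dotProduct,
    regionVector]
  rw [← Finset.sum_add_distrib]
  exact Finset.sum_congr rfl fun i _ => by ring

/-- A generic small perturbation avoids all singular regions, and regularity makes the passage to
the limit possible: the solution in a fixed regular region is a continuous function of `ε`. -/
lemma exists_nonsingular_region (hl : ∀ i, 0 ≤ l i)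
    (hpos : ∀ r ∈ Set.Icc (0 : Fin n → ℝ) 1, ∀ i, 0 ≤ E i + ∑ j, C i j * r j) :
    ∃ S : Finset (Fin n), (∀ i ∈ S, 0 < l i) ∧ (regionMatrix l C (ind S)).det ≠ 0 ∧
      ∃ r, RegionSolution l E C S r := by
  let Eε : ℝ → Fin n → ℝ := fun ε i => E i + ε ^ ((i : ℕ) + 1)
  have hex : ∀ ε : ℝ, 0 < ε → ∃ S : Finset (Fin n), (∀ i ∈ S, 0 < l i) ∧
      ∃ r, RegionSolution l (Eε ε) C S r := fun ε hε =>
    exists_regionSolution hl fun r hr i => by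
      have h1 := hpos r hr i
      have h2 : 0 < ε ^ ((i : ℕ) + 1) := by positivity
      simp only [Eε]
      linarith
  have hev : ∀ᶠ ε in 𝓝[>] (0 : ℝ), ∃ S : Finset (Fin n), (∀ i ∈ S, 0 < l i) ∧
      (regionMatrix l C (ind S)).det ≠ 0 ∧ ∃ r, RegionSolution l (Eε ε) C S r := by
    have hfin : {ε : ℝ | ∃ S : Finset (Fin n), (regionMatrix l C (ind S)).det = 0 ∧
        ∃ r, (regionMatrix l C (ind S)).mulVec r = regionVector (Eε ε) (ind S)}.Finite := by
      have : ∀ S : Finset (Fin n), {ε : ℝ | (regionMatrix l C (ind S)).det = 0 ∧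
          ∃ r, (regionMatrix l C (ind S)).mulVec r = regionVector (Eε ε) (ind S)}.Finite := by
        intro S
        by_cases hS : (regionMatrix l C (ind S)).det = 0
        · exact (finite_singular_perturbations l E C S hS).subset fun ε h => h.2
        · exact Set.Finite.subset Set.finite_empty fun ε h => hS h.1
      refine (Set.finite_iUnion this).subset ?_
      rintro ε ⟨S, h⟩
      exact Set.mem_iUnion.2 ⟨S, h⟩
    have h1 : ∀ᶠ ε in 𝓝[>] (0 : ℝ), ε ∉ {ε : ℝ | ∃ S : Finset (Fin n),
        (regionMatrix l C (ind S)).det = 0 ∧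
        ∃ r, (regionMatrix l C (ind S)).mulVec r = regionVector (Eε ε) (ind S)} := by
      -- The value `0` may itself be exceptional, so it is removed before the complement is taken as
      -- a neighbourhood of `0`.
      have := (hfin.sdiff (t := {(0 : ℝ)})).isClosed.compl_mem_nhds (x := (0 : ℝ)) (by simp)
      filter_upwards [mem_nhdsWithin_of_mem_nhds this, self_mem_nhdsWithin] with ε h1 h2 h3
      exact h1 ⟨h3, (ne_of_gt h2 : ε ≠ 0)⟩
    filter_upwards [h1, self_mem_nhdsWithin] with ε h1 h2
    obtain ⟨S, hS, r, hr⟩ := hex ε h2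
    exact ⟨S, hS, fun h => h1 ⟨S, h, r, hr.2⟩, r, hr⟩
  -- Pigeonhole: there are finitely many regions, so one of them recurs for arbitrarily small `ε`.
  obtain ⟨S, hS⟩ : ∃ S : Finset (Fin n), ∃ᶠ ε in 𝓝[>] (0 : ℝ), (∀ i ∈ S, 0 < l i) ∧
      (regionMatrix l C (ind S)).det ≠ 0 ∧ ∃ r, RegionSolution l (Eε ε) C S r := by
    by_contra hcon
    simp only [not_exists, not_frequently] at hcon
    obtain ⟨ε, ⟨S, h1⟩, h2⟩ := (hev.and (eventually_all.2 hcon)).exists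
    exact h2 S h1
  obtain ⟨-, hSl, hdet, -⟩ := hS.exists
  refine ⟨S, hSl, hdet, ?_⟩
  let G : ℝ → Fin n → ℝ := fun ε =>
    (regionMatrix l C (ind S))⁻¹.mulVec (regionVector (Eε ε) (ind S))
  have hunit : IsUnit (regionMatrix l C (ind S)).det := isUnit_iff_ne_zero.2 hdet
  have hG : Continuous G := by
    refine Continuous.matrix_mulVec continuous_const (continuous_pi fun i => ?_)
    simp only [regionVector, Eε]
    fun_prop
  have hK : IsClosed {q : ℝ × (Fin n → ℝ) | ∀ i, 0 ≤ q.2 i ∧ q.2 i ≤ 1 ∧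
      l i * q.2 i ≤ Eε q.1 i + ∑ j, C i j * q.2 j} := by
    simp only [Set.ofPred_forall, Set.ofPred_and]
    refine isClosed_iInter fun i => ?_
    have hE : Continuous fun q : ℝ × (Fin n → ℝ) => Eε q.1 i := by
      simp only [Eε]
      fun_prop
    refine (isClosed_le ?_ ?_).inter ((isClosed_le ?_ ?_).inter (isClosed_le ?_ ?_)) <;> fun_prop
  have hlim : Tendsto (fun ε => (ε, G ε)) (𝓝[>] (0 : ℝ)) (𝓝 ((0 : ℝ), G 0)) :=
    ((continuous_id.prodMk hG).tendsto 0).mono_left nhdsWithin_le_nhds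
  have hmem := hK.mem_of_frequently_of_tendsto (hS.mono ?_) hlim
  · have hE0 : Eε 0 = E := by
      funext i
      simp [Eε]
    refine ⟨G 0, ?_, ?_⟩
    · simpa only [Set.mem_ofPred_eq, hE0] using hmem
    · simp only [G, hE0]
      rw [Matrix.mulVec_mulVec, Matrix.mul_nonsing_inv _ hunit, Matrix.one_mulVec]
  · rintro ε ⟨-, -, r, hr, hr'⟩
    have : G ε = r := by
      simp only [G]
      rw [← hr', Matrix.mulVec_mulVec, Matrix.nonsing_inv_mul _ hunit, Matrix.one_mulVec]
    simp only [this]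
    exact hr

end

namespace RAM

/-! ### Costs relative to a unit -/

/-- A syntactic bound on the cost of one round of a program, per bit of the registers. -/
def Program.weight : Program → ℕ
  | .skip => 1
  | .put _ e f => e.costWeight + f.costWeight + 1
  | .seq P Q => P.weight + Q.weight
  | .branch e P Q => e.costWeight + P.weight + Q.weight + 1
  | .loop e P => e.costWeight + P.weight + 100

/-- `P` halts at a cost of at most `U`, up to the factor `P.weight`. -/
def HaltsIn (P : Program) (U : ℕ) (m : Memory) (Q : Memory → Prop) : Prop :=
  Halts P m (P.weight * U) Q

lemma HaltsIn.mono {P : Program} {U U' : ℕ} {m : Memory} {Q Q' : Memory → Prop}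
    (h : HaltsIn P U m Q) (hU : U ≤ U') (hQ : ∀ m', Q m' → Q' m') : HaltsIn P U' m Q' :=
  Halts.mono h (Nat.mul_le_mul_left _ hU) hQ

lemma HaltsIn.seq {P Q : Program} {U : ℕ} {m : Memory} {R S : Memory → Prop}
    (h : HaltsIn P U m R) (h' : ∀ m', R m' → HaltsIn Q U m' S) : HaltsIn (.seq P Q) U m S := by
  unfold HaltsIn Program.weight
  rw [Nat.add_mul]
  exact Halts.seq h h'

lemma HaltsIn.put {B U : ℕ} {m : Memory} (hm : m.Bounded B) (hU : B ≤ U) (a : ℕ) (e f : Expr)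
    {Q : Memory → Prop} (hQ : Q (m.write a (e.eval m) (f.eval m))) :
    HaltsIn (.put a e f) U m Q :=
  Halts.mono (Halts.put hm a e f hQ) (Nat.mul_le_mul_left _ hU) fun _ h => h

/-- The number of rounds enters the unit and not the weight, so the weight of the final program is a
constant. The `100` in `Program.weight` absorbs the overhead of a round. -/
lemma HaltsIn.loop {e : Expr} {P : Program} {B U n : ℕ} (I : ℕ → Memory → Prop)
    (hB : ∀ k m, I k m → m.Bounded B) (hU : B ≤ U)
    (hstep : ∀ k < n, ∀ m, I k m → 0 < e.eval m ∧ HaltsIn P U m (I (k + 1)))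
    (hend : ∀ m, I n m → e.eval m ≤ 0) {m : Memory} (h0 : I 0 m) :
    HaltsIn (.loop e P) ((n + 1) * U) m (I n) := by
  refine Halts.mono (Halts.loop I hB hstep hend h0) ?_ fun _ h => h
  have h1 := (hB _ _ h0).one_le
  rw [mul_left_comm]
  apply Nat.mul_le_mul_left
  change _ ≤ (e.costWeight + P.weight + 100) * U
  have h2 : e.costWeight * B ≤ e.costWeight * U := Nat.mul_le_mul_left _ hU
  nlinarith

/-! ### Bounds on values -/

/-- `|x| ≤ (2 ^ L) ^ e`. -/
def Bd (L e : ℕ) (x : ℤ) : Prop := x.natAbs ≤ 2 ^ (L * e)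

section

variable {L e f : ℕ} {x y : ℤ}

lemma Bd.mono (h : Bd L e x) (hef : e ≤ f) : Bd L f x :=
  h.trans (Nat.pow_le_pow_right (by norm_num) (Nat.mul_le_mul_left _ hef))

lemma Bd.zero : Bd L e 0 := by simp [Bd]

lemma Bd.one : Bd L e 1 := by simpa [Bd] using Nat.one_le_two_pow

lemma Bd.mul (hx : Bd L e x) (hy : Bd L f y) : Bd L (e + f) (x * y) := by
  unfold Bd
  rw [Int.natAbs_mul, Nat.mul_add, pow_add]
  exact Nat.mul_le_mul hx hy

lemma Bd.div (hx : Bd L e x) : Bd L e (x / y) := (Int.natAbs_ediv_le_natAbs x y).trans hx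

/-- A sum of `n + 1` terms costs a single unit of the exponent, since `n + 1 ≤ 2 ^ L`. -/
lemma Bd.add_sum {ι : Type*} {s : Finset ι} {t : ι → ℤ} {n : ℕ} (hL : n + 1 ≤ L) (hs : s.card ≤ n)
    (hx : Bd L e x) (ht : ∀ k ∈ s, Bd L e (t k)) : Bd L (e + 1) (x + ∑ k ∈ s, t k) := by
  have h1 : n + 1 ≤ 2 ^ L := hL.trans Nat.lt_two_pow_self.le
  have h2 : (∑ k ∈ s, t k).natAbs ≤ n * 2 ^ (L * e) :=
    (Int.natAbs_sum_le _ _).trans ((Finset.sum_le_card_nsmul _ _ _ ht).trans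
      (Nat.mul_le_mul_right _ hs))
  unfold Bd at *
  rw [Nat.mul_add, mul_one, pow_add]
  have h3 := Int.natAbs_add_le x (∑ k ∈ s, t k)
  nlinarith [Nat.mul_le_mul_left (2 ^ (L * e)) h1]

lemma Bd.neg (hx : Bd L e x) : Bd L e (-x) := by simpa [Bd] using hx

lemma Bd.add (hL : 1 ≤ L) (hx : Bd L e x) (hy : Bd L e y) : Bd L (e + 1) (x + y) := by
  have h1 : 2 ≤ 2 ^ L := by simpa using Nat.pow_le_pow_right (n := 2) (by norm_num) hL
  unfold Bd at *
  rw [Nat.mul_add, mul_one, pow_add]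
  have h3 := Int.natAbs_add_le x y
  nlinarith [Nat.mul_le_mul_left (2 ^ (L * e)) h1]

lemma Bd.sub (hL : 1 ≤ L) (hx : Bd L e x) (hy : Bd L e y) : Bd L (e + 1) (x - y) := by
  rw [sub_eq_add_neg]
  exact hx.add hL hy.neg

/-- Bit length of the registers in the runs on inputs of bit length at most `L`. -/
def cap (L : ℕ) : ℕ := L * (30 * L) + 2

lemma Bd.bitLength_le (h : Bd L e x) (he : e ≤ 30 * L) : bitLength x ≤ cap L := by
  refine (bitLength_le_of_lt (b := L * e + 1) ?_).trans ?_
  · have : 0 < 2 ^ (L * e) := by positivity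
    unfold Bd at h
    rw [pow_succ]
    omega
  · have := Nat.mul_le_mul_left L he
    unfold cap
    omega

lemma Bd.of_le {k : ℕ} (h : k ≤ 2 ^ L) : Bd L 1 (k : ℤ) := by
  simpa [Bd] using h

end

/-! ### Tabulation over index types -/

/-- Cost unit for tabulations. -/
def tabUnit (L : ℕ) : ℕ := cap L * ((L + 1) * (L + 1))

lemma cap_le_tabUnit (L : ℕ) : cap L ≤ tabUnit L :=
  Nat.le_mul_of_pos_right _ (by positivity)

lemma HaltsIn.tabulate {ι : Type*} {a num L : ℕ} {N K init step fin : Expr} {m : Memory}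
    (enc : ι → ℕ) (hlt : ∀ x, enc x < num) (hinj : Function.Injective enc)
    (hsurj : ∀ p < num, ∃ x, enc x = p) (acc : ι → ℕ → ℤ) (len : ι → ℕ) (val : ι → ℤ)
    (ha : a ≠ 2 ∧ a ≠ 3 ∧ a ≠ 4) (hL : 1 ≤ L) (hm : m.Bounded (cap L)) (hnum : num ≤ L)
    (hlen : ∀ x, len x ≤ L)
    (hacc : ∀ x, ∀ k ≤ len x, Bd L (30 * L) (acc x k)) (hval : ∀ x, Bd L (30 * L) (val x))
    (hN : ∀ m', m.EqOff a m' → N.eval m' = num)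
    (hK : ∀ x, ∀ m', m.EqOff a m' → m' 2 0 = enc x → K.eval m' = len x)
    (hinit : ∀ x, ∀ m', m.EqOff a m' → m' 2 0 = enc x → init.eval m' = acc x 0)
    (hstep : ∀ x, ∀ k < len x, ∀ m', m.EqOff a m' → m' 2 0 = enc x → m' 3 0 = k →
      m' 4 0 = acc x k → step.eval m' = acc x (k + 1))
    (hfin : ∀ x, ∀ m', m.EqOff a m' → m' 2 0 = enc x → m' 4 0 = acc x (len x) →
      fin.eval m' = val x) :
    HaltsIn (tabulate a N K init step fin) (tabUnit L) m
      (fun m' => m'.Bounded (cap L) ∧ m.EqOff a m' ∧ ∀ x, m' a (enc x) = val x) := by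
  have hbit : ∀ k : ℕ, k ≤ L → bitLength k ≤ cap L := fun k hk =>
    (Bd.of_le (hk.trans Nat.lt_two_pow_self.le)).bitLength_le (by omega)
  rcases isEmpty_or_nonempty ι with hι | hι
  · have hnum0 : num = 0 := by
      by_contra h
      obtain ⟨x, -⟩ := hsurj 0 (Nat.pos_of_ne_zero h)
      exact hι.elim x
    refine Halts.mono (Halts.tabulate (n := num) (κ := L) (fun _ _ => 0) (fun _ => 0) (fun _ => 0)
      ha hm (hbit _ hnum) (hbit _ le_rfl) ?_ ?_ ?_ hN ?_ ?_ ?_ ?_) ?_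
      fun m' h => ⟨h.1, h.2.1, fun x => hι.elim x⟩
    iterate 7 (intro p hp; omega)
    -- Each of the two nested loops contributes `100` to `Program.weight`, which covers the constant
    -- in `tabulateWeight`.
    rw [tabUnit, ← mul_assoc (Program.weight _)]
    refine Nat.mul_le_mul (Nat.mul_le_mul_right _ ?_)
      (Nat.mul_le_mul_right _ (Nat.add_le_add_right hnum 1))
    simp only [tabulateWeight, RAM.tabulate, forLoop, Program.weight, Expr.costWeight, Expr.weight]
    omega
  · let g : ℕ → ι := Function.invFun enc
    have hg : ∀ p < num, enc (g p) = p := fun p hp => Function.invFun_eq (hsurj p hp)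
    have hg' : ∀ x, g (enc x) = x := Function.leftInverse_invFun hinj
    refine Halts.mono (Halts.tabulate (n := num) (κ := L) (fun p => acc (g p)) (fun p => len (g p))
      (fun p => val (g p)) ha hm (hbit _ hnum) (hbit _ le_rfl) (fun p _ => hlen _)
      (fun p _ k hk => (hacc _ k hk).bitLength_le le_rfl)
      (fun p _ => (hval _).bitLength_le le_rfl) hN ?_ ?_ ?_ ?_) ?_
      fun m' h => ⟨h.1, h.2.1, fun x => by rw [h.2.2 _ (hlt x), hg']⟩
    · intro p hp m' h1 h2
      exact hK _ m' h1 (by rw [h2, hg p hp])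
    · intro p hp m' h1 h2
      exact hinit _ m' h1 (by rw [h2, hg p hp])
    · intro p hp k hk m' h1 h2
      exact hstep _ k hk m' h1 (by rw [h2, hg p hp])
    · intro p hp m' h1 h2
      exact hfin _ m' h1 (by rw [h2, hg p hp])
    rw [tabUnit, ← mul_assoc (Program.weight _)]
    refine Nat.mul_le_mul (Nat.mul_le_mul_right _ ?_)
      (Nat.mul_le_mul_right _ (Nat.add_le_add_right hnum 1))
    simp only [tabulateWeight, RAM.tabulate, forLoop, Program.weight, Expr.costWeight, Expr.weight]
    omega

/-- Tabulation of values that need no inner loop. -/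
def tabulateVal (a : ℕ) (N fin : Expr) : Program :=
  tabulate a N (.const 0) (.const 0) (.const 0) fin

lemma HaltsIn.tabulateVal {ι : Type*} {a num L : ℕ} {N fin : Expr} {m : Memory}
    (enc : ι → ℕ) (hlt : ∀ x, enc x < num) (hinj : Function.Injective enc)
    (hsurj : ∀ p < num, ∃ x, enc x = p) (val : ι → ℤ)
    (ha : a ≠ 2 ∧ a ≠ 3 ∧ a ≠ 4) (hL : 1 ≤ L) (hm : m.Bounded (cap L)) (hnum : num ≤ L)
    (hval : ∀ x, Bd L (30 * L) (val x))
    (hN : ∀ m', m.EqOff a m' → N.eval m' = num)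
    (hfin : ∀ x, ∀ m', m.EqOff a m' → m' 2 0 = enc x → fin.eval m' = val x) :
    HaltsIn (tabulateVal a N fin) (tabUnit L) m
      (fun m' => m'.Bounded (cap L) ∧ m.EqOff a m' ∧ ∀ x, m' a (enc x) = val x) :=
  HaltsIn.tabulate enc hlt hinj hsurj (fun _ _ => 0) (fun _ => 0) val ha hL hm hnum
    (fun _ => Nat.zero_le _) (fun _ _ _ => Bd.zero) hval hN (fun _ _ _ _ => rfl)
    (fun _ _ _ _ => rfl) (fun _ k hk => absurd hk (Nat.not_lt_zero k))
    (fun x m' h1 h2 _ => hfin x m' h1 h2)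

/-- The accumulator holds the partial sum over the indices below `k`. The strict bound on `b` leaves
one unit of the exponent for the summation. -/
lemma HaltsIn.tabulateSum {ι : Type*} {a num L n b : ℕ} {N K init step fin : Expr} {m : Memory}
    (enc : ι → ℕ) (hlt : ∀ x, enc x < num) (hinj : Function.Injective enc)
    (hsurj : ∀ p < num, ∃ x, enc x = p) (z : ι → ℤ) (t : ι → Fin n → ℤ) (val : ι → ℤ)
    (ha : a ≠ 2 ∧ a ≠ 3 ∧ a ≠ 4) (hL : n + 1 ≤ L) (hm : m.Bounded (cap L)) (hnum : num ≤ L)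
    (hz : ∀ x, Bd L b (z x)) (ht : ∀ x k, Bd L b (t x k)) (hb : b < 30 * L)
    (hval : ∀ x, Bd L (30 * L) (val x))
    (hN : ∀ m', m.EqOff a m' → N.eval m' = num) (hK : ∀ m', m.EqOff a m' → K.eval m' = n)
    (hinit : ∀ x, ∀ m', m.EqOff a m' → m' 2 0 = enc x → init.eval m' = z x)
    (hstep : ∀ x (k : Fin n) s, ∀ m', m.EqOff a m' → m' 2 0 = enc x → m' 3 0 = (k : ℕ) →
      m' 4 0 = s → step.eval m' = s + t x k)
    (hfin : ∀ x, ∀ m', m.EqOff a m' → m' 2 0 = enc x → m' 4 0 = z x + ∑ k, t x k →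
      fin.eval m' = val x) :
    HaltsIn (RAM.tabulate a N K init step fin) (tabUnit L) m
      (fun m' => m'.Bounded (cap L) ∧ m.EqOff a m' ∧ ∀ x, m' a (enc x) = val x) := by
  refine HaltsIn.tabulate enc hlt hinj hsurj
    (fun x k => z x + ∑ j ∈ Finset.univ.filter (fun j : Fin n => (j : ℕ) < k), t x j)
    (fun _ => n) val ha (by omega) hm hnum (fun _ => by omega) ?_ hval hN
    (fun _ m' h _ => hK m' h) ?_ ?_ ?_
  · intro x k _
    exact (Bd.add_sum hL ((Finset.card_le_univ _).trans_eq (Fintype.card_fin n)) (hz x)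
      fun j _ => ht x j).mono hb
  · intro x m' h1 h2
    simpa using hinit x m' h1 h2
  · intro x k hk m' h1 h2 h3 h4
    rw [hstep x ⟨k, hk⟩ _ m' h1 h2 h3 h4, add_assoc]
    congr 1
    have : (Finset.univ.filter fun j : Fin n => (j : ℕ) < k + 1) =
        insert ⟨k, hk⟩ (Finset.univ.filter fun j : Fin n => (j : ℕ) < k) := by
      ext j
      simp only [Finset.mem_filter, Finset.mem_univ, true_and, Finset.mem_insert, Fin.ext_iff]
      omega
    rw [this, Finset.sum_insert (by simp), add_comm]
  · intro x m' h1 h2 h3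
    refine hfin x m' h1 h2 ?_
    rw [h3, Finset.filter_true_of_mem fun j _ => j.2]

/-- Row-major position of a pair of indices. -/
def pairIndex {n : ℕ} (x : Fin n × Fin n) : ℕ := x.1 * n + x.2

lemma pairIndex_lt {n : ℕ} (x : Fin n × Fin n) : pairIndex x < n * n := by
  have h1 := x.1.2
  have h2 := x.2.2
  have : (x.1 + 1 : ℕ) * n ≤ n * n := Nat.mul_le_mul_right _ h1
  rw [Nat.add_mul, one_mul] at this
  unfold pairIndex
  omega

lemma pairIndex_div {n : ℕ} (x : Fin n × Fin n) : pairIndex x / n = x.1 := by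
  unfold pairIndex
  rw [Nat.add_comm, Nat.add_mul_div_right _ _ (by have := x.1.2; omega), Nat.div_eq_of_lt x.2.2,
    zero_add]

lemma pairIndex_injective {n : ℕ} : Function.Injective (pairIndex (n := n)) := by
  intro x y h
  have h1 : (x.1 : ℕ) = y.1 := by rw [← pairIndex_div, h, pairIndex_div]
  have h2 : (x.2 : ℕ) = y.2 := by
    unfold pairIndex at h
    rw [h1] at h
    omega
  exact Prod.ext (Fin.ext h1) (Fin.ext h2)

lemma pairIndex_surj {n : ℕ} (p : ℕ) (hp : p < n * n) : ∃ x : Fin n × Fin n, pairIndex x = p := by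
  have hn : 0 < n := Nat.pos_of_ne_zero fun h => by simp [h] at hp
  refine ⟨(⟨p / n, Nat.div_lt_of_lt_mul hp⟩, ⟨p % n, Nat.mod_lt _ hn⟩), ?_⟩
  simp only [pairIndex]
  rw [mul_comm]
  exact Nat.div_add_mod p n

lemma fin_surj {n : ℕ} (p : ℕ) (hp : p < n) : ∃ x : Fin n, (x : ℕ) = p := ⟨⟨p, hp⟩, rfl⟩

end RAM

namespace RAM

/-! ### The program: preprocessing

Array `0` is the input and array `1` the output, the arrays `2`, `3`, `4` hold the local variables of
tabulations. Array `5` holds the common denominator, `6` the scaled input, `7`, `8` and `9` the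
coefficients of the clearing equations. -/

/-- The register `0` of an array. -/
def Expr.reg (a : ℕ) : Expr := .get a (.const 0)

/-- The number of banks. -/
def Expr.num : Expr := .reg 0

/-- The row of the current position in a matrix. -/
def Expr.row : Expr := .div (.reg 2) .num

/-- The column of the current position in a matrix. -/
def Expr.col : Expr := .sub (.reg 2) (.mul .row .num)

/-- The entry of a matrix. -/
def Expr.entry (a : ℕ) (i j : Expr) : Expr := .get a (.add (.mul i .num) j)

/-- The number of rationals in the input. -/
def Expr.size : Expr :=
  .add (.add .num (.mul .num .num)) (.mul (.mul .num .num) .num)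

@[simp] lemma Expr.eval_const (m : Memory) (z : ℤ) : (Expr.const z).eval m = z := rfl
@[simp] lemma Expr.eval_get (m : Memory) (a : ℕ) (e : Expr) :
    (Expr.get a e).eval m = m a (e.eval m) := rfl
@[simp] lemma Expr.eval_add (m : Memory) (e f : Expr) :
    (Expr.add e f).eval m = e.eval m + f.eval m := rfl
@[simp] lemma Expr.eval_sub (m : Memory) (e f : Expr) :
    (Expr.sub e f).eval m = e.eval m - f.eval m := rfl
@[simp] lemma Expr.eval_mul (m : Memory) (e f : Expr) :
    (Expr.mul e f).eval m = e.eval m * f.eval m := rfl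
@[simp] lemma Expr.eval_div (m : Memory) (e f : Expr) :
    (Expr.div e f).eval m = e.eval m / f.eval m := rfl
@[simp] lemma Expr.eval_reg (m : Memory) (a : ℕ) : (Expr.reg a).eval m = m a 0 := rfl
@[simp] lemma Expr.eval_num (m : Memory) : Expr.num.eval m = m 0 0 := rfl
@[simp] lemma Expr.eval_entry (m : Memory) (a : ℕ) (e f : Expr) :
    (Expr.entry a e f).eval m = m a (e.eval m * m 0 0 + f.eval m) := rfl

lemma Expr.eval_row {m : Memory} {n : ℕ} {x : Fin n × Fin n} (h0 : m 0 0 = n)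
    (h2 : m 2 0 = pairIndex x) : Expr.row.eval m = (x.1 : ℕ) := by
  simp only [Expr.row, Expr.eval_div, Expr.eval_reg, Expr.eval_num, h0, h2]
  exact_mod_cast pairIndex_div x

lemma Expr.eval_col {m : Memory} {n : ℕ} {x : Fin n × Fin n} (h0 : m 0 0 = n)
    (h2 : m 2 0 = pairIndex x) : Expr.col.eval m = (x.2 : ℕ) := by
  simp only [Expr.col, Expr.eval_sub, Expr.eval_mul, Expr.eval_reg, Expr.eval_num,
    Expr.eval_row h0 h2, h0, h2]
  simp [pairIndex]

/-- Scaling to a common denominator, and the coefficients of the clearing equations. -/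
def prelude : Program :=
  -- Position `0` of the input holds the number of banks, so the rational with number `t` occupies
  -- the positions `1 + 2 * t` and `2 + 2 * t`.
  .seq (tabulate 5 (.const 1) .size (.const 1)
    (.mul (.reg 4) (.get 0 (.add (.const 2) (.mul (.const 2) (.reg 3))))) (.reg 4)) <|
  .seq (tabulateVal 6 .size (.mul (.get 0 (.add (.const 1) (.mul (.const 2) (.reg 2))))
    (.div (.reg 5) (.get 0 (.add (.const 2) (.mul (.const 2) (.reg 2))))))) <|
  .seq (tabulate 7 .num .num (.const 0)
    (.add (.reg 4) (.get 6 (.add .num (.add (.mul (.reg 2) .num) (.reg 3))))) (.reg 4)) <|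
  .seq (tabulate 8 (.mul .num .num) .num (.get 6 (.add .num (.add (.mul .col .num) .row)))
    (.sub (.reg 4) (.get 6 (.add (.add .num (.mul .num .num))
      (.add (.mul (.add (.mul (.reg 3) .num) .row) .num) .col)))) (.reg 4))
  (tabulate 9 .num .num (.get 6 (.reg 2))
    (.add (.reg 4) (.sub (.get 6 (.add .num (.add (.mul (.reg 3) .num) (.reg 2))))
      (.entry 8 (.reg 2) (.reg 3)))) (.reg 4))

end RAM

namespace Clearing

/-! ### Scaled coefficients -/

/-- The number of rationals in the description of a network. -/
def inputSize (n : ℕ) : ℕ := n + n * n + n * n * n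

/-- The rationals of the input, scaled to the common denominator. -/
def scaled (n : ℕ) (num den : ℕ → ℤ) (t : ℕ) : ℤ :=
  num t * ((∏ k ∈ Finset.range (inputSize n), den k) / den t)

/-- Scaled liabilities from debt contracts. -/
def coeffL {n : ℕ} (g : ℕ → ℤ) (i : Fin n) : ℤ := 0 + ∑ j : Fin n, g (n + (i * n + j))

/-- Scaled coefficients of the recovery rates in the assets. -/
def coeffC {n : ℕ} (g : ℕ → ℤ) : Matrix (Fin n) (Fin n) ℤ := fun i k =>
  g (n + (k * n + i)) + ∑ j : Fin n, -g (n + n * n + ((j * n + i) * n + k))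

/-- Scaled constant terms of the assets. -/
def coeffE {n : ℕ} (g : ℕ → ℤ) (i : Fin n) : ℤ :=
  g i + ∑ k : Fin n, (g (n + (k * n + i)) - coeffC g i k)

section

variable {n L : ℕ} {g : ℕ → ℤ}

lemma bd_coeffL (hL : n + 1 ≤ L) (hg : ∀ t, RAM.Bd L 2 (g t)) (i : Fin n) :
    RAM.Bd L 3 (coeffL g i) :=
  RAM.Bd.add_sum hL (by simp) .zero fun _ _ => hg _

lemma bd_coeffC (hL : n + 1 ≤ L) (hg : ∀ t, RAM.Bd L 2 (g t)) (i k : Fin n) :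
    RAM.Bd L 3 (coeffC g i k) :=
  RAM.Bd.add_sum hL (by simp) (hg _) fun _ _ => (hg _).neg

lemma bd_coeffE (hL : n + 1 ≤ L) (hg : ∀ t, RAM.Bd L 2 (g t)) (i : Fin n) :
    RAM.Bd L 5 (coeffE g i) :=
  RAM.Bd.add_sum hL (by simp) ((hg _).mono (by norm_num)) fun k _ =>
    ((hg _).mono (by norm_num)).sub (by omega) (bd_coeffC hL hg i k)

lemma debt_index_lt (i j : Fin n) : n + (i * n + j) < inputSize n := by
  have := RAM.pairIndex_lt (i, j)
  simp only [RAM.pairIndex] at this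
  unfold inputSize
  omega

lemma cds_index_lt (i j k : Fin n) : n + n * n + ((i * n + j) * n + k) < inputSize n := by
  have h1 := RAM.pairIndex_lt (i, j)
  simp only [RAM.pairIndex] at h1
  have h2 := Nat.mul_le_mul_right n (Nat.succ_le_of_lt h1)
  rw [Nat.succ_mul] at h2
  unfold inputSize
  have := k.2
  omega

lemma asset_index_lt (i : Fin n) : (i : ℕ) < inputSize n := by
  have := i.2
  unfold inputSize
  omega

end

end Clearing

namespace RAM

open Clearing

/-- The registers that the preprocessing computes, for the scaled input `g`. -/
structure Coeffs (n : ℕ) (g : ℕ → ℤ) (m : Memory) : Prop where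
  num : m 0 0 = n
  liability : ∀ i : Fin n, m 7 (i : ℕ) = coeffL g i
  matrix : ∀ x : Fin n × Fin n, m 8 (pairIndex x) = coeffC g x.1 x.2
  const : ∀ i : Fin n, m 9 (i : ℕ) = coeffE g i

lemma prelude_halts {n L : ℕ} {m : Memory} {num den : ℕ → ℤ} (hL : inputSize n + 1 ≤ L)
    (hm : m.Bounded (cap L)) (hn : m 0 0 = n)
    (hnum : ∀ t < inputSize n, m 0 (1 + 2 * t) = num t)
    (hden : ∀ t < inputSize n, m 0 (2 + 2 * t) = den t)
    (hbnum : ∀ t, Bd L 1 (num t))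
    (hbden : ∀ j, Bd L 1 (∏ k ∈ Finset.range j, den k)) :
    HaltsIn prelude (tabUnit L) m (fun m' => m'.Bounded (cap L) ∧ m' 10 = m 10 ∧ m' 11 = m 11 ∧
      Coeffs n (scaled n num den) m') := by
  have hsize : inputSize n = n + n * n + n * n * n := rfl
  have hnL : n + 1 ≤ L := by omega
  have hbg : ∀ t, Bd L 2 (scaled n num den t) := fun t => (hbnum t).mul (hbden _).div
  set g := scaled n num den with hg
  -- A table with a single entry serves as a plain loop; here it accumulates the product of the
  -- denominators.
  refine HaltsIn.seq (HaltsIn.tabulate (fun _ : Unit => 0) (num := 1) (by simp)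
    (fun _ _ _ => rfl) (fun p hp => ⟨(), by omega⟩)
    (fun _ k => ∏ j ∈ Finset.range k, den j) (fun _ => inputSize n)
    (fun _ => ∏ j ∈ Finset.range (inputSize n), den j) (by simp) (by omega) hm (by omega)
    (fun _ => by omega) (fun _ k _ => (hbden k).mono (by omega)) (fun _ => (hbden _).mono (by omega))
    (by simp) ?_ (by simp) ?_ (by simp)) ?_
  · intro _ m' h _
    simp [Expr.size, h 0, hn, hsize]
  · intro _ k hk m' h _ h3 h4
    have := hden k hk
    simp [h 0, h3, h4, this, Finset.prod_range_succ]
  rintro m1 ⟨hm1, h1, hv1⟩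
  refine HaltsIn.seq (HaltsIn.tabulateVal (fun x : Fin (inputSize n) => (x : ℕ)) (fun x => x.2)
    Fin.val_injective fin_surj (fun t => g t) (by simp) (by omega) hm1 (by omega)
    (fun t => (hbg t).mono (by omega)) ?_ ?_) ?_
  · intro m' h
    simp [Expr.size, h 0, h1 0, hn, hsize]
  · intro x m' h h2
    have e1 := hnum x x.2
    have e2 := hden x x.2
    have e3 := hv1 ()
    rw [Nat.cast_zero] at e3
    simp [h 0, h 5, h1 0, h2, e1, e2, e3, hg, scaled]
  rintro m2 ⟨hm2, h2, hv2⟩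
  have hv2' : ∀ t < inputSize n, m2 6 (t : ℕ) = g t := fun t ht => hv2 ⟨t, ht⟩
  refine HaltsIn.seq (HaltsIn.tabulateSum (n := n) (b := 2) (fun x : Fin n => (x : ℕ)) (fun x => x.2)
    Fin.val_injective fin_surj (fun _ => 0) (fun i j => g (n + (i * n + j))) (coeffL g)
    (by simp) hnL hm2 (by omega) (fun _ => .zero) (fun _ _ => hbg _) (by omega)
    (fun i => (bd_coeffL hnL hbg i).mono (by omega)) ?_ ?_ (by simp) ?_ ?_) ?_
  · intro m' h
    simp [h 0, h1 0, h2 0, hn]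
  · intro m' h
    simp [h 0, h1 0, h2 0, hn]
  · intro i j s m' h e2 e3 e4
    have := hv2' _ (debt_index_lt i j)
    push_cast at this
    simp [h 0, h 6, h1 0, h2 0, hn, e2, e3, e4, this]
  · intro i m' h e2 e4
    exact e4
  rintro m3 ⟨hm3, h3, hv3⟩
  have hn3 : m3 0 0 = n := by simp [h1 0, h2 0, h3 0, hn]
  refine HaltsIn.seq (HaltsIn.tabulateSum (n := n) (b := 2) pairIndex pairIndex_lt
    pairIndex_injective pairIndex_surj (fun x => g (n + (x.2 * n + x.1)))
    (fun x j => -g (n + n * n + ((j * n + x.1) * n + x.2))) (fun x => coeffC g x.1 x.2)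
    (by simp) hnL hm3 (by omega) (fun _ => hbg _) (fun _ _ => (hbg _).neg) (by omega)
    (fun x => (bd_coeffC hnL hbg x.1 x.2).mono (by omega)) ?_ ?_ ?_ ?_ ?_) ?_
  · intro m' h
    simp [h 0, hn3]
  · intro m' h
    simp [h 0, hn3]
  · intro x m' h e2
    have hn' : m' 0 0 = n := by simp [h 0, hn3]
    have := hv2' _ (debt_index_lt x.2 x.1)
    push_cast at this
    simp [hn', Expr.eval_row hn' e2, Expr.eval_col hn' e2, h 6, h3 6, this]
  · intro x j s m' h e2 e3 e4
    have hn' : m' 0 0 = n := by simp [h 0, hn3]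
    have := hv2' _ (cds_index_lt j x.1 x.2)
    push_cast at this
    simp [hn', Expr.eval_row hn' e2, Expr.eval_col hn' e2, h 6, h3 6, e3, e4, this,
      sub_eq_add_neg]
  · intro i m' h e2 e4
    exact e4
  rintro m4 ⟨hm4, h4, hv4⟩
  refine (HaltsIn.tabulateSum (n := n) (b := 4) (fun x : Fin n => (x : ℕ)) (fun x => x.2)
    Fin.val_injective fin_surj (fun i => g i) (fun i k => g (n + (k * n + i)) - coeffC g i k)
    (coeffE g) (by simp) hnL hm4 (by omega) (fun _ => (hbg _).mono (by omega))
    (fun i k => ((hbg _).mono (by omega)).sub (by omega) (bd_coeffC hnL hbg i k)) (by omega)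
    (fun i => (bd_coeffE hnL hbg i).mono (by omega)) ?_ ?_ ?_ ?_ ?_).mono le_rfl ?_
  · intro m' h
    simp [h 0, h4 0, hn3]
  · intro m' h
    simp [h 0, h4 0, hn3]
  · intro i m' h e2
    have := hv2' _ (asset_index_lt i)
    simp [h 6, h4 6, h3 6, e2, this]
  · intro i k s m' h e2 e3 e4
    have e5 := hv2' _ (debt_index_lt k i)
    have e6 := hv4 (i, k)
    simp only [pairIndex] at e6
    push_cast at e5 e6
    simp [h 0, h 6, h 8, h4 0, h4 6, h3 6, hn3, e2, e3, e4, e5, e6]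
  · intro i m' h e2 e4
    exact e4
  rintro m5 ⟨hm5, h5, hv5⟩
  refine ⟨hm5, ?_, ?_, ?_, ?_, ?_, hv5⟩
  · simp [h5 10, h4 10, h3 10, h2 10, h1 10]
  · simp [h5 11, h4 11, h3 11, h2 11, h1 11]
  · simp [h5 0, h4 0, hn3]
  · intro i
    simp [h5 7, h4 7, hv3]
  · intro x
    simp [h5 8, hv4]

end RAM

namespace RAM

open Clearing Matrix

/-! ### The program: solving the linear system of a region

Array `10` holds the number of the current region and array `11` the flag for success. Array `12` is
the region, `13` and `14` the linear system, and `15` to `18` belong to the Faddeev-LeVerrier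
iteration. -/

/-- Indicator of the value `0`. -/
def Expr.isZero (e : Expr) : Expr := .div (.const 1) (.add (.const 1) (.mul e e))

/-- Indicator of the nonnegative values. -/
def Expr.isNonneg (e : Expr) : Expr :=
  .add (.const 1) (.div e (.add (.const 1) (.mul e e)))

/-- The quotient `1 / (1 + x * x)` is `1` at `0` and rounds down to `0` elsewhere. -/
lemma Expr.eval_isZero (m : Memory) (e : Expr) :
    e.isZero.eval m = if e.eval m = 0 then 1 else 0 := by
  simp only [Expr.isZero, Expr.eval_div, Expr.eval_const, Expr.eval_add, Expr.eval_mul]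
  split
  · next h => simp [h]
  · next h =>
    have := mul_self_pos.2 h
    exact Int.ediv_eq_zero_of_lt zero_le_one (by linarith)

/-- As `|x| < 1 + x * x`, the quotient `x / (1 + x * x)` rounds down to `0` for `x ≥ 0` and to `-1`
for `x < 0`. -/
lemma Expr.eval_isNonneg (m : Memory) (e : Expr) :
    e.isNonneg.eval m = if 0 ≤ e.eval m then 1 else 0 := by
  simp only [Expr.isNonneg, Expr.eval_div, Expr.eval_const, Expr.eval_add, Expr.eval_mul]
  generalize e.eval m = x
  split
  · next h =>
    rw [Int.ediv_eq_zero_of_lt h (by nlinarith), add_zero]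
  · next h =>
    have h1 : x / (1 + x * x) = -1 := by
      rw [Int.ediv_eq_iff_of_pos (by nlinarith)]
      constructor <;> nlinarith
    rw [h1]
    norm_num

/-- Choice of a region, and its linear system. -/
def setup : Program :=
  .seq (tabulate 12 .num (.reg 2) (.const 1) (.mul (.reg 4) (.const 2))
    (.mul (.sub (.div (.reg 10) (.reg 4))
      (.mul (.const 2) (.div (.reg 10) (.mul (.reg 4) (.const 2)))))
      (.sub (.const 1) (Expr.get 7 (.reg 2)).isZero))) <|
  .seq (tabulateVal 13 (.mul .num .num) (.sub (.const 0)
    (.add (.mul (.get 12 .row)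
      (.sub (.mul (.get 7 .row) (Expr.sub .row .col).isZero) (.get 8 (.reg 2))))
      (.mul (.sub (.const 1) (.get 12 .row)) (Expr.sub .row .col).isZero)))) <|
  .seq (tabulateVal 14 .num (.add (.mul (.get 12 (.reg 2)) (.get 9 (.reg 2)))
    (.sub (.const 1) (.get 12 (.reg 2))))) <|
  .seq (tabulateVal 15 (.mul .num .num) (.const 0)) <|
  .seq (.put 16 (.const 0) (.const 1)) (.put 17 (.const 0) (.const 0))

/-- One round of the Faddeev-LeVerrier iteration. -/
def iteration : Program :=
  .seq (.put 17 (.const 0) (.add (.reg 17) (.const 1))) <|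
  .seq (tabulateVal 18 (.mul .num .num)
    (.add (.get 15 (.reg 2)) (.mul (.reg 16) (Expr.sub .row .col).isZero))) <|
  .seq (tabulate 15 (.mul .num .num) .num (.const 0)
    (.add (.reg 4) (.mul (.entry 13 .row (.reg 3)) (.entry 18 (.reg 3) .col))) (.reg 4))
  (tabulate 16 (.const 1) .num (.const 0) (.add (.reg 4) (.entry 15 (.reg 3) (.reg 3)))
    (.div (.sub (.const 0) (.reg 4)) (.reg 17)))

end RAM

/-! ### Growth of the numbers in the system of a region and in the iteration -/

namespace Clearing

open RAM Matrix

/-- The region with number `k`, restricted to the banks with liabilities. -/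
def region {n : ℕ} (l : Fin n → ℤ) (k : ℕ) (i : Fin n) : ℤ :=
  if k.testBit i ∧ l i ≠ 0 then 1 else 0

/-- The left side is what `setup` evaluates: a binary digit as a difference of two quotients, set to
`0` at banks without liabilities. -/
lemma region_eq {n : ℕ} (l : Fin n → ℤ) (k : ℕ) (i : Fin n) :
    ((k : ℤ) / (2 ^ (i : ℕ)) - 2 * ((k : ℤ) / (2 ^ (i : ℕ) * 2))) *
      (1 - if l i = 0 then 1 else 0) = region l k i := by
  have h1 : (k : ℤ) / (2 ^ (i : ℕ)) - 2 * ((k : ℤ) / (2 ^ (i : ℕ) * 2)) =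
      if k.testBit i then 1 else 0 := by
    rw [← Int.ediv_ediv_of_nonneg (by positivity)]
    have : (k : ℤ) / 2 ^ (i : ℕ) = ((k / 2 ^ (i : ℕ) : ℕ) : ℤ) := by push_cast; rfl
    rw [this, Nat.testBit_eq_decide_div_mod_eq]
    simp only [decide_eq_true_eq]
    split <;> omega
  rw [h1]
  unfold region
  by_cases h2 : k.testBit i <;> by_cases h3 : l i = 0 <;> simp [h2, h3]

section

variable {n L : ℕ} {l E S : Fin n → ℤ} {C : Matrix (Fin n) (Fin n) ℤ}

lemma bd_region (l : Fin n → ℤ) (k : ℕ) (i : Fin n) : Bd L 0 (region l k i) := by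
  unfold region
  split
  · exact .one
  · exact .zero

lemma bd_ite (p : Prop) [Decidable p] (e : ℕ) : Bd L e (if p then 1 else 0) := by
  split
  · exact .one
  · exact .zero

lemma bd_regionMatrix (hL : 1 ≤ L) (hl : ∀ i, Bd L 3 (l i)) (hC : ∀ i j, Bd L 3 (C i j))
    (hS : ∀ i, Bd L 0 (S i)) (i j : Fin n) : Bd L 5 (-regionMatrix l C S i j) := by
  refine Bd.neg (Bd.add (e := 4) hL (((hS i).mul (f := 4) ?_).mono (by norm_num)) ?_)
  · exact (((hl i).mul (bd_ite _ 0)).mono (by norm_num)).sub (e := 3) hL (hC i j)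
  · exact ((Bd.one.sub hL (hS i)).mul (bd_ite _ 0)).mono (by norm_num)

lemma bd_regionVector (hL : 1 ≤ L) (hE : ∀ i, Bd L 5 (E i)) (hS : ∀ i, Bd L 0 (S i))
    (i : Fin n) : Bd L 6 (regionVector E S i) :=
  Bd.add (e := 5) hL (((hS i).mul (hE i)).mono (by norm_num))
    ((Bd.one.sub hL (hS i)).mono (by norm_num))

lemma bd_faddeev_aux (hL : n + 1 ≤ L) {A M : Matrix (Fin n) (Fin n) ℤ} (hA : ∀ i j, Bd L 5 (A i j))
    {e : ℕ} (hM : ∀ i j, Bd L e (M i j)) :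
    (∀ i j k, Bd L (e + 5) (A i k * M k j)) ∧ (∀ i j, Bd L (e + 6) ((A * M) i j)) ∧
      Bd L (e + 7) (trace (A * M)) := by
  have h1 : ∀ i j k, Bd L (e + 5) (A i k * M k j) := fun i j k =>
    ((hA i k).mul (hM k j)).mono (by omega)
  have h2 : ∀ i j, Bd L (e + 6) ((A * M) i j) := fun i j => by
    rw [Matrix.mul_apply, ← zero_add (∑ k, _)]
    exact Bd.add_sum hL (by simp) .zero fun k _ => h1 i j k
  refine ⟨h1, h2, ?_⟩
  unfold trace
  rw [← zero_add (∑ k, _)]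
  exact Bd.add_sum hL (by simp) .zero fun k _ => h2 k k

/-- A round costs eight units of the exponent: one for adding the scalar matrix, five for an entry
of `A`, one for the sum in the matrix product and one for the trace. The division does not increase
the bound. -/
lemma bd_faddeev (hL : n + 1 ≤ L) {A : Matrix (Fin n) (Fin n) ℤ} (hA : ∀ i j, Bd L 5 (A i j))
    (k : ℕ) : (∀ i j, Bd L (8 * k) ((faddeev A k).1 i j)) ∧
      (∀ i j, Bd L (8 * k) ((faddeev A k).2.1 i j)) ∧ Bd L (8 * k) (faddeev A k).2.2 := by
  induction k with
  | zero => exact ⟨fun _ _ => .zero, fun _ _ => .zero, .one⟩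
  | succ k ih =>
    obtain ⟨-, hV, hc⟩ := ih
    have hM : ∀ i j, Bd L (8 * k + 1) ((faddeev A (k + 1)).1 i j) := fun i j => by
      refine Bd.add (by omega) (hV i j) ?_
      rw [Matrix.smul_apply, Matrix.one_apply, smul_eq_mul]
      exact hc.mul (bd_ite _ 0)
    obtain ⟨-, h2, h3⟩ := bd_faddeev_aux hL hA hM
    refine ⟨fun i j => (hM i j).mono (by omega), fun i j => (h2 i j).mono (by omega), ?_⟩
    refine Bd.mono (Bd.div ?_) (show 8 * k + 1 + 7 ≤ 8 * (k + 1) by omega)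
    rw [zero_sub]
    exact h3.neg

end

end Clearing

/-! ### Memory states of setup and iteration -/

namespace RAM

open Clearing Matrix

/-- The state of the Faddeev-LeVerrier iteration after `k` rounds. -/
structure Iterate {n : ℕ} (A : Matrix (Fin n) (Fin n) ℤ) (b : Fin n → ℤ) (k : ℕ)
    (m : Memory) : Prop where
  matrix : ∀ x : Fin n × Fin n, m 13 (pairIndex x) = A x.1 x.2
  vector : ∀ i : Fin n, m 14 (i : ℕ) = b i
  -- Array `18` is written only within a round; before the first one it may hold remains of an
  -- earlier region.
  adjugate : 0 < k → ∀ x : Fin n × Fin n, m 18 (pairIndex x) = (faddeev A k).1 x.1 x.2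
  product : ∀ x : Fin n × Fin n, m 15 (pairIndex x) = (faddeev A k).2.1 x.1 x.2
  coeff : m 16 0 = (faddeev A k).2.2
  round : m 17 0 = k

/-- The matrix of the region with number `k`, with the opposite sign. -/
def negMatrix (n : ℕ) (g : ℕ → ℤ) (k : ℕ) : Matrix (Fin n) (Fin n) ℤ :=
  -regionMatrix (coeffL g) (coeffC g) (region (coeffL g) k)

/-- The right hand side for the region with number `k`. -/
def rhs (n : ℕ) (g : ℕ → ℤ) (k : ℕ) : Fin n → ℤ :=
  regionVector (coeffE g) (region (coeffL g) k)

lemma Coeffs.congr {n : ℕ} {g : ℕ → ℤ} {m m' : Memory} (h : Coeffs n g m) (h0 : m' 0 = m 0)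
    (h7 : m' 7 = m 7) (h8 : m' 8 = m 8) (h9 : m' 9 = m 9) : Coeffs n g m' :=
  ⟨h0 ▸ h.num, h7 ▸ h.liability, h8 ▸ h.matrix, h9 ▸ h.const⟩

lemma sub_coe_eq_zero_iff {n : ℕ} (i j : Fin n) : ((i : ℕ) : ℤ) - ((j : ℕ) : ℤ) = 0 ↔ i = j := by
  rw [Fin.ext_iff]
  omega

variable {n L : ℕ} {g : ℕ → ℤ} {m : Memory}

lemma setup_halts (hL : inputSize n + 1 ≤ L) (hm : m.Bounded (cap L))
    (hg : ∀ t, Bd L 2 (g t)) (h : Coeffs n g m) {k : ℕ} (hk : m 10 0 = k) :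
    HaltsIn setup (tabUnit L) m (fun m' => m'.Bounded (cap L) ∧ m' 10 = m 10 ∧ m' 11 = m 11 ∧
      Coeffs n g m' ∧ Iterate (negMatrix n g k) (rhs n g k) 0 m') := by
  have hsize : inputSize n = n + n * n + n * n * n := rfl
  have hnL : n + 1 ≤ L := by omega
  have hbl := bd_coeffL hnL hg
  have hbC := bd_coeffC hnL hg
  have hbE := bd_coeffE hnL hg
  have hbS : ∀ i : Fin n, Bd L 0 (region (coeffL g) k i) := bd_region _ k
  refine HaltsIn.seq (HaltsIn.tabulate (fun x : Fin n => (x : ℕ)) (fun x => x.2)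
    Fin.val_injective fin_surj (fun _ j => (2 : ℤ) ^ j) (fun i => i)
    (fun i => region (coeffL g) k i) (by simp) (by omega) hm (by omega)
    (fun i => by have := i.2; omega) ?_ (fun i => (hbS i).mono (by omega)) ?_ ?_ ?_ ?_ ?_) ?_
  · intro i j hj
    refine Bd.mono (e := 1) ?_ (by omega)
    have := Nat.pow_le_pow_right (n := 2) (by norm_num) (show j ≤ L by have := i.2; omega)
    exact_mod_cast Bd.of_le this
  · intro m' h'
    simp [h' 0, h.num]
  · intro i m' h' h2
    simp [h2]
  · simp
  · intro i j _ m' h' h2 h3 h4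
    simp [h4, pow_succ]
  · intro i m' h' h2 h4
    simp only [Expr.eval_mul, Expr.eval_sub, Expr.eval_div, Expr.eval_reg, Expr.eval_const,
      Expr.eval_isZero, Expr.eval_get, h2, h4]
    simp only [h' 10 (by simp) (by simp) (by simp) (by simp), hk,
      h' 7 (by simp) (by simp) (by simp) (by simp), h.liability]
    exact region_eq _ _ _
  rintro m1 ⟨hm1, h1, hv1⟩
  have hn1 : m1 0 0 = n := by simp [h1 0, h.num]
  refine HaltsIn.seq (HaltsIn.tabulateVal pairIndex pairIndex_lt pairIndex_injective pairIndex_surj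
    (fun x => negMatrix n g k x.1 x.2) (by simp) (by omega) hm1 (by omega)
    (fun x => (bd_regionMatrix (by omega) hbl hbC hbS x.1 x.2).mono (by omega)) ?_ ?_) ?_
  · intro m' h'
    simp [h' 0, hn1]
  · intro x m' h' h2
    have hn' : m' 0 0 = n := by simp [h' 0, hn1]
    simp [Expr.eval_isZero, Expr.eval_row hn' h2, Expr.eval_col hn' h2, h2, h' 12, hv1, h' 7,
      h1 7, h.liability, h' 8, h1 8, h.matrix, negMatrix, regionMatrix, sub_coe_eq_zero_iff]
  rintro m2 ⟨hm2, h2, hv2⟩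
  have hn2 : m2 0 0 = n := by simp [h2 0, hn1]
  refine HaltsIn.seq (HaltsIn.tabulateVal (fun x : Fin n => (x : ℕ)) (fun x => x.2)
    Fin.val_injective fin_surj (fun x => rhs n g k x) (by simp) (by omega) hm2 (by omega)
    (fun x => (bd_regionVector (by omega) hbE hbS x).mono (by omega)) ?_ ?_) ?_
  · intro m' h'
    simp [h' 0, hn2]
  · intro x m' h' e2
    simp [e2, h' 12, h2 12, hv1, h' 9, h2 9, h1 9, h.const, rhs, regionVector]
  rintro m3 ⟨hm3, h3, hv3⟩
  have hn3 : m3 0 0 = n := by simp [h3 0, hn2]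
  refine HaltsIn.seq (HaltsIn.tabulateVal pairIndex pairIndex_lt pairIndex_injective pairIndex_surj
    (fun _ : Fin n × Fin n => 0) (by simp) (by omega) hm3 (by omega) (fun _ => .zero) ?_ (by simp)) ?_
  · intro m' h'
    simp [h' 0, hn3]
  rintro m4 ⟨hm4, h4, hv4⟩
  have hb1 : bitLength 1 ≤ cap L := Bd.one.bitLength_le (e := 0) (by omega)
  have hb0 : bitLength 0 ≤ cap L := Bd.zero.bitLength_le (e := 0) (by omega)
  refine HaltsIn.seq (R := fun m' => m' = m4.write 16 0 1)
    (HaltsIn.put hm4 (cap_le_tabUnit L) _ _ _ rfl) ?_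
  rintro m5 rfl
  refine HaltsIn.put (hm4.write 16 0 hb1) (cap_le_tabUnit L) _ _ _ ⟨?_, ?_, ?_, ?_, ?_⟩
  · exact (hm4.write 16 0 hb1).write 17 _ hb0
  · funext j
    simp [Memory.write, h1 10, h2 10, h3 10, h4 10]
  · funext j
    simp [Memory.write, h1 11, h2 11, h3 11, h4 11]
  · refine h.congr ?_ ?_ ?_ ?_ <;> funext j
    · simp [Memory.write, h1 0, h2 0, h3 0, h4 0]
    · simp [Memory.write, h1 7, h2 7, h3 7, h4 7]
    · simp [Memory.write, h1 8, h2 8, h3 8, h4 8]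
    · simp [Memory.write, h1 9, h2 9, h3 9, h4 9]
  · constructor
    · intro x
      simp [Memory.write, h4 13, h3 13, hv2]
    · intro x
      simp [Memory.write, h4 14, hv3]
    · intro h
      exact absurd h (lt_irrefl 0)
    · intro x
      simp [Memory.write, hv4, faddeev]
    · simp [Memory.write, faddeev]
    · simp [Memory.write]

lemma iteration_halts (hL : inputSize n + 1 ≤ L) (hm : m.Bounded (cap L)) (h : Coeffs n g m)
    {A : Matrix (Fin n) (Fin n) ℤ} {b : Fin n → ℤ} (hA : ∀ i j, Bd L 5 (A i j)) {k : ℕ}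
    (hk : k < n) (hI : Iterate A b k m) :
    HaltsIn iteration (tabUnit L) m (fun m' => m'.Bounded (cap L) ∧ m' 10 = m 10 ∧ m' 11 = m 11 ∧
      Coeffs n g m' ∧ Iterate A b (k + 1) m') := by
  have hsize : inputSize n = n + n * n + n * n * n := rfl
  have hnL : n + 1 ≤ L := by omega
  obtain ⟨hbM, -, hbc⟩ := bd_faddeev hnL hA (k + 1)
  obtain ⟨hbt, hbV, -⟩ := bd_faddeev_aux hnL hA hbM
  have hbk : bitLength ((k + 1 : ℕ) : ℤ) ≤ cap L :=
    (Bd.of_le (show k + 1 ≤ 2 ^ L from (by omega : k + 1 ≤ L).trans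
      Nat.lt_two_pow_self.le)).bitLength_le (by omega)
  refine HaltsIn.seq (R := fun m' => m' = m.write 17 0 (k + 1 : ℕ))
    (HaltsIn.put hm (cap_le_tabUnit L) _ _ _ (by simp [hI.round])) ?_
  rintro m1 rfl
  have hm1 := hm.write 17 0 hbk
  set m1 := m.write 17 0 (k + 1 : ℕ) with hm1def
  have hoff : ∀ a, a ≠ 17 → m1 a = m a := fun a ha => by
    funext j
    simp [hm1def, Memory.write, ha]
  have h17 : m1 17 0 = (k + 1 : ℕ) := by simp [hm1def, Memory.write]
  have hn1 : m1 0 0 = n := by simp [hoff 0, h.num]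
  refine HaltsIn.seq (HaltsIn.tabulateVal pairIndex pairIndex_lt pairIndex_injective pairIndex_surj
    (fun x => (faddeev A (k + 1)).1 x.1 x.2) (by simp) (by omega) hm1 (by omega)
    (fun x => (hbM x.1 x.2).mono (by omega)) ?_ ?_) ?_
  · intro m' h'
    simp [h' 0, hn1]
  · intro x m' h' e2
    have hn' : m' 0 0 = n := by simp [h' 0, hn1]
    have hM : (faddeev A (k + 1)).1 x.1 x.2 = (faddeev A k).2.1 x.1 x.2 +
        (faddeev A k).2.2 * if x.1 = x.2 then 1 else 0 := by
      rw [← Matrix.one_apply, ← smul_eq_mul, ← Matrix.smul_apply, ← Matrix.add_apply]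
      rfl
    rw [hM]
    simp [Expr.eval_isZero, Expr.eval_row hn' e2, Expr.eval_col hn' e2, e2, h' 15, hoff 15,
      hI.product, h' 16, hoff 16, hI.coeff, sub_coe_eq_zero_iff]
  rintro m2 ⟨hm2, h2, hv2⟩
  have hn2 : m2 0 0 = n := by simp [h2 0, hn1]
  refine HaltsIn.seq (HaltsIn.tabulateSum (n := n) (b := 8 * (k + 1) + 5) pairIndex pairIndex_lt
    pairIndex_injective pairIndex_surj (fun _ => 0)
    (fun x j => A x.1 j * (faddeev A (k + 1)).1 j x.2)
    (fun x => (faddeev A (k + 1)).2.1 x.1 x.2) (by simp) hnL hm2 (by omega) (fun _ => .zero)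
    (fun x j => hbt x.1 x.2 j) (by omega) (fun x => (hbV x.1 x.2).mono (by omega))
    ?_ ?_ (by simp) ?_ ?_) ?_
  · intro m' h'
    simp [h' 0, hn2]
  · intro m' h'
    simp [h' 0, hn2]
  · intro x j s m' h' e2 e3 e4
    have hn' : m' 0 0 = n := by simp [h' 0, hn2]
    have e5 := hI.matrix (x.1, j)
    have e6 := hv2 (j, x.2)
    simp only [pairIndex] at e5 e6
    push_cast at e5 e6
    simp [hn', Expr.eval_row hn' e2, Expr.eval_col hn' e2, e3, e4, h' 13, h2 13, hoff 13, e5, h' 18,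
      e6]
  · intro x m' h' e2 e4
    rw [Expr.eval_reg, e4, zero_add]
    rfl
  rintro m3 ⟨hm3, h3, hv3⟩
  have hn3 : m3 0 0 = n := by simp [h3 0, hn2]
  refine (HaltsIn.tabulateSum (n := n) (b := 8 * (k + 1) + 6) (fun _ : Unit => 0) (num := 1)
    (by simp) (fun _ _ _ => rfl) (fun p hp => ⟨(), by omega⟩) (fun _ => 0)
    (fun _ j => (faddeev A (k + 1)).2.1 j j) (fun _ => (faddeev A (k + 1)).2.2) (by simp) hnL hm3
    (by omega) (fun _ => .zero) (fun _ j => hbV j j) (by omega) (fun _ => hbc.mono (by omega))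
    (by simp) ?_ (by simp) ?_ ?_).mono le_rfl ?_
  · intro m' h'
    simp [h' 0, hn3]
  · intro x j s m' h' e2 e3 e4
    have hn' : m' 0 0 = n := by simp [h' 0, hn3]
    have e5 := hv3 (j, j)
    simp only [pairIndex] at e5
    push_cast at e5
    simp [hn', e3, e4, h' 15, e5]
  · intro x m' h' e2 e4
    simp only [Expr.eval_div, Expr.eval_sub, Expr.eval_const, Expr.eval_reg, e4, zero_add]
    simp [h' 17, h3 17, h2 17, h17, faddeev, trace]
  rintro m4 ⟨hm4, h4, hv4⟩
  have hv4' := hv4 ()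
  rw [Nat.cast_zero] at hv4'
  refine ⟨hm4, ?_, ?_, ?_, ?_⟩
  · simp [h4 10, h3 10, h2 10, hoff 10]
  · simp [h4 11, h3 11, h2 11, hoff 11]
  · refine h.congr ?_ ?_ ?_ ?_
    · simp [h4 0, h3 0, h2 0, hoff 0]
    · simp [h4 7, h3 7, h2 7, hoff 7]
    · simp [h4 8, h3 8, h2 8, hoff 8]
    · simp [h4 9, h3 9, h2 9, hoff 9]
  · constructor
    · intro x
      simp [h4 13, h3 13, h2 13, hoff 13, hI.matrix]
    · intro x
      simp [h4 14, h3 14, h2 14, hoff 14, hI.vector]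
    · intro _ x
      simp [h4 18, h3 18, hv2]
    · intro x
      simp [h4 15, hv3]
    · exact hv4'
    · simp [h4 17, h3 17, h2 17, h17]

end RAM

namespace Clearing

open RAM Matrix

/-- The determinant of the region with number `k`, as computed by the iteration. -/
def regionDet (n : ℕ) (g : ℕ → ℤ) (k : ℕ) : ℤ := (faddeev (negMatrix n g k) n).2.2

/-- Numerators of the solution in the region with number `k`; the denominator is
`regionDet n g k ^ 2`. -/
def candidate (n : ℕ) (g : ℕ → ℤ) (k : ℕ) (i : Fin n) : ℤ :=
  (0 + ∑ j, (faddeev (negMatrix n g k) n).1 i j * rhs n g k j) * regionDet n g k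

/-- Scaled assets under the candidate. -/
def candidateAssets (n : ℕ) (g : ℕ → ℤ) (k : ℕ) (i : Fin n) : ℤ :=
  coeffE g i * (regionDet n g k * regionDet n g k) + ∑ j, coeffC g i j * candidate n g k j

/-- The conditions on the candidate at a bank. -/
def AcceptedAt (n : ℕ) (g : ℕ → ℤ) (k : ℕ) (i : Fin n) : Prop :=
  0 ≤ candidate n g k i ∧ 0 ≤ regionDet n g k * regionDet n g k - candidate n g k i ∧
    0 ≤ candidateAssets n g k i - coeffL g i * candidate n g k i

/-- The system of the region with number `k` is regular and its solution is accepted. -/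
def Accepted (n : ℕ) (g : ℕ → ℤ) (k : ℕ) : Prop :=
  regionDet n g k ≠ 0 ∧ ∀ i, AcceptedAt n g k i

end Clearing

namespace RAM

open Clearing Matrix

/-! ### The program: testing a candidate, and the main loop -/

/-- Computation of the candidate, test and output. -/
def test : Program :=
  .seq (tabulate 19 .num .num (.const 0)
    (.add (.reg 4) (.mul (.entry 18 (.reg 2) (.reg 3)) (.get 14 (.reg 3))))
    (.mul (.reg 4) (.reg 16))) <|
  .seq (tabulate 20 .num .num (.mul (.get 9 (.reg 2)) (.mul (.reg 16) (.reg 16)))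
    (.add (.reg 4) (.mul (.entry 8 (.reg 2) (.reg 3)) (.get 19 (.reg 3)))) (.reg 4)) <|
  .seq (tabulateVal 1 (.add .num .num) (.add
    (.mul (.get 19 (.div (.reg 2) (.const 2)))
      (.sub (.const 1) (.sub (.reg 2) (.mul (.const 2) (.div (.reg 2) (.const 2))))))
    (.mul (.sub (.reg 2) (.mul (.const 2) (.div (.reg 2) (.const 2))))
      (.mul (.reg 16) (.reg 16))))) <|
  .seq (tabulate 11 (.const 1) .num (.sub (.const 1) (Expr.reg 16).isZero)
    (.mul (.reg 4) (.mul (Expr.get 19 (.reg 3)).isNonneg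
      (.mul (Expr.sub (.mul (.reg 16) (.reg 16)) (.get 19 (.reg 3))).isNonneg
        (Expr.sub (.get 20 (.reg 3)) (.mul (.get 7 (.reg 3)) (.get 19 (.reg 3)))).isNonneg)))
    (.reg 4))
  (.put 10 (.const 0) (.add (.reg 10) (.const 1)))

/-- Treatment of one region. -/
def round : Program :=
  .seq setup (.seq (.loop (.sub .num (.reg 17)) iteration) test)

/-- The algorithm. -/
def solver : Program := .seq prelude (.loop (.sub (.const 1) (.reg 11)) round)

variable {n L : ℕ} {g : ℕ → ℤ} {m : Memory}

lemma bd_negMatrix (hL : n + 1 ≤ L) (hg : ∀ t, Bd L 2 (g t)) (k : ℕ) (i j : Fin n) :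
    Bd L 5 (negMatrix n g k i j) :=
  bd_regionMatrix (by omega) (bd_coeffL hL hg) (bd_coeffC hL hg) (bd_region _ k) i j

lemma iterations_halt (hL : inputSize n + 1 ≤ L) (hm : m.Bounded (cap L)) (h : Coeffs n g m)
    {A : Matrix (Fin n) (Fin n) ℤ} {b : Fin n → ℤ} (hA : ∀ i j, Bd L 5 (A i j))
    (hI : Iterate A b 0 m) :
    HaltsIn (.loop (.sub .num (.reg 17)) iteration) ((n + 1) * tabUnit L) m
      (fun m' => m'.Bounded (cap L) ∧ m' 10 = m 10 ∧ m' 11 = m 11 ∧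
        Coeffs n g m' ∧ Iterate A b n m') := by
  refine HaltsIn.loop (fun k m' => m'.Bounded (cap L) ∧ m' 10 = m 10 ∧ m' 11 = m 11 ∧
    Coeffs n g m' ∧ Iterate A b k m') (fun _ _ h => h.1) (cap_le_tabUnit L) ?_ ?_
    ⟨hm, rfl, rfl, h, hI⟩
  · rintro k hk m' ⟨h1, h2, h3, h4, h5⟩
    refine ⟨by simp [h4.num, h5.round, hk], ?_⟩
    refine (iteration_halts hL h1 h4 hA hk h5).mono le_rfl ?_
    rintro m'' ⟨e1, e2, e3, e4, e5⟩
    exact ⟨e1, e2.trans h2, e3.trans h3, e4, e5⟩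
  · rintro m' ⟨h1, h2, h3, h4, h5⟩
    simp [h4.num, h5.round]

open Classical in
lemma test_halts (hn : 0 < n) (hL : inputSize n + 1 ≤ L) (hm : m.Bounded (cap L))
    (hg : ∀ t, Bd L 2 (g t)) (h : Coeffs n g m) {k : ℕ} (hk : m 10 0 = k) (hkn : k < 2 ^ n)
    (hI : Iterate (negMatrix n g k) (rhs n g k) n m) :
    HaltsIn test (tabUnit L) m (fun m' => m'.Bounded (cap L) ∧ m' 10 0 = (k + 1 : ℕ) ∧
      m' 11 0 = (if Accepted n g k then 1 else 0) ∧ Coeffs n g m' ∧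
      (∀ i : Fin n, m' 1 (2 * (i : ℕ)) = candidate n g k i) ∧
      ∀ i : Fin n, m' 1 (2 * (i : ℕ) + 1) = regionDet n g k * regionDet n g k) := by
  have hsize : inputSize n = n + n * n + n * n * n := rfl
  -- This gives `n + n ≤ L`, as needed for the output table with its `2 * n` entries.
  have hnn : n ≤ n * n := Nat.le_mul_of_pos_left n hn
  have hnL : n + 1 ≤ L := by omega
  have hbl := bd_coeffL hnL hg
  have hbC := bd_coeffC hnL hg
  have hbE := bd_coeffE hnL hg
  have hbA := bd_negMatrix hnL hg k
  obtain ⟨hbM, -, hbc⟩ := bd_faddeev hnL hbA n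
  have hbb : ∀ i, Bd L 6 (rhs n g k i) :=
    bd_regionVector (by omega) hbE (bd_region _ k)
  have hbt : ∀ i j, Bd L (8 * n + 6) ((faddeev (negMatrix n g k) n).1 i j * rhs n g k j) :=
    fun i j => (hbM i j).mul (hbb j)
  have hbX : ∀ i, Bd L (16 * n + 7) (candidate n g k i) := fun i =>
    ((Bd.add_sum hnL (by simp) .zero fun j _ => hbt i j).mul hbc).mono (by omega)
  have hbD : Bd L (16 * n) (regionDet n g k * regionDet n g k) :=
    (hbc.mul hbc).mono (by omega)
  have hbz : ∀ i, Bd L (16 * n + 10) (coeffE g i * (regionDet n g k * regionDet n g k)) :=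
    fun i => ((hbE i).mul hbD).mono (by omega)
  have hbs : ∀ i j, Bd L (16 * n + 10) (coeffC g i j * candidate n g k j) :=
    fun i j => ((hbC i j).mul (hbX j)).mono (by omega)
  have hbY : ∀ i, Bd L (16 * n + 11) (candidateAssets n g k i) := fun i =>
    Bd.add_sum hnL (by simp) (hbz i) fun j _ => hbs i j
  refine HaltsIn.seq (HaltsIn.tabulateSum (n := n) (b := 8 * n + 6) (fun x : Fin n => (x : ℕ))
    (fun x => x.2) Fin.val_injective fin_surj (fun _ => 0)
    (fun i j => (faddeev (negMatrix n g k) n).1 i j * rhs n g k j) (candidate n g k)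
    (by simp) hnL hm (by omega) (fun _ => .zero) hbt (by omega)
    (fun i => (hbX i).mono (by omega)) ?_ ?_ (by simp) ?_ ?_) ?_
  · intro m' h'
    simp [h' 0, h.num]
  · intro m' h'
    simp [h' 0, h.num]
  · intro i j s m' h' e2 e3 e4
    have e5 := hI.adjugate hn (i, j)
    simp only [pairIndex] at e5
    push_cast at e5
    simp [h' 0, h.num, e2, e3, e4, h' 18, e5, h' 14, hI.vector]
  · intro i m' h' e2 e4
    simp [e4, h' 16, hI.coeff, candidate, regionDet]
  rintro m1 ⟨hm1, h1, hv1⟩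
  have hn1 : m1 0 0 = n := by simp [h1 0, h.num]
  have hc1 : m1 16 0 = regionDet n g k := by simp [h1 16, hI.coeff, regionDet]
  refine HaltsIn.seq (HaltsIn.tabulateSum (n := n) (b := 16 * n + 10) (fun x : Fin n => (x : ℕ))
    (fun x => x.2) Fin.val_injective fin_surj
    (fun i => coeffE g i * (regionDet n g k * regionDet n g k))
    (fun i j => coeffC g i j * candidate n g k j) (candidateAssets n g k)
    (by simp) hnL hm1 (by omega) hbz hbs (by omega)
    (fun i => (hbY i).mono (by omega)) ?_ ?_ ?_ ?_ ?_) ?_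
  · intro m' h'
    simp [h' 0, hn1]
  · intro m' h'
    simp [h' 0, hn1]
  · intro i m' h' e2
    simp [e2, h' 9, h1 9, h.const, h' 16, hc1]
  · intro i j s m' h' e2 e3 e4
    have e5 := h.matrix (i, j)
    simp only [pairIndex] at e5
    push_cast at e5
    simp [h' 0, hn1, e2, e3, e4, h' 8, h1 8, e5, h' 19, hv1]
  · intro i m' h' e2 e4
    exact e4
  rintro m2 ⟨hm2, h2, hv2⟩
  have hn2 : m2 0 0 = n := by simp [h2 0, hn1]
  have hc2 : m2 16 0 = regionDet n g k := by simp [h2 16, hc1]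
  have hdiv : ∀ x : Fin (n + n), (x : ℕ) / 2 < n := fun x => by omega
  refine HaltsIn.seq (HaltsIn.tabulateVal (fun x : Fin (n + n) => (x : ℕ)) (fun x => x.2)
    Fin.val_injective fin_surj
    (fun x => if (x : ℕ) % 2 = 0 then candidate n g k ⟨x / 2, hdiv x⟩ else
      regionDet n g k * regionDet n g k) (by simp) (by omega) hm2 (by omega) ?_ ?_ ?_) ?_
  · intro x
    split
    · exact (hbX _).mono (by omega)
    · exact hbD.mono (by omega)
  · intro m' h'
    simp [h' 0, hn2]
  · intro x m' h' e2
    have e3 := hv1 ⟨x / 2, hdiv x⟩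
    simp only [Int.natCast_ediv, Nat.cast_ofNat] at e3
    simp only [Expr.eval_add, Expr.eval_mul, Expr.eval_sub, Expr.eval_div, Expr.eval_get,
      Expr.eval_reg, Expr.eval_const, e2, h' 19 (by simp) (by simp) (by simp) (by simp),
      h2 19 (by simp) (by simp) (by simp) (by simp), e3,
      h' 16 (by simp) (by simp) (by simp) (by simp), hc2]
    split
    · next hx =>
      have : ((x : ℕ) : ℤ) - 2 * (((x : ℕ) : ℤ) / 2) = 0 := by omega
      rw [this]
      ring
    · next hx =>
      have : ((x : ℕ) : ℤ) - 2 * (((x : ℕ) : ℤ) / 2) = 1 := by omega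
      rw [this]
      ring
  rintro m3 ⟨hm3, h3, hv3⟩
  have hn3 : m3 0 0 = n := by simp [h3 0, hn2]
  have hc3 : m3 16 0 = regionDet n g k := by simp [h3 16, hc2]
  -- The flag is a running product of indicators; it starts from the indicator of a nonzero
  -- determinant.
  refine HaltsIn.seq (HaltsIn.tabulate (fun _ : Unit => 0) (num := 1)
    (by simp) (fun _ _ _ => rfl) (fun p hp => ⟨(), by omega⟩)
    (fun _ j => if regionDet n g k ≠ 0 ∧ ∀ i : Fin n, (i : ℕ) < j → AcceptedAt n g k i then 1 else 0)
    (fun _ => n) (fun _ => if Accepted n g k then 1 else 0) (by simp) (by omega) hm3 (by omega)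
    (fun _ => by omega) (fun _ _ _ => bd_ite _ _) (fun _ => bd_ite _ _) (by simp) ?_ ?_ ?_ ?_) ?_
  · intro _ m' h' _
    simp [h' 0, hn3]
  · intro _ m' h' _
    by_cases hd : regionDet n g k = 0 <;> simp [Expr.eval_isZero, h' 16, hc3, hd]
  · intro _ j hj m' h' _ e3 e4
    have e5 := hv1 ⟨j, hj⟩
    have e6 := hv2 ⟨j, hj⟩
    have e7 := h.liability ⟨j, hj⟩
    simp only at e5 e6 e7
    simp only [Expr.eval_mul, Expr.eval_reg, Expr.eval_isNonneg, Expr.eval_get, Expr.eval_sub, e3,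
      e4, h' 19 (by simp) (by simp) (by simp) (by simp),
      h3 19 (by simp) (by simp) (by simp) (by simp), h2 19 (by simp) (by simp) (by simp) (by simp),
      e5, h' 20 (by simp) (by simp) (by simp) (by simp),
      h3 20 (by simp) (by simp) (by simp) (by simp), e6,
      h' 16 (by simp) (by simp) (by simp) (by simp), hc3,
      h' 7 (by simp) (by simp) (by simp) (by simp), h3 7 (by simp) (by simp) (by simp) (by simp),
      h2 7 (by simp) (by simp) (by simp) (by simp), h1 7 (by simp) (by simp) (by simp) (by simp), e7]
    simp only [← ite_and, mul_ite, mul_one, mul_zero]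
    have hiff : (regionDet n g k ≠ 0 ∧ ∀ i : Fin n, (i : ℕ) < j + 1 → AcceptedAt n g k i) ↔
        (regionDet n g k ≠ 0 ∧ ∀ i : Fin n, (i : ℕ) < j → AcceptedAt n g k i) ∧
          AcceptedAt n g k ⟨j, hj⟩ := by
      constructor
      · rintro ⟨a, b⟩
        exact ⟨⟨a, fun i hi => b i (by omega)⟩, b _ (Nat.lt_succ_self j)⟩
      · rintro ⟨⟨a, b⟩, c⟩
        refine ⟨a, fun i hi => ?_⟩
        rcases Nat.lt_succ_iff_lt_or_eq.1 hi with hi | hi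
        · exact b i hi
        · obtain rfl : i = ⟨j, hj⟩ := Fin.ext hi
          exact c
    refine if_congr ?_ rfl rfl
    rw [hiff]
    exact ⟨fun ⟨⟨⟨a, b⟩, c⟩, d⟩ => ⟨d, c, b, a⟩, fun ⟨d, c, b, a⟩ => ⟨⟨⟨a, b⟩, c⟩, d⟩⟩
  · intro _ m' h' _ e4
    rw [Expr.eval_reg, e4]
    exact if_congr (by simp [Accepted]) rfl rfl
  rintro m4 ⟨hm4, h4, hv4⟩
  have hv4' := hv4 ()
  rw [Nat.cast_zero] at hv4'
  have hk4 : m4 10 0 = k := by simp [h4 10, h3 10, h2 10, h1 10, hk]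
  have hbk : bitLength ((k + 1 : ℕ) : ℤ) ≤ cap L := by
    refine (Bd.of_le (L := L) ?_).bitLength_le (by omega)
    have := Nat.pow_le_pow_right (n := 2) (by norm_num) (show n ≤ L by omega)
    omega
  refine HaltsIn.put hm4 (cap_le_tabUnit L) _ _ _ ?_
  have hval : (Expr.add (.reg 10) (.const 1)).eval m4 = (k + 1 : ℕ) := by simp [hk4]
  rw [hval]
  refine ⟨hm4.write _ _ hbk, ?_, ?_, ?_, ?_, ?_⟩
  · simp [Memory.write]
  · simp [Memory.write, hv4']
  · refine h.congr ?_ ?_ ?_ ?_ <;> funext j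
    · simp [Memory.write, h4 0, h3 0, h2 0, h1 0]
    · simp [Memory.write, h4 7, h3 7, h2 7, h1 7]
    · simp [Memory.write, h4 8, h3 8, h2 8, h1 8]
    · simp [Memory.write, h4 9, h3 9, h2 9, h1 9]
  · intro i
    have := hv3 ⟨2 * i, by omega⟩
    simp at this
    simp [Memory.write, h4 1, this]
  · intro i
    have := hv3 ⟨2 * i + 1, by omega⟩
    rw [if_neg (by simp only; omega)] at this
    push_cast at this
    simp [Memory.write, h4 1, this]

open Classical in
lemma round_halts (hn : 0 < n) (hL : inputSize n + 1 ≤ L) (hm : m.Bounded (cap L))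
    (hg : ∀ t, Bd L 2 (g t)) (h : Coeffs n g m) {k : ℕ} (hk : m 10 0 = k) (hkn : k < 2 ^ n) :
    HaltsIn round ((n + 1) * tabUnit L) m (fun m' => m'.Bounded (cap L) ∧ m' 10 0 = (k + 1 : ℕ) ∧
      m' 11 0 = (if Accepted n g k then 1 else 0) ∧ Coeffs n g m' ∧
      (∀ i : Fin n, m' 1 (2 * (i : ℕ)) = candidate n g k i) ∧
      ∀ i : Fin n, m' 1 (2 * (i : ℕ) + 1) = regionDet n g k * regionDet n g k) := by
  have hU : tabUnit L ≤ (n + 1) * tabUnit L := Nat.le_mul_of_pos_left _ (Nat.succ_pos n)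
  have hnL : n + 1 ≤ L := by
    have : inputSize n = n + n * n + n * n * n := rfl
    omega
  refine HaltsIn.seq ((setup_halts hL hm hg h hk).mono hU fun _ h => h) ?_
  rintro m1 ⟨hm1, h10, h11, hc1, hI1⟩
  refine HaltsIn.seq (iterations_halt hL hm1 hc1 (bd_negMatrix hnL hg k) hI1) ?_
  rintro m2 ⟨hm2, h10', h11', hc2, hI2⟩
  refine (test_halts hn hL hm2 hg hc2 (by rw [h10', h10, hk]) hkn hI2).mono hU fun _ h => h

/-- The main loop runs up to the least accepted region `k₀ < 2 ^ n`. By minimality the flag stays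
`0` before, and the output of that last round is not overwritten. -/
lemma solver_halts {num den : ℕ → ℤ} (hn : 0 < n) (hL : inputSize n + 1 ≤ L)
    (hm : m.Bounded (cap L)) (hn0 : m 0 0 = n) (h10 : m 10 0 = 0) (h11 : m 11 0 = 0)
    (hnum : ∀ t < inputSize n, m 0 (1 + 2 * t) = num t)
    (hden : ∀ t < inputSize n, m 0 (2 + 2 * t) = den t)
    (hbnum : ∀ t, Bd L 1 (num t)) (hbden : ∀ j, Bd L 1 (∏ k ∈ Finset.range j, den k))
    (hex : ∃ k < 2 ^ n, Accepted n (scaled n num den) k) :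
    HaltsIn solver ((2 ^ n + 1) * ((n + 1) * tabUnit L)) m (fun m' =>
      ∃ k, Accepted n (scaled n num den) k ∧
        (∀ i : Fin n, m' 1 (2 * (i : ℕ)) = candidate n (scaled n num den) k i) ∧
        ∀ i : Fin n, m' 1 (2 * (i : ℕ) + 1) =
          regionDet n (scaled n num den) k * regionDet n (scaled n num den) k) := by
  classical
  have hbg : ∀ t, Bd L 2 (scaled n num den t) := fun t => (hbnum t).mul (hbden _).div
  set g := scaled n num den with hg
  have hU : tabUnit L ≤ (n + 1) * tabUnit L := Nat.le_mul_of_pos_left _ (Nat.succ_pos n)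
  have hU' : (n + 1) * tabUnit L ≤ (2 ^ n + 1) * ((n + 1) * tabUnit L) :=
    Nat.le_mul_of_pos_left _ (Nat.succ_pos _)
  obtain ⟨k₀, ⟨hk₀, hacc⟩, hmin⟩ : ∃ k₀, (k₀ < 2 ^ n ∧ Accepted n g k₀) ∧
      ∀ k < k₀, ¬ Accepted n g k :=
    ⟨Nat.find hex, Nat.find_spec hex, fun k hk h =>
      Nat.find_min hex hk ⟨hk.trans (Nat.find_spec hex).1, h⟩⟩
  refine HaltsIn.seq ((prelude_halts hL hm hn0 hnum hden hbnum hbden).mono (hU.trans hU')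
    fun _ h => h) ?_
  rintro m1 ⟨hm1, e10, e11, hc1⟩
  refine (HaltsIn.loop (n := k₀ + 1) (U := (n + 1) * tabUnit L) (fun j m' => m'.Bounded (cap L) ∧
    m' 10 0 = j ∧ m' 11 0 = (if j = k₀ + 1 then 1 else 0) ∧ Coeffs n g m' ∧ (j = k₀ + 1 →
      (∀ i : Fin n, m' 1 (2 * (i : ℕ)) = candidate n g k₀ i) ∧
      ∀ i : Fin n, m' 1 (2 * (i : ℕ) + 1) = regionDet n g k₀ * regionDet n g k₀))
    (fun _ _ h => h.1) ((cap_le_tabUnit L).trans hU) ?_ ?_ ?_).mono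
      (Nat.mul_le_mul_right _ (by omega)) ?_
  · rintro k hk m' ⟨f1, f2, f3, f4, -⟩
    refine ⟨by simp [f3, hk.ne], ?_⟩
    refine (round_halts hn hL f1 hbg f4 f2 (by omega)).mono le_rfl ?_
    rintro m'' ⟨g1, g2, g3, g4, g5, g6⟩
    refine ⟨g1, g2, ?_, g4, ?_⟩
    · rw [g3]
      refine if_congr ?_ rfl rfl
      constructor
      · intro h
        by_contra hne
        exact hmin k (by omega) h
      · intro h
        obtain rfl : k = k₀ := by omega
        exact hacc
    · intro h
      obtain rfl : k = k₀ := by omega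
      exact ⟨g5, g6⟩
  · rintro m' ⟨-, -, f3, -, -⟩
    simp [f3]
  · refine ⟨hm1, by simp [e10, h10], by simp [e11, h11], hc1, fun h => by omega⟩
  · rintro m' ⟨-, -, -, -, h⟩
    exact ⟨k₀, hacc, h rfl⟩

end RAM

/-! ### Encoding of networks -/

lemma List.getElem?_flatMap_of_length {α β : Type*} {f : α → List β} {c : ℕ}
    (hf : ∀ a, (f a).length = c) (l : List α) (i j : ℕ) (hj : j < c) :
    (l.flatMap f)[i * c + j]? = l[i]?.bind fun a => (f a)[j]? := by
  induction l generalizing i with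
  | nil => simp
  | cons a l ih =>
    rw [List.flatMap_cons]
    cases i with
    | zero =>
      rw [List.getElem?_append_left (by rw [hf]; omega)]
      simp
    | succ i =>
      rw [List.getElem?_append_right (by rw [hf, Nat.succ_mul]; omega), hf, Nat.succ_mul]
      rw [show i * c + c + j - c = i * c + j by omega, ih]
      simp

lemma List.length_flatMap_of_length {α β : Type*} {f : α → List β} {c : ℕ}
    (hf : ∀ a, (f a).length = c) (l : List α) : (l.flatMap f).length = l.length * c := by
  induction l with
  | nil => simp
  | cons a l ih => rw [List.flatMap_cons, List.length_append, hf, ih, List.length_cons]; ring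

namespace FinancialNetwork

open RAM Clearing

variable {n : ℕ}

/-- The rationals in the description of a network. -/
def rats (F : FinancialNetwork n) : List ℚ≥0 :=
  (List.finRange n).map F.assets ++
  ((List.finRange n).flatMap fun i => (List.finRange n).map fun j => F.debt i j) ++
  ((List.finRange n).flatMap fun i => (List.finRange n).flatMap fun j =>
    (List.finRange n).map fun k => F.cds i j k)

lemma encode_eq (F : FinancialNetwork n) : F.encode = (n : ℤ) :: F.rats.flatMap encodeRat := by
  simp [encode, rats, List.flatMap_append, List.flatMap_assoc, List.flatMap_map]

lemma length_rats (F : FinancialNetwork n) : F.rats.length = inputSize n := by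
  unfold rats
  rw [List.length_append, List.length_append,
    List.length_flatMap_of_length (c := n) (fun i => by simp),
    List.length_flatMap_of_length (c := n * n)
      (fun i => by rw [List.length_flatMap_of_length (c := n) (fun i => by simp)]; simp)]
  simp [inputSize, Nat.mul_assoc]

/-- The rationals in the description of a network, as a sequence. -/
def rat (F : FinancialNetwork n) (t : ℕ) : ℚ≥0 := F.rats.getD t 0

lemma rat_asset (F : FinancialNetwork n) (i : Fin n) : F.rat i = F.assets i := by
  unfold rat rats
  rw [List.getD_eq_getElem?_getD, List.append_assoc, List.getElem?_append_left (by simp)]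
  simp

lemma rat_debt (F : FinancialNetwork n) (i j : Fin n) :
    F.rat (n + (i * n + j)) = F.debt i j := by
  have h := pairIndex_lt (i, j)
  simp only [pairIndex] at h
  unfold rat rats
  rw [List.getD_eq_getElem?_getD, List.append_assoc, List.getElem?_append_right (by simp),
    List.length_map, List.length_finRange, Nat.add_sub_cancel_left, List.getElem?_append_left (by
      rw [List.length_flatMap_of_length (c := n) (fun i => by simp)]; simpa using h),
    List.getElem?_flatMap_of_length (fun i => by simp) _ _ _ j.2]
  simp

lemma rat_cds (F : FinancialNetwork n) (i j k : Fin n) :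
    F.rat (n + n * n + ((i * n + j) * n + k)) = F.cds i j k := by
  have h := pairIndex_lt (j, k)
  simp only [pairIndex] at h
  unfold rat rats
  have hlen : ((List.finRange n).map F.assets ++ ((List.finRange n).flatMap fun i =>
      (List.finRange n).map fun j => F.debt i j)).length = n + n * n := by
    rw [List.length_append, List.length_flatMap_of_length (c := n) (fun i => by simp)]
    simp
  rw [List.getD_eq_getElem?_getD, List.getElem?_append_right (by rw [hlen]; omega), hlen,
    Nat.add_sub_cancel_left,
    show ((i : ℕ) * n + j) * n + k = i * (n * n) + (j * n + k) by ring,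
    List.getElem?_flatMap_of_length (c := n * n)
      (fun i => by rw [List.length_flatMap_of_length (c := n) (fun i => by simp)]; simp) _ _ _ h]
  rw [List.getElem?_eq_getElem (by simp), Option.bind_some,
    List.getElem?_flatMap_of_length (fun i => by simp) _ _ _ k.2]
  simp

/-- Numerators of the input. -/
def ratNum (F : FinancialNetwork n) (t : ℕ) : ℤ := (F.rat t).num

/-- Denominators of the input. -/
def ratDen (F : FinancialNetwork n) (t : ℕ) : ℤ := (F.rat t).den

lemma initial_zero_zero (F : FinancialNetwork n) : initial F.encode 0 0 = n := by
  simp [initial, encode_eq]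

lemma initial_num (F : FinancialNetwork n) (t : ℕ) (ht : t < inputSize n) :
    initial F.encode 0 (1 + 2 * t) = F.ratNum t := by
  have h : (1 + 2 * (t : ℤ)).toNat = t * 2 + 1 := by omega
  have h0 : (0 : ℤ) ≤ 1 + 2 * (t : ℤ) := by omega
  rw [← length_rats F] at ht
  simp only [initial, h0, and_self, if_true, h, encode_eq, List.getD_cons_succ]
  rw [List.getD_eq_getElem?_getD, ← add_zero (t * 2),
    List.getElem?_flatMap_of_length (c := 2) (fun _ => rfl) _ _ _
    (by norm_num), List.getElem?_eq_getElem ht]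
  simp [ratNum, rat, encodeRat, ht]

lemma initial_den (F : FinancialNetwork n) (t : ℕ) (ht : t < inputSize n) :
    initial F.encode 0 (2 + 2 * t) = F.ratDen t := by
  have h : (2 + 2 * (t : ℤ)).toNat = (t * 2 + 1) + 1 := by omega
  have h0 : (0 : ℤ) ≤ 2 + 2 * (t : ℤ) := by omega
  rw [← length_rats F] at ht
  simp only [initial, h0, and_self, if_true, h, encode_eq, List.getD_cons_succ]
  rw [List.getD_eq_getElem?_getD, List.getElem?_flatMap_of_length (c := 2) (fun _ => rfl) _ _ _
    (by norm_num), List.getElem?_eq_getElem ht]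
  simp [ratDen, rat, encodeRat, ht]

lemma listBitLength_cons (z : ℤ) (l : List ℤ) :
    listBitLength (z :: l) = bitLength z + listBitLength l := rfl

lemma length_le_listBitLength (l : List ℤ) : l.length ≤ listBitLength l := by
  induction l with
  | nil => simp
  | cons z l ih =>
    have := bitLength_pos z
    rw [listBitLength_cons, List.length_cons]
    omega

lemma bitLength_getD_le (l : List ℤ) (i : ℕ) (hl : 1 ≤ listBitLength l) :
    bitLength (l.getD i 0) ≤ listBitLength l := by
  by_cases hi : i < l.length
  · rw [List.getD_eq_getElem _ _ hi]
    exact List.single_le_sum (fun _ _ => Nat.zero_le _) _ (List.mem_map_of_mem (List.getElem_mem hi))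
  · rw [List.getD_eq_default _ _ (not_lt.1 hi)]
    exact hl

lemma inputSize_lt_listBitLength (F : FinancialNetwork n) :
    inputSize n + 1 ≤ listBitLength F.encode := by
  refine le_trans ?_ (length_le_listBitLength _)
  rw [encode_eq, List.length_cons, List.length_flatMap_of_length (c := 2) (fun _ => rfl),
    length_rats]
  omega

lemma natAbs_lt_two_pow_bitLength (z : ℤ) : z.natAbs ≤ 2 ^ bitLength z :=
  (natAbs_lt_two_pow_bitLength_sub_one z).le.trans
    (Nat.pow_le_pow_right (by norm_num) (Nat.sub_le _ _))

lemma natAbs_getD_num_le (l : List ℚ≥0) (t : ℕ) :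
    ((l.getD t 0).num : ℤ).natAbs ≤ 2 ^ listBitLength (l.flatMap encodeRat) := by
  induction l generalizing t with
  | nil => simp
  | cons q l ih =>
    rw [List.flatMap_cons, encodeRat, List.cons_append, List.cons_append, List.nil_append,
      listBitLength_cons, listBitLength_cons]
    cases t with
    | zero =>
      exact (natAbs_lt_two_pow_bitLength _).trans (Nat.pow_le_pow_right (by norm_num) (by simp))
    | succ t =>
      exact (ih t).trans (Nat.pow_le_pow_right (by norm_num) (by omega))

/-- Bit lengths of the denominators add up along the input, so the common denominator is no longer
than the input. Beyond the end of the list the default `0` has denominator `1`. -/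
lemma natAbs_prod_den_le (l : List ℚ≥0) (j : ℕ) :
    (∏ k ∈ Finset.range j, ((l.getD k 0).den : ℤ)).natAbs ≤
      2 ^ listBitLength (l.flatMap encodeRat) := by
  induction l generalizing j with
  | nil => simpa using Nat.one_le_two_pow
  | cons q l ih =>
    rw [List.flatMap_cons, encodeRat, List.cons_append, List.cons_append, List.nil_append,
      listBitLength_cons, listBitLength_cons]
    cases j with
    | zero => simpa using Nat.one_le_two_pow
    | succ j =>
      rw [Finset.prod_range_succ', Int.natAbs_mul]
      have h1 := ih j
      have h2 := natAbs_lt_two_pow_bitLength (q.den : ℤ)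
      refine (Nat.mul_le_mul h1 h2).trans ?_
      rw [← pow_add]
      exact Nat.pow_le_pow_right (by norm_num) (by omega)

lemma bd_ratNum (F : FinancialNetwork n) (t : ℕ) :
    Bd (listBitLength F.encode) 1 (F.ratNum t) := by
  refine (natAbs_getD_num_le F.rats t).trans (Nat.pow_le_pow_right (by norm_num) ?_)
  rw [encode_eq, listBitLength_cons]
  omega

lemma bd_prod_ratDen (F : FinancialNetwork n) (j : ℕ) :
    Bd (listBitLength F.encode) 1 (∏ k ∈ Finset.range j, F.ratDen k) := by
  refine (natAbs_prod_den_le F.rats j).trans (Nat.pow_le_pow_right (by norm_num) ?_)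
  rw [encode_eq, listBitLength_cons]
  omega

lemma initial_bounded (F : FinancialNetwork n) :
    (initial F.encode).Bounded (cap (listBitLength F.encode)) := by
  have hL := inputSize_lt_listBitLength F
  have hcap : listBitLength F.encode ≤ cap (listBitLength F.encode) := by
    unfold cap
    nlinarith
  intro a i
  unfold initial
  split
  · exact (bitLength_getD_le _ _ (by omega)).trans hcap
  · exact (show bitLength 0 ≤ listBitLength F.encode from (by omega : 1 ≤ _)).trans hcap

/-- The common denominator of the input. -/
def commonDen (F : FinancialNetwork n) : ℤ := ∏ k ∈ Finset.range (inputSize n), F.ratDen k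

lemma commonDen_pos (F : FinancialNetwork n) : 0 < F.commonDen :=
  Finset.prod_pos fun _ _ => Nat.cast_pos.2 (NNRat.den_pos _)

/-- The scaled input. -/
def scaledRat (F : FinancialNetwork n) : ℕ → ℤ := scaled n F.ratNum F.ratDen

lemma cast_scaledRat (F : FinancialNetwork n) {t : ℕ} (ht : t < inputSize n) :
    (F.scaledRat t : ℝ) = F.commonDen * (F.rat t : ℝ) := by
  have hdvd : F.ratDen t ∣ F.commonDen := Finset.dvd_prod_of_mem _ (Finset.mem_range.2 ht)
  obtain ⟨c, hc⟩ := hdvd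
  have hd : F.ratDen t ≠ 0 := Nat.cast_ne_zero.2 (NNRat.den_ne_zero _)
  have h1 : F.scaledRat t = F.ratNum t * c := by
    change F.ratNum t * (F.commonDen / F.ratDen t) = _
    rw [hc, Int.mul_ediv_cancel_left _ hd]
  have h2 : (F.rat t : ℝ) = (F.ratNum t : ℝ) / (F.ratDen t : ℝ) := by
    rw [NNRat.cast_def]
    simp [ratNum, ratDen]
  have hd' : (F.ratDen t : ℝ) ≠ 0 := Int.cast_ne_zero.2 hd
  rw [h1, hc, h2]
  push_cast
  field_simp

end FinancialNetwork

/-! ### Candidates and clearing vectors -/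

namespace Clearing

open RAM Matrix

variable {n : ℕ} {g : ℕ → ℤ} {k : ℕ}

/-- The matrix of the region with number `k`. -/
def posMatrix (n : ℕ) (g : ℕ → ℤ) (k : ℕ) : Matrix (Fin n) (Fin n) ℤ :=
  regionMatrix (coeffL g) (coeffC g) (region (coeffL g) k)

lemma regionDet_eq : regionDet n g k = (posMatrix n g k).det := by
  have h := faddeev_det (negMatrix n g k)
  rw [Fintype.card_fin] at h
  rw [regionDet, h, negMatrix, neg_neg, posMatrix]

/-- The adjugate gives a solution with denominator `det`; multiplying once more by `det` makes the
denominator `det ^ 2`, so its sign plays no role in the tests and in the output. -/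
lemma posMatrix_mulVec_candidate :
    (posMatrix n g k).mulVec (candidate n g k) =
      (regionDet n g k * regionDet n g k) • rhs n g k := by
  have h : posMatrix n g k * (faddeev (negMatrix n g k) n).1 = regionDet n g k • 1 := by
    have h := neg_mul_faddeev (negMatrix n g k)
    rwa [Fintype.card_fin, show -negMatrix n g k = posMatrix n g k from neg_neg _] at h
  have hX : candidate n g k =
      regionDet n g k • (faddeev (negMatrix n g k) n).1.mulVec (rhs n g k) := by
    funext i
    simp [candidate, mulVec, dotProduct, mul_comm]
  rw [hX, mulVec_smul, mulVec_mulVec, h, smul_mulVec, one_mulVec, smul_smul]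

/-- Row `i` of the system is either the untruncated equation or the equation `r i = 1`, and a bank
without liabilities always has the latter. -/
lemma candidate_spec (i : Fin n) :
    (coeffL g i = 0 → candidate n g k i = regionDet n g k * regionDet n g k) ∧
      (candidate n g k i = regionDet n g k * regionDet n g k ∨
        coeffL g i * candidate n g k i = candidateAssets n g k i) := by
  have h := congrFun (posMatrix_mulVec_candidate (n := n) (g := g) (k := k)) i
  rw [posMatrix, regionMatrix_mulVec, Pi.smul_apply, rhs, regionVector, smul_eq_mul] at h
  unfold candidateAssets
  by_cases hr : k.testBit i ∧ coeffL g i ≠ 0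
  · have hr' : region (coeffL g) k i = 1 := if_pos hr
    rw [hr'] at h
    exact ⟨fun h0 => absurd h0 hr.2, Or.inr (by linarith)⟩
  · have hr' : region (coeffL g) k i = 0 := if_neg hr
    rw [hr'] at h
    have : candidate n g k i = regionDet n g k * regionDet n g k := by linarith
    exact ⟨fun _ => this, Or.inl this⟩

/-- Some region is accepted if the equations have nonnegative coefficients on the cube. -/
lemma exists_accepted (hl : ∀ i : Fin n, 0 ≤ coeffL g i)
    (hpos : ∀ r ∈ Set.Icc (0 : Fin n → ℝ) 1, ∀ i : Fin n,
      0 ≤ (coeffE g i : ℝ) + ∑ j, (coeffC g i j : ℝ) * r j) :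
    ∃ k < 2 ^ n, Accepted n g k := by
  classical
  obtain ⟨S, hS, hdet, r, hr, hsys⟩ := exists_nonsingular_region
    (l := fun i => (coeffL g i : ℝ)) (E := fun i => (coeffE g i : ℝ))
    (C := fun i j => (coeffC g i j : ℝ)) (fun i => Int.cast_nonneg (hl i)) hpos
  set k := Nat.ofBits fun i : Fin n => decide (i ∈ S) with hk
  refine ⟨k, Nat.ofBits_lt_two_pow _, ?_⟩
  -- All banks in `S` have liabilities, so the restriction built into `region` drops none of them.
  have hreg : ∀ i : Fin n, ((region (coeffL g) k i : ℤ) : ℝ) = ind S i := by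
    intro i
    unfold region ind
    rw [hk, Nat.testBit_ofBits_lt _ _ i.2]
    by_cases hi : i ∈ S
    · have h0 : coeffL g i ≠ 0 := fun h0 => by
        have := hS i hi
        simp [h0] at this
      simp [hi, h0]
    · simp [hi]
  have hmat : (posMatrix n g k).map (Int.castRingHom ℝ) = regionMatrix
      (fun i => (coeffL g i : ℝ)) (fun i j => (coeffC g i j : ℝ)) (ind S) := by
    ext i j
    simp only [posMatrix, regionMatrix, map_apply, Int.coe_castRingHom]
    push_cast
    rw [hreg]
  have hdet' : (regionDet n g k : ℝ) ≠ 0 := by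
    rw [← hmat, ← RingHom.mapMatrix_apply, ← RingHom.map_det, ← regionDet_eq] at hdet
    exact hdet
  set D : ℝ := (regionDet n g k : ℝ) * regionDet n g k with hD
  have hDpos : 0 < D := mul_self_pos.2 hdet'
  -- Both sides solve the same regular linear system.
  have hX : ∀ i, (candidate n g k i : ℝ) = D * r i := by
    have h1 : (regionMatrix (fun i => (coeffL g i : ℝ)) (fun i j => (coeffC g i j : ℝ))
        (ind S)).mulVec ((fun i => (candidate n g k i : ℝ)) - D • r) = 0 := by
      rw [mulVec_sub, mulVec_smul, hsys, sub_eq_zero, ← hmat]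
      funext i
      have h2 := congrArg (Int.castRingHom ℝ) (congrFun
        (posMatrix_mulVec_candidate (n := n) (g := g) (k := k)) i)
      rw [RingHom.map_mulVec] at h2
      refine Eq.trans h2 ?_
      simp [hD, rhs, regionVector, hreg]
    have h3 := eq_zero_of_mulVec_eq_zero hdet h1
    intro i
    have := congrFun h3 i
    simp only [Pi.sub_apply, Pi.smul_apply, smul_eq_mul, Pi.zero_apply] at this
    linarith
  refine ⟨fun h => hdet' (by rw [h, Int.cast_zero]), fun i => ?_⟩
  obtain ⟨h1, h2, h3⟩ := hr i
  refine ⟨?_, ?_, ?_⟩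
  · rw [← Int.cast_nonneg_iff (R := ℝ), hX]
    positivity
  · rw [← Int.cast_nonneg_iff (R := ℝ)]
    push_cast
    rw [hX, ← hD]
    nlinarith
  · rw [← Int.cast_nonneg_iff (R := ℝ)]
    simp only [candidateAssets]
    push_cast
    rw [← hD, hX]
    have : ∑ j, (coeffC g i j : ℝ) * (candidate n g k j : ℝ) =
        D * ∑ j, (coeffC g i j : ℝ) * r j := by
      rw [Finset.mul_sum]
      exact Finset.sum_congr rfl fun j _ => by rw [hX]; ring
    rw [this]
    nlinarith

end Clearing

/-! ### From the scaled equations back to the network -/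

namespace FinancialNetwork

open RAM Clearing

variable {n : ℕ}

/-- Liabilities from debt contracts. -/
noncomputable def debtSum (F : FinancialNetwork n) (i : Fin n) : ℝ := ∑ j, (F.debt i j : ℝ)

/-- Assets when the debtors of the credit default swaps pay in full. -/
noncomputable def fullAssets (F : FinancialNetwork n) (r : Fin n → ℝ) (i : Fin n) : ℝ :=
  (F.assets i : ℝ) + (∑ k, r k * (F.debt k i : ℝ) + ∑ k, ∑ j, (1 - r k) * (F.cds j i k : ℝ))

lemma cast_coeffL (F : FinancialNetwork n) (i : Fin n) :
    (coeffL F.scaledRat i : ℝ) = F.commonDen * F.debtSum i := by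
  simp only [coeffL, debtSum, Int.cast_sum, zero_add]
  rw [Finset.mul_sum]
  exact Finset.sum_congr rfl fun j _ => by rw [cast_scaledRat F (debt_index_lt i j), rat_debt]

lemma cast_coeffC (F : FinancialNetwork n) (i k : Fin n) :
    (coeffC F.scaledRat i k : ℝ) = F.commonDen * (F.debt k i - ∑ j, (F.cds j i k : ℝ)) := by
  simp only [coeffC, Int.cast_add, Int.cast_sum, Int.cast_neg]
  rw [cast_scaledRat F (debt_index_lt k i), rat_debt, mul_sub, Finset.mul_sum, sub_eq_add_neg,
    ← Finset.sum_neg_distrib]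
  congr 1
  exact Finset.sum_congr rfl fun j _ => by rw [cast_scaledRat F (cds_index_lt j i k), rat_cds]

/-- Subtracting `coeffC` from the debt notional leaves the CDS notionals that `i` can claim on the
reference bank, which is the constant part of `(1 - r k) * cds`. -/
lemma cast_coeffE (F : FinancialNetwork n) (i : Fin n) :
    (coeffE F.scaledRat i : ℝ) =
      F.commonDen * (F.assets i + ∑ k, ∑ j, (F.cds j i k : ℝ)) := by
  simp only [coeffE, Int.cast_add, Int.cast_sum, Int.cast_sub]
  rw [cast_scaledRat F (asset_index_lt i), rat_asset, mul_add, Finset.mul_sum]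
  congr 1
  refine Finset.sum_congr rfl fun k _ => ?_
  rw [cast_scaledRat F (debt_index_lt k i), rat_debt, cast_coeffC]
  ring

lemma cast_assets (F : FinancialNetwork n) (r : Fin n → ℝ) (i : Fin n) :
    (coeffE F.scaledRat i : ℝ) + ∑ j, (coeffC F.scaledRat i j : ℝ) * r j =
      F.commonDen * F.fullAssets r i := by
  simp only [cast_coeffE, cast_coeffC, fullAssets]
  have h : ∀ k, ∑ j, (1 - r k) * (F.cds j i k : ℝ) = (1 - r k) * ∑ j, (F.cds j i k : ℝ) :=
    fun k => by rw [Finset.mul_sum]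
  simp only [h, mul_add, Finset.mul_sum _ _ (F.commonDen : ℝ)]
  rw [add_assoc]
  congr 1
  rw [← Finset.sum_add_distrib, ← Finset.sum_add_distrib]
  refine Finset.sum_congr rfl fun k _ => ?_
  rw [← Finset.mul_sum]
  ring

lemma fullAssets_nonneg (F : FinancialNetwork n) {r : Fin n → ℝ}
    (hr : ∀ i, 0 ≤ r i ∧ r i ≤ 1) (i : Fin n) : 0 ≤ F.fullAssets r i := by
  refine add_nonneg (NNRat.cast_nonneg _) (add_nonneg ?_ ?_)
  · exact Finset.sum_nonneg fun k _ => mul_nonneg (hr k).1 (NNRat.cast_nonneg _)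
  · exact Finset.sum_nonneg fun k _ => Finset.sum_nonneg fun j _ =>
      mul_nonneg (sub_nonneg.2 (hr k).2) (NNRat.cast_nonneg _)

/-- Clearing vectors of networks with a central CDS debtor. -/
lemma CentralCDSDebtor.isClearing {F : FinancialNetwork n} (hF : F.CentralCDSDebtor)
    {r : Fin n → ℝ} (hr : ∀ i, 0 ≤ r i ∧ r i ≤ 1) (h0 : ∀ i, F.debtSum i = 0 → r i = 1)
    (hle : ∀ i, F.debtSum i * r i ≤ F.fullAssets r i)
    (heq : ∀ i, r i = 1 ∨ F.debtSum i * r i = F.fullAssets r i) : F.IsClearing r := by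
  obtain ⟨d, hd, hdebt, hassets⟩ := hF
  have hrd : r d = 1 := h0 d (by simp [debtSum, hdebt])
  have hcds : ∀ i j k, i ≠ d → F.cds i j k = 0 := fun i j k hi =>
    not_not.1 fun h => hi (hd i j k h)
  -- CDS payments come from `d` only, whose recovery rate is `1`; so the products of two recovery
  -- rates disappear.
  have htotal : ∀ i, F.totalAssets r i = F.fullAssets r i := by
    intro i
    unfold totalAssets fullAssets payment liability
    congr 1
    simp only [mul_add, Finset.sum_add_distrib]
    congr 1
    rw [Finset.sum_comm]
    refine Finset.sum_congr rfl fun j _ => ?_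
    rw [Finset.mul_sum]
    refine Finset.sum_congr rfl fun k _ => ?_
    rcases eq_or_ne j d with rfl | hj
    · rw [hrd, one_mul]
    · simp [hcds j i k hj]
  refine ⟨fun i => hr i, fun i => ?_⟩
  rcases eq_or_ne i d with rfl | hi
  · refine ⟨fun hpos => ?_, fun _ => hrd⟩
    rw [hrd, min_eq_left]
    rw [le_div_iff₀ hpos, one_mul]
    -- The liabilities of the central debtor are at most its CDS notionals, so its quotient is at
    -- least `1`.
    have h1 : F.totalLiability r i ≤ (F.assets i : ℝ) := by
      have h2 : ((∑ j, ∑ k, F.cds i j k : ℚ≥0) : ℝ) ≤ (F.assets i : ℝ) := NNRat.cast_le.2 hassets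
      refine le_trans ?_ h2
      push_cast
      refine Finset.sum_le_sum fun j _ => ?_
      simp only [liability, hdebt, NNRat.cast_zero, zero_add]
      refine Finset.sum_le_sum fun k _ => ?_
      have h3 : (0 : ℝ) ≤ F.cds i j k := NNRat.cast_nonneg _
      nlinarith [(hr k).1]
    refine h1.trans ?_
    unfold totalAssets payment liability
    refine le_add_of_nonneg_right (Finset.sum_nonneg fun j _ => mul_nonneg (hr j).1
      (add_nonneg (NNRat.cast_nonneg _) (Finset.sum_nonneg fun k _ =>
        mul_nonneg (sub_nonneg.2 (hr k).2) (NNRat.cast_nonneg _))))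
  · have hl : F.totalLiability r i = F.debtSum i := by
      unfold totalLiability liability debtSum
      refine Finset.sum_congr rfl fun j _ => ?_
      simp [hcds i j _ hi]
    rw [hl, htotal]
    refine ⟨fun hpos => ?_, h0 i⟩
    have h1 : r i ≤ F.fullAssets r i / F.debtSum i := by
      rw [le_div_iff₀ hpos, mul_comm]
      exact hle i
    rcases heq i with h | h
    · rw [h] at h1 ⊢
      rw [min_eq_left h1]
    · have h2 : r i = F.fullAssets r i / F.debtSum i := by
        rw [eq_div_iff hpos.ne', mul_comm]
        exact h
      rw [← h2, min_eq_right (hr i).2]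

lemma exists_accepted (F : FinancialNetwork n) : ∃ k < 2 ^ n, Accepted n F.scaledRat k := by
  have hD : (0 : ℝ) < F.commonDen := Int.cast_pos.2 F.commonDen_pos
  refine Clearing.exists_accepted (fun i => ?_) fun r hr i => ?_
  · rw [← Int.cast_nonneg_iff (R := ℝ), cast_coeffL]
    exact mul_nonneg hD.le (Finset.sum_nonneg fun j _ => NNRat.cast_nonneg _)
  · rw [cast_assets]
    exact mul_nonneg hD.le (F.fullAssets_nonneg (fun i => ⟨hr.1 i, hr.2 i⟩) i)

/-- The integer tests are the conditions of `CentralCDSDebtor.isClearing` multiplied by positive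
factors: the squared determinant, and for the liabilities also the common denominator. -/
lemma CentralCDSDebtor.isClearing_of_accepted {F : FinancialNetwork n} (hF : F.CentralCDSDebtor)
    {k : ℕ} (hk : Accepted n F.scaledRat k) :
    F.IsClearing fun i => (candidate n F.scaledRat k i : ℝ) /
      ((regionDet n F.scaledRat k : ℝ) * regionDet n F.scaledRat k) := by
  obtain ⟨hdet, hacc⟩ := hk
  set g := F.scaledRat with hg
  have hD : (0 : ℝ) < F.commonDen := Int.cast_pos.2 F.commonDen_pos
  have hdet' : (regionDet n g k : ℝ) ≠ 0 := Int.cast_ne_zero.2 hdet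
  have hq : 0 < (regionDet n g k : ℝ) * regionDet n g k := mul_self_pos.2 hdet'
  set q : ℝ := (regionDet n g k : ℝ) * regionDet n g k with hqdef
  set r : Fin n → ℝ := fun i => (candidate n g k i : ℝ) / q with hr
  have hX : ∀ i, (candidate n g k i : ℝ) = q * r i := fun i => by
    simp only [hr]
    field_simp
  have hY : ∀ i, (candidateAssets n g k i : ℝ) = F.commonDen * (q * F.fullAssets r i) := by
    intro i
    rw [mul_left_comm, ← cast_assets, candidateAssets]
    push_cast
    rw [← hqdef, mul_add, Finset.mul_sum, mul_comm]
    congr 1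
    exact Finset.sum_congr rfl fun j _ => by rw [hX]; ring
  refine hF.isClearing ?_ ?_ ?_ ?_ <;> intro i <;> obtain ⟨h1, h2, h3⟩ := hacc i <;>
    obtain ⟨h4, h5⟩ := candidate_spec (n := n) (g := g) (k := k) i
  · rw [← Int.cast_nonneg_iff (R := ℝ), hX] at h1
    rw [← Int.cast_nonneg_iff (R := ℝ)] at h2
    push_cast at h2
    rw [hX, ← hqdef] at h2
    constructor
    · exact nonneg_of_mul_nonneg_right h1 hq
    · nlinarith
  · intro h
    have h6 : coeffL g i = 0 := by
      have := cast_coeffL F i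
      rw [h, mul_zero] at this
      exact_mod_cast this
    have h7 := congrArg (Int.cast (R := ℝ)) (h4 h6)
    push_cast at h7
    rw [hX, ← hqdef] at h7
    exact mul_left_cancel₀ hq.ne' (h7.trans (mul_one q).symm)
  · rw [← Int.cast_nonneg_iff (R := ℝ)] at h3
    push_cast at h3
    rw [hY, hX, hg, cast_coeffL] at h3
    have h8 : 0 ≤ (F.commonDen * q) * (F.fullAssets r i - F.debtSum i * r i) := by linarith
    exact sub_nonneg.1 (nonneg_of_mul_nonneg_right h8 (mul_pos hD hq))
  · refine h5.imp (fun h => ?_) fun h => ?_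
    · have h7 := congrArg (Int.cast (R := ℝ)) h
      push_cast at h7
      rw [hX, ← hqdef] at h7
      exact mul_left_cancel₀ hq.ne' (h7.trans (mul_one q).symm)
    · have h7 := congrArg (Int.cast (R := ℝ)) h
      push_cast at h7
      rw [hY, hX, hg, cast_coeffL] at h7
      refine mul_left_cancel₀ (mul_pos hD hq).ne' ?_
      linarith

end FinancialNetwork

/-! ### The algorithm -/

open RAM Clearing FinancialNetwork in
theorem mainTheorem6 :
    ∃ (P : RAM.Program) (p : Polynomial ℕ),
      ∀ (n : ℕ) (F : FinancialNetwork n), F.NonDegenerate → F.CentralCDSDebtor →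
        ∃ (m : RAM.Memory) (t : ℕ) (r : Fin n → ℚ),
          RAM.Runs P (RAM.initial F.encode) m t ∧
          t ≤ p.eval (RAM.listBitLength F.encode) * 2 ^ n ∧
          RAM.Outputs m r ∧
          F.IsClearing (fun i => (r i : ℝ)) := by
  -- The unit cost is at most `2 * 2 ^ n` for the regions, times `L` for the rounds of the
  -- iteration, times `32 * L ^ 2` for the register length, times `4 * L ^ 2` for a tabulation.
  refine ⟨solver, Polynomial.C (solver.weight * 256) * Polynomial.X ^ 5, fun n F _ hF => ?_⟩
  have hn : 0 < n := by
    obtain ⟨d, -⟩ := hF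
    exact d.pos
  have hL := inputSize_lt_listBitLength F
  obtain ⟨m, t, hrun, ht, k, hk, hnum, hden⟩ := solver_halts hn hL (initial_bounded F)
    (initial_zero_zero F) (by simp [initial]) (by simp [initial]) (initial_num F) (initial_den F)
    (bd_ratNum F) (bd_prod_ratDen F) F.exists_accepted
  set g := scaled n F.ratNum F.ratDen with hg
  refine ⟨m, t, fun i => (candidate n g k i : ℚ) / ((regionDet n g k * regionDet n g k : ℤ) : ℚ),
    hrun, ht.trans ?_, fun i => ⟨?_, ?_⟩, ?_⟩
  · rw [Polynomial.eval_mul, Polynomial.eval_C, Polynomial.eval_pow, Polynomial.eval_X]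
    set L := listBitLength F.encode
    have hnL : n + 1 ≤ L := by
      have : inputSize n = n + n * n + n * n * n := rfl
      omega
    rw [Nat.mul_assoc, Nat.mul_assoc]
    apply Nat.mul_le_mul_left
    have h1 : 2 ^ n + 1 ≤ 2 * 2 ^ n := by
      have := Nat.one_le_two_pow (n := n)
      omega
    have h2 : cap L ≤ 32 * L ^ 2 := by
      unfold cap
      nlinarith
    have h3 : (L + 1) * (L + 1) ≤ 4 * L ^ 2 := by nlinarith
    calc (2 ^ n + 1) * ((n + 1) * tabUnit L)
        ≤ (2 * 2 ^ n) * (L * ((32 * L ^ 2) * (4 * L ^ 2))) :=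
          Nat.mul_le_mul h1 (Nat.mul_le_mul hnL (Nat.mul_le_mul h2 h3))
      _ = 256 * (L ^ 5 * 2 ^ n) := by ring
  · rw [hden i]
    exact mul_self_pos.2 hk.1
  · rw [hnum i, hden i]
  · convert hF.isClearing_of_accepted hk using 2 with i
    push_cast
    rfl
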